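/- **Problem.** Let $n\ge 1$, let $f_1,\dots,f_n:\mathbb R^d\to\mathbb R$ be differentiable and $f=\frac1n\sum_{i=1}^n f_i$. Assume: $f$ is $L$-smooth and each $f_i$ is $L_i$-smooth (gradients Lipschitz with constants $L$, $L_i$); $f(x)\ge f^*$ for all $x$; for constants $L_A,L_B\ge 0$ and all $x,u_1,\dots,u_n\in\mathbb R^d$, $$\Big\|\frac1n\sum_{i=1}^n(\nabla f_i(x+u_i)-\nabla f_i(x))\Big\|^2\le L_A^2\,\frac1n\sum_{i=1}^n\|u_i\|^2+L_B^2\Big\|\frac1n\sum_{i=1}^n u_i\Big\|^2 ;$$ and each worker $i$ has stochastic gradients $\nabla f_i(x;\xi)$, $\xi\sim\mathcal D_i$, with $\mathbb E\nabla f_i(x;\xi)=\nabla f_i(x)$ and $\mathbb E\|\nabla f_i(x;\xi)-\nabla f_i(x)\|^2\le\sigma^2$ for all $x$, where $\sigma>0$. Put $L_{\max}=\max\{\max_i L_i,L_A,L_B\}$ and $\Delta=f(x^0)-f^*$. For $\omega\ge0$, $\mathbb U(\omega)$ is the class of random maps $\mathcal C:\mathbb R^d\to\mathbb R^d$ with $\mathbb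 E\,\mathcal C(x)=x$ and $\mathbb E\|\mathcal C(x)-x\|^2\le\omega\|x\|^2$ for all $x$. **Method (M4).** Given $x^0\in\mathbb R^d$, square-integrable initial vectors $v_i^0$ (deterministic or random), $\gamma>0$, $p_{\rm s},p,\nu,\mu\in(0,1]$, $b\ge1$, $\omega_{\rm s},\omega\ge0$, compressors $\mathcal C_{{\rm s},i}^k\in\mathbb U(\omega_{\rm s})$ and $\mathcal C_i^k\in\mathbb U(\omega)$, set $w_i^0=x_i^0=x^0$, $g^0=\frac1n\sum_i v_i^0$ and iterate, for $k\ge0$ and all $i$, $$x^{k+1}=x^k-\gamma g^k,\qquad w_i^{k+1}=\begin{cases}x^{k+1}&\text{with prob. }p_{\rm s}\\ w_i^k+\mathcal C_{{\rm s},i}^k(x^{k+1}-x^k)&\text{with prob. }1-p_{\rm s}\end{cases},\qquad x_i^{k+1}=(1-\mu)x_i^k+\mu w_i^{k+1},$$ $$v_i^{k+1}=(1-\nu)v_i^k+\frac{\nu}{b}\sum_{r=1}^b\nabla f_i(x_i^{k+1};\xi_{ir}^{k+1}),\qquad g^{k+1}=\begin{cases}\frac1n\sum_i v_i^{k+1}&\text{with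 prob. }p\\ g^k+\frac1n\sum_i\mathcal C_i^k(v_i^{k+1}-v_i^k)&\text{with prob. }1-p\end{cases}.$$ The first coin is shared by all workers; the family $(v_i^0)_{i}$ (as one random object), all coins, all compressors and all samples $\xi_{ir}^{k+1}\sim\mathcal D_i$ are mutually independent. With $v^k=\frac1n\sum_i v_i^k$ let $$\begin{aligned}\Psi^k={}&f(x^k)-f^*+\lambda_A\|g^k-v^k\|^2+\lambda_B\Big\|v^k-\frac1n\sum_i\nabla f_i(x_i^k)\Big\|^2+\frac{\lambda_C}{n}\sum_i\|v_i^k-\nabla f_i(x_i^k)\|^2+\frac{\lambda_D}{n}\sum_i\|w_i^k-x_i^k\|^2\\&+\frac{\lambda_E}{n}\sum_i\|w_i^k-x^k\|^2+\lambda_F\Big\|\frac1n\sum_i(w_i^k-x_i^k)\Big\|^2+\lambda_G\Big\|\frac1n\sum_i w_i^k-x^k\Big\|^2,\end{aligned}$$ where $\lambda_A=\frac{3\gamma}{2p}$, $\lambda_B=\frac{3\gamma}{2\nu}$, $\lambda_C=\frac{3\nu\omega\gamma}{np}$, $\lambda_D=\gamma\big(\frac{27\mu L_A^2}{\nu^2}+\frac{72\mu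 L_{\max}^2\omega}{np}+\frac{6L_A^2}{\mu}\big)$, $\lambda_E=\gamma\big(\frac{336\omega L_{\max}^2}{np}(\mu+p_{\rm s})+\frac{126L_A^2}{\nu^2}(\mu+p_{\rm s})+48L_A^2(\frac1{p_{\rm s}}+\frac{p_{\rm s}}{\mu^2})\big)$, $\lambda_F=\gamma\big(\frac{27\mu L_B^2}{\nu^2}+\frac{6L_B^2}{\mu}\big)$, $\lambda_G=\gamma\big(\frac{128L_B^2}{\nu^2}(p_{\rm s}+\mu)+48L_B^2(\frac{p_{\rm s}}{\mu^2}+\frac1{p_{\rm s}})\big)$. Let $\varepsilon>0$. In the step-size conditions below, $\gamma\le S^{-1}$ means $\gamma S\le1$. **Theorem.** (a) *General parameters.* If $\gamma\le\big(L+\sqrt{1416(\tilde C_AL_A^2+\tilde C_BL_B^2+\tilde C_{\max}L_{\max}^2)}\big)^{-1}$ with $\tilde C_A=\frac{\omega_{\rm s}(p_{\rm s}+\mu)+1}{\nu^2}+\frac{\omega_{\rm s}p_{\rm s}+1}{\mu^2}+\frac{\omega_{\rm s}}{p_{\rm s}}$, $\tilde C_B=\frac{\frac{\omega_{\rm s}}n(p_{\rm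 s}+\mu)+1}{\nu^2}+\frac{\frac{\omega_{\rm s}}np_{\rm s}+1}{\mu^2}+\frac{\omega_{\rm s}}{np_{\rm s}}$, $\tilde C_{\max}=\frac{\mu\omega\omega_{\rm s}}{np}+\frac{\omega(1+\omega_{\rm s}p_{\rm s})}{np}$, and if $\frac{9\nu^2\omega\sigma^2}{npb}+\frac{3\nu\sigma^2}{nb}\le\frac\varepsilon2$, then $\Psi^0$ and all $\|\nabla f(x^k)\|^2$ are integrable and for every $K\ge1$ $$\frac1K\sum_{k=0}^{K-1}\mathbb E\|\nabla f(x^k)\|^2\le\frac{2\,\mathbb E\Psi^0}{\gamma K}+\frac\varepsilon2.\tag{1}$$ (b) *Equal momentum.* Let $p_{\rm s}=\frac1{\omega_{\rm s}+1}$, $p=\frac1{\omega+1}$ and $$\nu=\mu=\eta=\min\Big\{\tfrac16\sqrt{\tfrac{bn\varepsilon}{\omega(\omega+1)\sigma^2}},\ \tfrac{bn\varepsilon}{6\sigma^2},\ \big(\tfrac{n}{\omega(\omega+1)\omega_{\rm s}}\big)^{1/3},\ 1\Big\}$$ (terms with denominator $0$ are $+\infty$). If $$\gamma\le\Big(6\sqrt{1416\big(\omega_{\rm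 s}(\omega_{\rm s}+1)L_A^2+\tfrac{\omega_{\rm s}}n(\omega_{\rm s}+1)L_B^2+(\tfrac{\omega(\omega+1)}n+\tfrac1{\eta^2})L_{\max}^2\big)}\Big)^{-1},$$ then $\Psi^0$ and all $\|\nabla f(x^k)\|^2$ are integrable and (1) holds for every $K\ge1$. (c) *Iteration complexity.* There is a universal constant $c>0$ such that the following holds. In the setting of (b) let moreover $v_i^0=\frac1{b_{\rm init}}\sum_{r=1}^{b_{\rm init}}\nabla f_i(x^0;\xi_{ir}^0)$ with independent samples $\xi_{ir}^0\sim\mathcal D_i$ and any integer $b_{\rm init}\ge\sqrt{\frac b\eta\big(1+\frac{\sigma^2}{n\varepsilon}\big)}$ (for example the least one). Put $$R=\frac{\Delta}{\gamma\varepsilon}+\sqrt{\max\Big\{\sqrt{\tfrac{\omega(\omega+1)\sigma^2}{bn\varepsilon}},\ \tfrac{\sigma^2}{bn\varepsilon},\ \big(\tfrac{\omega(\omega+1)\omega_{\rm s}}n\big)^{1/3},\ 1\Big\}\,\tfrac1b\Big(1+\tfrac{\sigma^2}{n\varepsilon}\Big)}.$$ Then M4 finds an $\varepsilon$-stationary point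 after at most $cR$ iterations: for some integer $T$ with $0\le T\le cR$, and moreover for every integer $T\ge0$ with $T+1\ge cR$, an iterate $\bar x$ drawn uniformly from $x^0,\dots,x^T$, independently of the run, satisfies $\mathbb E\|\nabla f(\bar x)\|^2\le\varepsilon$. -/

import Mathlib

open MeasureTheory ProbabilityTheory

universe u v w

noncomputable section

namespace M4

/-- The space `ℝ^d` with the Euclidean norm. -/
abbrev Vec (d : ℕ) := EuclideanSpace ℝ (Fin d)

/-- The average `(1/n) ∑ᵢ uᵢ` over the `n` workers. -/
def avg {n : ℕ} {V : Type*} [AddCommGroup V] [Module ℝ V] (u : Fin n → V) : V :=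
  (1 / (n : ℝ)) • ∑ i, u i

/-! ### The optimization problem -/

/-- `f` is differentiable and its gradient is `L`-Lipschitz. -/
def IsSmooth {d : ℕ} (f : Vec d → ℝ) (L : ℝ) : Prop :=
  0 ≤ L ∧ Differentiable ℝ f ∧ ∀ x y, ‖gradient f x - gradient f y‖ ≤ L * ‖x - y‖

/-- The objective `f = (1/n) ∑ᵢ fᵢ`. -/
def objective {n d : ℕ} (F : Fin n → Vec d → ℝ) : Vec d → ℝ :=
  fun x => avg fun i => F i x

/-- Functional `(L_A, L_B)` similarity of `f₁, …, fₙ`. -/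
def IsSimilar {n d : ℕ} (F : Fin n → Vec d → ℝ) (LA LB : ℝ) : Prop :=
  0 ≤ LA ∧ 0 ≤ LB ∧ ∀ (x : Vec d) (u : Fin n → Vec d),
    ‖avg fun i => gradient (F i) (x + u i) - gradient (F i) x‖ ^ 2
      ≤ LA ^ 2 * avg (fun i => ‖u i‖ ^ 2) + LB ^ 2 * ‖avg u‖ ^ 2

/-- `L_max = max {maxᵢ Lᵢ, L_A, L_B}`. -/
def Lmax {n : ℕ} (Li : Fin n → ℝ) (LA LB : ℝ) : ℝ := max (⨆ i, Li i) (max LA LB)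

/-- `G x ξ` is an unbiased stochastic gradient of `f` at `x` with variance at most `σ²`,
when `ξ` has law `D`. -/
structure IsStochasticGradient {d : ℕ} {Ξ : Type*} [MeasurableSpace Ξ]
    (f : Vec d → ℝ) (D : Measure Ξ) (G : Vec d → Ξ → Vec d) (σ : ℝ) : Prop where
  isProbabilityMeasure : IsProbabilityMeasure D
  measurable : Measurable (Function.uncurry G)
  memLp : ∀ x, MemLp (G x) 2 D
  unbiased : ∀ x, ∫ ξ, G x ξ ∂D = gradient f x
  variance_le : ∀ x, ∫ ξ, ‖G x ξ - gradient f x‖ ^ 2 ∂D ≤ σ ^ 2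

/-- The standing assumptions on the problem: smoothness of `f` and of every `fᵢ`, `f ≥ f*`,
`(L_A, L_B)` similarity, and unbiased stochastic gradients with `σ²`-bounded variance. -/
structure Assumptions {n d : ℕ} {Ξ : Type*} [MeasurableSpace Ξ]
    (F : Fin n → Vec d → ℝ) (L : ℝ) (Li : Fin n → ℝ) (LA LB fstar σ : ℝ)
    (D : Fin n → Measure Ξ) (G : Fin n → Vec d → Ξ → Vec d) : Prop where
  smooth : IsSmooth (objective F) L
  smooth_worker : ∀ i, IsSmooth (F i) (Li i)
  lower_bound : ∀ x, fstar ≤ objective F x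
  similar : IsSimilar F LA LB
  sigma_pos : 0 < σ
  stochastic : ∀ i, IsStochasticGradient (F i) (D i) (G i) σ

/-! ### Compressors and the randomness of the method -/

/-- The stochastic mapping `x ↦ C x θ`, with random seed `θ` of law `ρ`, is an unbiased compressor
of class `𝕌(ω)`. -/
structure IsUnbiasedCompressor {d : ℕ} {Θ : Type*} [MeasurableSpace Θ]
    (ρ : Measure Θ) (C : Vec d → Θ → Vec d) (ω : ℝ) : Prop where
  measurable : Measurable (Function.uncurry C)
  memLp : ∀ x, MemLp (C x) 2 ρ
  unbiased : ∀ x, ∫ θ, C x θ ∂ρ = x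
  variance_le : ∀ x, ∫ θ, ‖C x θ - x‖ ^ 2 ∂ρ ≤ ω * ‖x‖ ^ 2

/-- All random objects of the method, on a sample space `Ω`.
`ξ i k r` is the `r`-th sample of worker `i` in iteration `k` (the one usually written
`ξ_{ir}^{k+1}`); the compressors used in iteration `k` are `Cs i k` (server to worker `i`) and
`C i k` (worker `i` to server), with random seeds `seedS i k` and `seed i k`. -/
structure Noise (Ω : Type*) (Ξ : Type*) (Θ : Type*) (n d b : ℕ) where
  /-- the initial vectors `vᵢ⁰` -/
  v0 : Fin n → Ω → Vec d
  /-- synchronization of the `wᵢ` in iteration `k`: one coin for all workers -/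
  coinS : ℕ → Ω → Bool
  /-- synchronization of `g` in iteration `k` -/
  coin : ℕ → Ω → Bool
  seedS : Fin n → ℕ → Ω → Θ
  seed : Fin n → ℕ → Ω → Θ
  Cs : Fin n → ℕ → Vec d → Θ → Vec d
  C : Fin n → ℕ → Vec d → Θ → Vec d
  ξ : Fin n → ℕ → Fin b → Ω → Ξ

/-- Labels of the sources of randomness. -/
inductive Source (n b : ℕ) where
  | init : Source n b
  | coinS (k : ℕ) : Source n b
  | coin (k : ℕ) : Source n b
  | seedS (i : Fin n) (k : ℕ) : Source n b
  | seed (i : Fin n) (k : ℕ) : Source n b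
  | sample (i : Fin n) (k : ℕ) (r : Fin b) : Source n b

section

variable {Ω : Type*} {Ξ : Type*} {Θ : Type*} {n d b : ℕ}

/-- The σ-algebra generated by a source of randomness. -/
@[reducible] def Noise.sigma [MeasurableSpace Ξ] [MeasurableSpace Θ] (N : Noise Ω Ξ Θ n d b) :
    Source n b → MeasurableSpace Ω
  | .init => MeasurableSpace.comap (fun ω i => N.v0 i ω) inferInstance
  | .coinS k => MeasurableSpace.comap (N.coinS k) inferInstance
  | .coin k => MeasurableSpace.comap (N.coin k) inferInstance
  | .seedS i k => MeasurableSpace.comap (N.seedS i k) inferInstance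
  | .seed i k => MeasurableSpace.comap (N.seed i k) inferInstance
  | .sample i k r => MeasurableSpace.comap (N.ξ i k r) inferInstance

/-- The random objects have the laws prescribed by the method (coins with success probabilities
`ps` and `p`, compressors in `𝕌(ωs)` and `𝕌(ω)`, samples of worker `i` with law `D i`), the initial
vectors are square integrable, and all sources of randomness are mutually independent (the initial
vectors of the different workers are one source: they need not be independent of each other). -/
structure Noise.Valid [MeasurableSpace Ω] [MeasurableSpace Ξ] [MeasurableSpace Θ]
    (N : Noise Ω Ξ Θ n d b) (P : Measure Ω) (D : Fin n → Measure Ξ) (ps p ωs ω : ℝ) : Prop where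
  v0_measurable : ∀ i, Measurable (N.v0 i)
  v0_memLp : ∀ i, MemLp (N.v0 i) 2 P
  coinS_measurable : ∀ k, Measurable (N.coinS k)
  coinS_law : ∀ k, P {z | N.coinS k z = true} = ENNReal.ofReal ps
  coin_measurable : ∀ k, Measurable (N.coin k)
  coin_law : ∀ k, P {z | N.coin k z = true} = ENNReal.ofReal p
  seedS_measurable : ∀ i k, Measurable (N.seedS i k)
  compressorS : ∀ i k, IsUnbiasedCompressor (P.map (N.seedS i k)) (N.Cs i k) ωs
  seed_measurable : ∀ i k, Measurable (N.seed i k)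
  compressor : ∀ i k, IsUnbiasedCompressor (P.map (N.seed i k)) (N.C i k) ω
  sample_measurable : ∀ i k r, Measurable (N.ξ i k r)
  sample_law : ∀ i k r, P.map (N.ξ i k r) = D i
  independent : iIndep N.sigma P

end

/-! ### The method -/

/-- The variables `(x^k, (wᵢ^k)ᵢ, (xᵢ^k)ᵢ, (vᵢ^k)ᵢ, g^k)` of the method. -/
structure State (n d : ℕ) where
  x : Vec d
  w : Fin n → Vec d
  xw : Fin n → Vec d
  v : Fin n → Vec d
  g : Vec d

/-- Initialization: `wᵢ⁰ = xᵢ⁰ = x⁰` and `g⁰ = (1/n) ∑ᵢ vᵢ⁰`. -/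
def State.initial {n d : ℕ} (x0 : Vec d) (v0 : Fin n → Vec d) : State n d where
  x := x0
  w := fun _ => x0
  xw := fun _ => x0
  v := v0
  g := avg v0

/-- One iteration, for given outcomes `cS`, `c` of the coins, given realizations `Cs i`, `C i` of
the compressors, and given realizations `G i r` of the stochastic gradients of worker `i`. -/
def State.step {n d b : ℕ} (γ μ ν : ℝ) (cS c : Bool) (Cs C : Fin n → Vec d → Vec d)
    (G : Fin n → Fin b → Vec d → Vec d) (s : State n d) : State n d :=
  let x' : Vec d := s.x - γ • s.g
  let w' : Fin n → Vec d := fun i => if cS then x' else s.w i + Cs i (x' - s.x)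
  let xw' : Fin n → Vec d := fun i => (1 - μ) • s.xw i + μ • w' i
  let v' : Fin n → Vec d := fun i => (1 - ν) • s.v i + (ν / (b : ℝ)) • ∑ r, G i r (xw' i)
  let g' : Vec d := if c then avg v' else s.g + avg fun i => C i (v' i - s.v i)
  { x := x', w := w', xw := xw', v := v', g := g' }

/-- The iterates of the method M4. -/
def iterate {Ω : Type*} {Ξ : Type*} {Θ : Type*} {n d b : ℕ} (N : Noise Ω Ξ Θ n d b)
    (G : Fin n → Vec d → Ξ → Vec d) (x0 : Vec d) (γ μ ν : ℝ) : ℕ → Ω → State n d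
  | 0, z => State.initial x0 fun i => N.v0 i z
  | k + 1, z =>
    State.step γ μ ν (N.coinS k z) (N.coin k z)
      (fun i y => N.Cs i k y (N.seedS i k z)) (fun i y => N.C i k y (N.seed i k z))
      (fun i r y => G i y (N.ξ i k r z)) (iterate N G x0 γ μ ν k z)

/-- The initial vectors are minibatch gradients at `x⁰`,
`vᵢ⁰ = (1/B) ∑_{r ≤ B} ∇fᵢ(x⁰; ξ_{ir}⁰)`, with independent samples `ξ_{ir}⁰` of law `D i`. -/
structure IsMinibatchInit {Ω : Type*} {Ξ : Type*} {n d : ℕ}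
    [MeasurableSpace Ω] [MeasurableSpace Ξ] (v0 : Fin n → Ω → Vec d) (P : Measure Ω)
    (D : Fin n → Measure Ξ) (G : Fin n → Vec d → Ξ → Vec d) (x0 : Vec d) (B : ℕ)
    (ξ0 : Fin n → Fin B → Ω → Ξ) : Prop where
  measurable : ∀ i r, Measurable (ξ0 i r)
  law : ∀ i r, P.map (ξ0 i r) = D i
  independent : iIndepFun (fun (j : Fin n × Fin B) => ξ0 j.1 j.2) P
  v0_eq : ∀ i z, v0 i z = (1 / (B : ℝ)) • ∑ r, G i x0 (ξ0 i r z)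

/-! ### The Lyapunov function -/

section

variable (n : ℕ) (LA LB LM γ ps p ν μ ω : ℝ)

def lamA : ℝ := 3 * γ / (2 * p)

def lamB : ℝ := 3 * γ / (2 * ν)

def lamC : ℝ := 3 * ν * ω * γ / (n * p)

def lamD : ℝ :=
  γ * (27 * μ * LA ^ 2 / ν ^ 2 + 72 * μ * LM ^ 2 * ω / (n * p) + 6 * LA ^ 2 / μ)

def lamE : ℝ :=
  γ * (336 * ω * LM ^ 2 / (n * p) * (μ + ps) + 126 * LA ^ 2 / ν ^ 2 * (μ + ps)
    + 48 * LA ^ 2 * (1 / ps + ps / μ ^ 2))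

def lamF : ℝ := γ * (27 * μ * LB ^ 2 / ν ^ 2 + 6 * LB ^ 2 / μ)

def lamG : ℝ :=
  γ * (128 * LB ^ 2 / ν ^ 2 * (ps + μ) + 48 * LB ^ 2 * (ps / μ ^ 2 + 1 / ps))

end

/-- The Lyapunov function `Ψ`, evaluated at a state of the method. -/
def lyapunov {n d : ℕ} (F : Fin n → Vec d → ℝ) (fstar LA LB LM γ ps p ν μ ω : ℝ)
    (s : State n d) : ℝ :=
  (objective F s.x - fstar)
  + lamA γ p * ‖s.g - avg s.v‖ ^ 2
  + lamB γ ν * ‖avg s.v - avg fun i => gradient (F i) (s.xw i)‖ ^ 2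
  + lamC n γ p ν ω * avg (fun i => ‖s.v i - gradient (F i) (s.xw i)‖ ^ 2)
  + lamD n LA LM γ p ν μ ω * avg (fun i => ‖s.w i - s.xw i‖ ^ 2)
  + lamE n LA LM γ ps p ν μ ω * avg (fun i => ‖s.w i - s.x‖ ^ 2)
  + lamF LB γ ν μ * ‖avg fun i => s.w i - s.xw i‖ ^ 2
  + lamG LB γ ps ν μ * ‖avg s.w - s.x‖ ^ 2

/-! ### Parameters -/

section

variable (n : ℕ) (LA LB LM ps p ν μ ωs ω : ℝ)

/-- `C̃_A L_A² + C̃_B L_B² + C̃_max L_max²`. -/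
def generalRate : ℝ :=
  ((ωs * (ps + μ) + 1) / ν ^ 2 + (ωs * ps + 1) / μ ^ 2 + ωs / ps) * LA ^ 2
  + ((ωs / n * (ps + μ) + 1) / ν ^ 2 + (ωs / n * ps + 1) / μ ^ 2 + ωs / (n * ps)) * LB ^ 2
  + (μ * ω * ωs / (n * p) + ω * (1 + ωs * ps) / (n * p)) * LM ^ 2

/-- `ωs(ωs+1) L_A² + (ωs/n)(ωs+1) L_B² + (ω(ω+1)/n + 1/η²) L_max²`. -/
def equalRate (η : ℝ) : ℝ :=
  ωs * (ωs + 1) * LA ^ 2 + ωs / n * (ωs + 1) * LB ^ 2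
    + (ω * (ω + 1) / n + 1 / η ^ 2) * LM ^ 2

end

/-- The momentum `η`, written as a reciprocal of a maximum so that a term of the minimum
`min {(1/6)√(bnε/(ω(ω+1)σ²)), bnε/(6σ²), (n/(ω(ω+1)ωs))^{1/3}, 1}` with a vanishing denominator
counts as `+∞`; see `eta_eq_min`. -/
def eta (n b : ℕ) (ε σ ωs ω : ℝ) : ℝ :=
  1 / max (max (6 * √(ω * (ω + 1) * σ ^ 2 / (b * n * ε))) (6 * σ ^ 2 / (b * n * ε)))
    (max ((ω * (ω + 1) * ωs / n) ^ ((1 : ℝ) / 3)) 1)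

/-- The maximum in the iteration complexity. -/
def rateMax (n b : ℕ) (ε σ ωs ω : ℝ) : ℝ :=
  max (max (√(ω * (ω + 1) * σ ^ 2 / (b * n * ε))) (σ ^ 2 / (b * n * ε)))
    (max ((ω * (ω + 1) * ωs / n) ^ ((1 : ℝ) / 3)) 1)

lemma one_div_max {x y : ℝ} (hx : 0 < x) (hy : 0 < y) : 1 / max x y = min (1 / x) (1 / y) := by
  rcases le_total x y with h | h
  · rw [max_eq_right h, min_eq_right (one_div_le_one_div_of_le hx h)]
  · rw [max_eq_left h, min_eq_left (one_div_le_one_div_of_le hy h)]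

lemma eta_eq_min (n b : ℕ) (ε σ ωs ω : ℝ) (hn : 1 ≤ n) (hb : 1 ≤ b) (hε : 0 < ε) (hσ : 0 < σ)
    (hωs : 0 < ωs) (hω : 0 < ω) :
    eta n b ε σ ωs ω =
      min (min (1 / 6 * √(b * n * ε / (ω * (ω + 1) * σ ^ 2))) (b * n * ε / (6 * σ ^ 2)))
        (min ((n / (ω * (ω + 1) * ωs)) ^ ((1 : ℝ) / 3)) 1) := by
  have hn' : (0 : ℝ) < n := by exact_mod_cast hn
  have hb' : (0 : ℝ) < b := by exact_mod_cast hb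
  have h1 : 0 < √(ω * (ω + 1) * σ ^ 2 / (b * n * ε)) := by positivity
  unfold eta
  rw [one_div_max (by positivity) (by positivity), one_div_max (by positivity) (by positivity),
    one_div_max (by positivity) one_pos]
  congr 1
  · congr 1
    · rw [← inv_div (ω * (ω + 1) * σ ^ 2) (b * n * ε), Real.sqrt_inv]
      field_simp
    · rw [one_div, inv_div]
  · congr 1
    · rw [← inv_div (ω * (ω + 1) * ωs) (n : ℝ), Real.inv_rpow (by positivity), one_div]
    · norm_num

/-! ### Stationary points -/

/-- The random point `X`, on a probability space with measure `Q`, is an `ε`-stationary point of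
`f`: `E‖∇f(X)‖² ≤ ε`. -/
def IsStationary {Ω' : Type*} [MeasurableSpace Ω'] {d : ℕ} (Q : Measure Ω') (f : Vec d → ℝ)
    (X : Ω' → Vec d) (ε : ℝ) : Prop :=
  Integrable (fun z => ‖gradient f (X z)‖ ^ 2) Q ∧ ∫ z, ‖gradient f (X z)‖ ^ 2 ∂Q ≤ ε

/-- After `T` iterations, an iterate chosen uniformly at random from `x⁰, …, x^T`, independently of
the run, is an `ε`-stationary point. -/
def FindsStationary {Ω : Type*} [MeasurableSpace Ω] {n d : ℕ} (P : Measure Ω) (f : Vec d → ℝ)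
    (S : ℕ → Ω → State n d) (T : ℕ) (ε : ℝ) : Prop :=
  IsStationary ((PMF.uniformOfFintype (Fin (T + 1))).toMeasure.prod P) f
    (fun z => (S z.1 z.2).x) ε

/-- `Ψ⁰` and all `‖∇f(x^k)‖²` are integrable, and for all `K ≥ 1`
`(1/K) ∑_{k<K} E‖∇f(x^k)‖² ≤ 2 E[Ψ⁰]/(γK) + ε/2`. -/
def AverageBound {Ω : Type*} [MeasurableSpace Ω] {n d : ℕ} (P : Measure Ω) (f : Vec d → ℝ)
    (S : ℕ → Ω → State n d) (Ψ : State n d → ℝ) (γ ε : ℝ) : Prop :=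
  Integrable (fun z => Ψ (S 0 z)) P ∧
  (∀ k, Integrable (fun z => ‖gradient f (S k z).x‖ ^ 2) P) ∧
  ∀ K : ℕ, 1 ≤ K →
    1 / (K : ℝ) * ∑ k ∈ Finset.range K, ∫ z, ‖gradient f (S k z).x‖ ^ 2 ∂P
      ≤ 2 * (∫ z, Ψ (S 0 z) ∂P) / (γ * K) + ε / 2

end M4

end

set_option linter.unusedSectionVars false

/-! The proof is a Lyapunov analysis of second moments. A step with an inexact gradient
(`IsSmooth.descent_step`) decreases f by γ/2‖∇f(x)‖² plus (1/(2γ) − L/2)‖x^{k+1} − x^k‖², at the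
cost γ/2‖g − ∇f(x)‖². This cost is split into the compression error g − v (`gErr`) and the estimator
error v − ∇f(x) (`vMeanErr`).

The mean estimator is compared with ∇f(x^k) and not, as in Ψ, with the mean of ∇fᵢ(xᵢ^k). The lag of
xᵢ behind x then enters through `heteroErr`, which similarity bounds by the distances wᵢ − xᵢ and wᵢ
− x, individually and on average. At k = 0 both comparisons agree because xᵢ⁰ = x⁰. Only Ψ⁰ occurs
in (1), so Ψ itself is never propagated; the proof uses its own weights.

Two facts give the recursions their constants. Fresh randomness is independent of what it acts on,
so the errors it adds have conditional mean zero and are pairwise orthogonal; averaging over workers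
or samples divides their variance (`Noise.Valid.error_sum`). Moreover the shared coin moves the mean
of w only by a fraction ps of x − w, and its variance is also of order ps (`mix_norm_sq_le`); hence
w − x feeds the error w − xᵢ with factor 2ps²/μ + ps instead of ps/μ.

All recursions are collected in `ErrorRecursion`, which concerns real sequences only. Weights for
which the sum decreases solve a triangular system (`ErrorRecursion.step`, `ErrorRecursion.sum_le`):
the errors of g and v first, then w − xᵢ, then w − x. What remains is the coefficient of E‖x^{k+1} −
x^k‖², which must not exceed 1/(2γ) − L/2; this is the step-size condition.

For equal momentum, the choice of η makes the noise at most a fixed part of ε and the general rate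
at most ten times the equal rate; f is then treated as L_max-smooth. For the complexity, the initial
worker errors are not charged to Ψ⁰, where they carry a factor 1/p. Their total effect on g − v is
at most (5/4)(ω/n)ν times their size, uniformly in time, because they decay like (1 − ν)^k
(`ErrorRecursion.remove_initial`). The choice of the initial batch makes this persistent bias a
fraction of ε. -/

namespace M4

/-! ### Unbiased random maps applied to independent random points. -/

section Oracle

variable {Ω Θ : Type*} [MeasurableSpace Ω] [MeasurableSpace Θ] {P : Measure Ω} {d : ℕ}

lemma integrable_norm_sq {U : Ω → Vec d} (hU : MemLp U 2 P) :
    Integrable (fun z => ‖U z‖ ^ 2) P :=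
  (memLp_two_iff_integrable_sq_norm hU.1).1 hU

lemma integrable_inner_of_memLp {U V : Ω → Vec d} (hU : MemLp U 2 P) (hV : MemLp V 2 P) :
    Integrable (fun z => inner ℝ (U z) (V z)) P := by
  refine ((integrable_norm_sq hU).add (integrable_norm_sq hV)).mono' (hU.1.inner hV.1)
    (ae_of_all _ fun z => ?_)
  have h := norm_inner_le_norm (𝕜 := ℝ) (U z) (V z)
  simp only [Pi.add_apply]
  nlinarith [sq_nonneg (‖U z‖ - ‖V z‖), sq_nonneg (‖U z‖), sq_nonneg (‖V z‖)]

/-- `K x θ` is, for `θ` of law `ρ`, a square integrable random vector with mean `m x` and variance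
at most `V x`, measurably in `x`. -/
structure IsOracle (ρ : Measure Θ) (K : Vec d → Θ → Vec d) (m : Vec d → Vec d)
    (V : Vec d → ℝ) : Prop where
  measurable : Measurable (Function.uncurry K)
  memLp : ∀ x, MemLp (K x) 2 ρ
  measurable_mean : Measurable m
  measurable_var : Measurable V
  mean : ∀ x, ∫ θ, K x θ ∂ρ = m x
  variance_le : ∀ x, ∫ θ, ‖K x θ - m x‖ ^ 2 ∂ρ ≤ V x

variable [IsProbabilityMeasure P] {K : Vec d → Θ → Vec d} {m : Vec d → Vec d} {V : Vec d → ℝ}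

lemma IsOracle.measurable_error {ρ : Measure Θ} (h : IsOracle ρ K m V) :
    Measurable fun z : Vec d × Θ => K z.1 z.2 - m z.1 :=
  h.measurable.sub (h.measurable_mean.comp measurable_fst)

/-- Independence makes the joint law a product, so the seed can be integrated out first with the
point frozen. Square integrability of the error is part of the conclusion, since the assumptions
only give it for each fixed point. -/
lemma IsOracle.error_sq {X : Ω → Vec d} {θ : Ω → Θ} (h : IsOracle (P.map θ) K m V)
    (hX : Measurable X) (hθ : Measurable θ) (hind : IndepFun X θ P)
    (hV : Integrable (fun z => V (X z)) P) :
    MemLp (fun z => K (X z) (θ z) - m (X z)) 2 P ∧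
      ∫ z, ‖K (X z) (θ z) - m (X z)‖ ^ 2 ∂P ≤ ∫ z, V (X z) ∂P := by
  have : IsProbabilityMeasure (P.map θ) := Measure.isProbabilityMeasure_map hθ.aemeasurable
  have : IsProbabilityMeasure (P.map X) := Measure.isProbabilityMeasure_map hX.aemeasurable
  have hmap := (indepFun_iff_map_prod_eq_prod_map_map hX.aemeasurable hθ.aemeasurable).1 hind
  have hmeas : Measurable fun z : Vec d × Θ => ‖K z.1 z.2 - m z.1‖ ^ 2 :=
    h.measurable_error.norm.pow_const 2
  have hV' : Integrable V (P.map X) :=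
    (integrable_map_measure h.measurable_var.aestronglyMeasurable hX.aemeasurable).2 hV
  have hsq : Integrable (fun z : Vec d × Θ => ‖K z.1 z.2 - m z.1‖ ^ 2)
      ((P.map X).prod (P.map θ)) := by
    refine (integrable_prod_iff hmeas.aestronglyMeasurable).2 ⟨ae_of_all _ fun x => ?_, ?_⟩
    · exact integrable_norm_sq ((h.memLp x).sub (memLp_const (m x)))
    · refine hV'.mono' ?_ (ae_of_all _ fun x => ?_)
      · exact (hmeas.norm.stronglyMeasurable.integral_prod_right').aestronglyMeasurable
      · rw [Real.norm_of_nonneg (by positivity)]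
        simpa using h.variance_le x
  have hsq' := hsq
  rw [← hmap] at hsq'
  have hpair : Measurable fun z => (X z, θ z) := hX.prodMk hθ
  constructor
  · have hm : Measurable fun z => K (X z) (θ z) - m (X z) := h.measurable_error.comp hpair
    exact (memLp_two_iff_integrable_sq_norm hm.aestronglyMeasurable).2
      (hsq'.comp_measurable hpair)
  · calc ∫ z, ‖K (X z) (θ z) - m (X z)‖ ^ 2 ∂P
        = ∫ y, ‖K y.1 y.2 - m y.1‖ ^ 2 ∂(P.map fun z => (X z, θ z)) :=
          (integral_map hpair.aemeasurable hmeas.aestronglyMeasurable).symm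
      _ = ∫ x, ∫ t, ‖K x t - m x‖ ^ 2 ∂(P.map θ) ∂(P.map X) := by
          rw [hmap, integral_prod _ hsq]
      _ ≤ ∫ x, V x ∂(P.map X) :=
          integral_mono hsq.integral_prod_left hV' fun x => h.variance_le x
      _ = ∫ z, V (X z) ∂P := integral_map hX.aemeasurable h.measurable_var.aestronglyMeasurable

/-- Given (U, X), the error has mean zero. Independence of the seed from the pair is needed, not
only from each component. -/
lemma IsOracle.integral_inner_error {X U : Ω → Vec d} {θ : Ω → Θ}
    (h : IsOracle (P.map θ) K m V) (hX : Measurable X) (hU : Measurable U) (hθ : Measurable θ)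
    (hind : IndepFun (fun z => (U z, X z)) θ P) (hV : Integrable (fun z => V (X z)) P)
    (hU2 : MemLp U 2 P) :
    ∫ z, inner ℝ (U z) (K (X z) (θ z) - m (X z)) ∂P = 0 := by
  have : IsProbabilityMeasure (P.map θ) := Measure.isProbabilityMeasure_map hθ.aemeasurable
  have hUX : Measurable fun z => (U z, X z) := hU.prodMk hX
  have hmap := (indepFun_iff_map_prod_eq_prod_map_map hUX.aemeasurable hθ.aemeasurable).1 hind
  have he := (h.error_sq hX hθ (hind.comp measurable_snd measurable_id) hV).1
  have hpair : Measurable fun z => ((U z, X z), θ z) := hUX.prodMk hθ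
  have hmeas : Measurable fun y : (Vec d × Vec d) × Θ =>
      inner ℝ y.1.1 (K y.1.2 y.2 - m y.1.2) :=
    (measurable_fst.comp measurable_fst).inner
      (h.measurable_error.comp ((measurable_snd.comp measurable_fst).prodMk measurable_snd))
  have hint : Integrable (fun y : (Vec d × Vec d) × Θ => inner ℝ y.1.1 (K y.1.2 y.2 - m y.1.2))
      ((P.map fun z => (U z, X z)).prod (P.map θ)) := by
    rw [← hmap, integrable_map_measure hmeas.aestronglyMeasurable hpair.aemeasurable]
    exact integrable_inner_of_memLp hU2 he
  calc ∫ z, inner ℝ (U z) (K (X z) (θ z) - m (X z)) ∂P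
      = ∫ y, inner ℝ y.1.1 (K y.1.2 y.2 - m y.1.2) ∂(P.map fun z => ((U z, X z), θ z)) :=
        (integral_map hpair.aemeasurable hmeas.aestronglyMeasurable).symm
    _ = 0 := by
        rw [hmap, integral_prod _ hint]
        refine integral_eq_zero_of_ae (ae_of_all _ fun y => ?_)
        have hi := (h.memLp y.2).integrable one_le_two
        simp only [Pi.zero_apply]
        rw [integral_inner (f := fun t => K y.2 t - m y.2) (hi.sub (integrable_const _)),
          integral_sub hi (integrable_const _), h.mean]
        simp

end Oracle

/-! ### Second moments of orthogonal sums and of coin mixtures. -/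

section Orthogonal

variable {Ω : Type*} [MeasurableSpace Ω] {P : Measure Ω} {d : ℕ}

lemma integral_norm_add_sq {U W : Ω → Vec d} (hU : MemLp U 2 P) (hW : MemLp W 2 P)
    (h : ∫ z, inner ℝ (U z) (W z) ∂P = 0) :
    ∫ z, ‖U z + W z‖ ^ 2 ∂P = ∫ z, ‖U z‖ ^ 2 ∂P + ∫ z, ‖W z‖ ^ 2 ∂P := by
  have h1 := integrable_norm_sq hU
  have h2 := integrable_norm_sq hW
  have h3 := (integrable_inner_of_memLp hU hW).const_mul 2
  simp_rw [norm_add_sq_real]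
  have h13 : Integrable (fun z => ‖U z‖ ^ 2 + 2 * inner ℝ (U z) (W z)) P := h1.add h3
  rw [integral_add h13 h2, integral_add h1 h3, integral_const_mul, h]
  ring

lemma integral_norm_add_sum_sq {J : Type*} (s : Finset J) {U : Ω → Vec d} {e : J → Ω → Vec d}
    (hU : MemLp U 2 P) (he : ∀ j, MemLp (e j) 2 P)
    (h0 : ∀ j, ∫ z, inner ℝ (U z) (e j z) ∂P = 0)
    (h : ∀ i j, i ≠ j → ∫ z, inner ℝ (e i z) (e j z) ∂P = 0) :
    ∫ z, ‖U z + ∑ j ∈ s, e j z‖ ^ 2 ∂P = ∫ z, ‖U z‖ ^ 2 ∂P + ∑ j ∈ s, ∫ z, ‖e j z‖ ^ 2 ∂P := by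
  classical
  induction s using Finset.induction_on with
  | empty => simp
  | insert a s ha ih =>
    have hs : MemLp (fun z => U z + ∑ j ∈ s, e j z) 2 P :=
      hU.add (memLp_finsetSum s fun j _ => he j)
    have hin : ∫ z, inner ℝ (U z + ∑ j ∈ s, e j z) (e a z) ∂P = 0 := by
      simp_rw [inner_add_left, sum_inner]
      rw [integral_add (integrable_inner_of_memLp hU (he a))
        (integrable_finsetSum _ fun j _ => integrable_inner_of_memLp (he j) (he a)), h0,
        integral_finsetSum _ fun j _ => integrable_inner_of_memLp (he j) (he a)]
      rw [zero_add]
      exact Finset.sum_eq_zero fun j hj => h j a fun hja => ha (hja ▸ hj)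
    have := integral_norm_add_sq hs (he a) hin
    rw [ih] at this
    rw [Finset.sum_insert ha, ← add_assoc, add_right_comm, ← this]
    refine integral_congr_ae (ae_of_all _ fun z => ?_)
    simp only [Finset.sum_insert ha]
    rw [add_comm (e a z), add_assoc]

/-- Adding pairwise uncorrelated errors with second moments at most `v j`. -/
lemma integral_norm_add_smul_sum_sq_le {J : Type*} [Fintype J] {U : Ω → Vec d}
    {e : J → Ω → Vec d} {v : J → ℝ} (a : ℝ) (hU : MemLp U 2 P) (he : ∀ j, MemLp (e j) 2 P)
    (h0 : ∀ j, ∫ z, inner ℝ (U z) (e j z) ∂P = 0)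
    (h : ∀ i j, i ≠ j → ∫ z, inner ℝ (e i z) (e j z) ∂P = 0)
    (hv : ∀ j, ∫ z, ‖e j z‖ ^ 2 ∂P ≤ v j) :
    ∫ z, ‖U z + a • ∑ j, e j z‖ ^ 2 ∂P ≤ ∫ z, ‖U z‖ ^ 2 ∂P + a ^ 2 * ∑ j, v j := by
  have := integral_norm_add_sum_sq (P := P) Finset.univ (U := U) (e := fun j z => a • e j z) hU
    (fun j => (he j).const_smul a)
    (fun j => by simp_rw [inner_smul_right, integral_const_mul, h0, mul_zero])
    (fun i j hij => by
      simp_rw [inner_smul_right, inner_smul_left, integral_const_mul, h i j hij, mul_zero])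
  simp_rw [Finset.smul_sum]
  rw [this, Finset.mul_sum]
  gcongr with j _
  simp_rw [norm_smul, mul_pow, integral_const_mul]
  simpa using mul_le_mul_of_nonneg_left (hv j) (sq_nonneg a)

/-- The squared norm of the mixture is a sum of two products, each involving the coin and one
branch. So the coin only has to be independent of each branch separately. -/
lemma integral_norm_ite_sq [IsProbabilityMeasure P] {c : Ω → Bool} (hc : Measurable c) {q : ℝ}
    (hq : 0 ≤ q) (hlaw : P {z | c z = true} = ENNReal.ofReal q) {U W : Ω → Vec d}
    (hU : MemLp U 2 P) (hW : MemLp W 2 P) (hUc : IndepFun U c P) (hWc : IndepFun W c P) :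
    ∫ z, ‖if c z then U z else W z‖ ^ 2 ∂P
      = q * ∫ z, ‖U z‖ ^ 2 ∂P + (1 - q) * ∫ z, ‖W z‖ ^ 2 ∂P := by
  let φ : Bool → ℝ := fun t => if t then 1 else 0
  have hφ : Measurable φ := measurable_from_top
  have hint : Integrable (fun z => φ (c z)) P :=
    Integrable.of_bound (hφ.comp hc).aestronglyMeasurable 1 (ae_of_all _ fun z => by
      by_cases h : c z <;> simp [φ, h])
  have hφc : ∫ z, φ (c z) ∂P = q := by
    have hs : MeasurableSet {z | c z = true} := hc (measurableSet_singleton true)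
    have : (fun z => φ (c z)) = Set.indicator {z | c z = true} 1 := by
      ext z; by_cases h : c z <;> simp [φ, h]
    rw [this, integral_indicator_one hs, measureReal_def, hlaw, ENNReal.toReal_ofReal hq]
  have hsq : Measurable fun y : Vec d => ‖y‖ ^ 2 := measurable_norm.pow_const 2
  have e1 : ∫ z, ‖U z‖ ^ 2 * φ (c z) ∂P = (∫ z, ‖U z‖ ^ 2 ∂P) * q := by
    rw [← hφc]
    exact (hUc.comp hsq hφ).integral_fun_mul_eq_mul_integral (integrable_norm_sq hU).1 hint.1
  have e2 : ∫ z, ‖W z‖ ^ 2 * (1 - φ (c z)) ∂P = (∫ z, ‖W z‖ ^ 2 ∂P) * (1 - q) := by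
    have : ∫ z, (1 - φ (c z)) ∂P = 1 - q := by
      rw [integral_sub (integrable_const _) hint, hφc]; simp
    rw [← this]
    exact (hWc.comp hsq (hφ.const_sub 1)).integral_fun_mul_eq_mul_integral
      (integrable_norm_sq hW).1 ((integrable_const _).sub hint).1
  have hb : ∀ t, ‖φ t‖ ≤ 1 ∧ ‖1 - φ t‖ ≤ 1 := by
    intro t; cases t <;> simp [φ]
  have i1 : Integrable (fun z => ‖U z‖ ^ 2 * φ (c z)) P :=
    (integrable_norm_sq hU).mul_bdd (c := 1) hint.1 (ae_of_all _ fun z => (hb _).1)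
  have i2 : Integrable (fun z => ‖W z‖ ^ 2 * (1 - φ (c z))) P :=
    (integrable_norm_sq hW).mul_bdd (c := 1) ((integrable_const _).sub hint).1
      (ae_of_all _ fun z => (hb _).2)
  rw [mul_comm q, mul_comm (1 - q), ← e1, ← e2, ← integral_add i1 i2]
  refine integral_congr_ae (ae_of_all _ fun z => ?_)
  by_cases h : c z <;> simp [φ, h]

lemma memLp_ite {c : Ω → Bool} (hc : Measurable c) {U W : Ω → Vec d}
    (hU : MemLp U 2 P) (hW : MemLp W 2 P) :
    MemLp (fun z => if c z then U z else W z) 2 P := by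
  classical
  have hs : MeasurableSet {z | c z = true} := hc (measurableSet_singleton true)
  have := (hU.indicator hs).add (hW.indicator hs.compl)
  refine this.ae_eq (ae_of_all _ fun z => ?_)
  by_cases h : c z <;> simp [h]

end Orthogonal

/-! ### The sources of randomness and their independence. -/

section Sources

variable {Ω Ξ Θ : Type*} {n d b : ℕ}

/-- The order in which the sources of randomness are used. -/
def Source.rank : Source n b → ℕ
  | .init => 0
  | .seedS _ k => 5 * k + 1
  | .coinS k => 5 * k + 2
  | .sample _ k _ => 5 * k + 3
  | .seed _ k => 5 * k + 4
  | .coin k => 5 * k + 5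

variable [MeasurableSpace Ξ] [MeasurableSpace Θ]

/-- The σ-algebra generated by a set of sources. -/
@[reducible] def Noise.gen (N : Noise Ω Ξ Θ n d b) (T : Set (Source n b)) : MeasurableSpace Ω :=
  ⨆ s ∈ T, N.sigma s

/-- The σ-algebra generated by the sources of rank at most `t`. -/
@[reducible] def Noise.upTo (N : Noise Ω Ξ Θ n d b) (t : ℕ) : MeasurableSpace Ω :=
  N.gen {s | s.rank ≤ t}

variable {N : Noise Ω Ξ Θ n d b}

lemma Noise.sigma_le_gen {T : Set (Source n b)} {s : Source n b} (hs : s ∈ T) :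
    N.sigma s ≤ N.gen T :=
  le_iSup₂_of_le s hs le_rfl

lemma Noise.gen_mono {S T : Set (Source n b)} (h : S ⊆ T) : N.gen S ≤ N.gen T :=
  biSup_mono h

lemma Noise.upTo_mono {s t : ℕ} (h : s ≤ t) : N.upTo s ≤ N.upTo t :=
  Noise.gen_mono fun _ hx => le_trans hx h

lemma Noise.measurable_of_sigma_eq {α : Type*} [mα : MeasurableSpace α] {T : Set (Source n b)}
    {s : Source n b} (hs : s ∈ T) {θ : Ω → α} (h : N.sigma s = MeasurableSpace.comap θ mα) :
    Measurable[N.gen T] θ :=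
  (comap_measurable θ).mono (h ▸ N.sigma_le_gen hs) le_rfl

variable [mΩ : MeasurableSpace Ω] {P : Measure Ω} {D : Fin n → Measure Ξ} {ps p ωs ω : ℝ}

lemma Noise.Valid.sigma_le (hN : N.Valid P D ps p ωs ω) (s : Source n b) : N.sigma s ≤ mΩ := by
  cases s with
  | init => exact (measurable_pi_lambda _ hN.v0_measurable).comap_le
  | coinS k => exact (hN.coinS_measurable k).comap_le
  | coin k => exact (hN.coin_measurable k).comap_le
  | seedS i k => exact (hN.seedS_measurable i k).comap_le
  | seed i k => exact (hN.seed_measurable i k).comap_le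
  | sample i k r => exact (hN.sample_measurable i k r).comap_le

lemma Noise.Valid.gen_le (hN : N.Valid P D ps p ωs ω) (T : Set (Source n b)) : N.gen T ≤ mΩ :=
  iSup₂_le fun s _ => hN.sigma_le s

/-- Mutual independence passes to σ-algebras generated by disjoint families of sources, here T and
the single source s. All later uses of independence go through this. -/
lemma Noise.Valid.indepFun (hN : N.Valid P D ps p ωs ω) {α β : Type*} [MeasurableSpace α]
    [mβ : MeasurableSpace β] {T : Set (Source n b)} {s : Source n b} (hs : s ∉ T) {X : Ω → α}
    (hX : Measurable[N.gen T] X) {θ : Ω → β} (hθ : N.sigma s = MeasurableSpace.comap θ mβ) :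
    IndepFun X θ P := by
  rw [IndepFun_iff_Indep]
  have := indep_iSup_of_disjoint hN.sigma_le hN.independent (S := T) (T := {s})
    (Set.disjoint_singleton_right.2 hs)
  refine indep_of_indep_of_le_left (indep_of_indep_of_le_right this ?_) hX.comap_le
  rw [← hθ]
  simp

/-- Everything determined by T is orthogonal to errors driven by sources outside T, and distinct
such errors are orthogonal to each other. Hence the variances simply add up, with factor a². -/
lemma Noise.Valid.error_sum [IsProbabilityMeasure P] (hN : N.Valid P D ps p ωs ω)
    {J β : Type*} [Fintype J] [mβ : MeasurableSpace β] {T : Set (Source n b)}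
    {src : J → Source n b} (hinj : Function.Injective src) (hsrc : ∀ j, src j ∉ T)
    {θ : J → Ω → β} (hθm : ∀ j, Measurable (θ j))
    (hθ : ∀ j, N.sigma (src j) = MeasurableSpace.comap (θ j) mβ)
    {K : J → Vec d → β → Vec d} {m : J → Vec d → Vec d} {V : J → Vec d → ℝ}
    (hK : ∀ j, IsOracle (P.map (θ j)) (K j) (m j) (V j))
    {X : J → Ω → Vec d} (hX : ∀ j, Measurable[N.gen T] (X j))
    (hV : ∀ j, Integrable (fun z => V j (X j z)) P)
    {U : Ω → Vec d} (hU : Measurable[N.gen T] U) (hU2 : MemLp U 2 P) (a : ℝ) :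
    ∫ z, ‖U z + a • ∑ j, (K j (X j z) (θ j z) - m j (X j z))‖ ^ 2 ∂P
      ≤ ∫ z, ‖U z‖ ^ 2 ∂P + a ^ 2 * ∑ j, ∫ z, V j (X j z) ∂P := by
  have hXm : ∀ j, Measurable (X j) := fun j => (hX j).mono (hN.gen_le T) le_rfl
  have he : ∀ j, _ ∧ _ := fun j =>
    (hK j).error_sq (hXm j) (hθm j) (hN.indepFun (hsrc j) (hX j) (hθ j)) (hV j)
  refine integral_norm_add_smul_sum_sq_le a hU2 (fun j => (he j).1) (fun j => ?_)
    (fun i j hij => ?_) fun j => (he j).2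
  · exact (hK j).integral_inner_error (hXm j) (hU.mono (hN.gen_le T) le_rfl) (hθm j)
      (hN.indepFun (hsrc j) (hU.prodMk (hX j)) (hθ j)) (hV j) hU2
  -- For two errors, the source of the first is counted among the known ones; the second source is
  -- still fresh.
  · have hT : N.gen T ≤ N.gen (insert (src i) T) := Noise.gen_mono (Set.subset_insert _ _)
    have hX' : ∀ j, Measurable[N.gen (insert (src i) T)] (X j) := fun j =>
      (hX j).mono hT le_rfl
    have hei : Measurable[N.gen (insert (src i) T)]
        fun z => K i (X i z) (θ i z) - m i (X i z) :=
      (hK i).measurable_error.comp ((hX' i).prodMk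
        (Noise.measurable_of_sigma_eq (Set.mem_insert _ _) (hθ i)))
    have hj : src j ∉ insert (src i) T := by
      rw [Set.mem_insert_iff, not_or]
      exact ⟨fun h => hij (hinj h).symm, hsrc j⟩
    exact (hK j).integral_inner_error (hXm j) (hei.mono (hN.gen_le _) le_rfl) (hθm j)
      (hN.indepFun hj (hei.prodMk (hX' j)) (hθ j)) (hV j) (he i).1

end Sources

/-! ### Smooth functions and the inexact gradient step. -/

section Smooth

variable {d : ℕ} {f : Vec d → ℝ} {L : ℝ}

lemma IsSmooth.continuous_gradient (h : IsSmooth f L) : Continuous (gradient f) :=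
  (LipschitzWith.of_dist_le_mul (K := ⟨L, h.1⟩) fun x y => by
    rw [dist_eq_norm, dist_eq_norm]; exact h.2.2 x y).continuous

lemma IsSmooth.memLp_gradient {Ω : Type*} [MeasurableSpace Ω] {P : Measure Ω}
    [IsProbabilityMeasure P] (h : IsSmooth f L) {X : Ω → Vec d} (hX : MemLp X 2 P) :
    MemLp (fun z => gradient f (X z)) 2 P := by
  have h1 : MemLp (fun z => L * ‖X z‖ + ‖gradient f 0‖) 2 P :=
    (hX.norm.const_mul L).add (memLp_const _)
  refine h1.mono (h.continuous_gradient.comp_aestronglyMeasurable hX.1) (ae_of_all _ fun z => ?_)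
  have h2 := h.2.2 (X z) 0
  have h3 := norm_le_norm_add_norm_sub' (gradient f (X z)) (gradient f 0)
  have h4 := h.1
  rw [sub_zero] at h2
  rw [Real.norm_of_nonneg (by positivity)]
  linarith

/-- On the segment from x to y, f minus its linear part and the quadratic term has derivative at
most zero by Cauchy–Schwarz and the Lipschitz bound. -/
lemma IsSmooth.descent (h : IsSmooth f L) (x y : Vec d) :
    f y ≤ f x + inner ℝ (gradient f x) (y - x) + L / 2 * ‖y - x‖ ^ 2 := by
  let φ : ℝ → ℝ := fun t =>
    f (x + t • (y - x)) - t * inner ℝ (gradient f x) (y - x) - L / 2 * t ^ 2 * ‖y - x‖ ^ 2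
  have hφ : ∀ t, HasDerivAt φ (inner ℝ (gradient f (x + t • (y - x))) (y - x)
      - inner ℝ (gradient f x) (y - x) - L * t * ‖y - x‖ ^ 2) t := by
    intro t
    have h1 : HasDerivAt (fun t : ℝ => x + t • (y - x)) (y - x) t := by
      simpa using ((hasDerivAt_id t).smul_const (y - x)).const_add x
    have h2 := (h.2.1 (x + t • (y - x))).hasGradientAt.hasFDerivAt.comp_hasDerivAt t h1
    have h3 := (hasDerivAt_id t).mul_const (inner ℝ (gradient f x) (y - x))
    have h4 := (((hasDerivAt_pow 2 t).const_mul (L / 2)).mul_const (‖y - x‖ ^ 2))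
    refine ((h2.sub h3).sub h4).congr_deriv ?_
    rw [InnerProductSpace.toDual_apply_apply]
    rw [show 2 - 1 = 1 from rfl]
    push_cast
    ring
  have hanti : AntitoneOn φ (Set.Icc 0 1) := by
    refine antitoneOn_of_deriv_nonpos (convex_Icc 0 1)
      (fun t _ => (hφ t).continuousAt.continuousWithinAt)
      (fun t _ => (hφ t).differentiableAt.differentiableWithinAt) fun t ht => ?_
    rw [interior_Icc] at ht
    rw [(hφ t).deriv, ← inner_sub_left]
    have h1 := real_inner_le_norm (gradient f (x + t • (y - x)) - gradient f x) (y - x)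
    have h2 := h.2.2 (x + t • (y - x)) x
    rw [add_sub_cancel_left, norm_smul, Real.norm_of_nonneg ht.1.le] at h2
    nlinarith [norm_nonneg (y - x)]
  have := hanti (Set.left_mem_Icc.2 zero_le_one) (Set.right_mem_Icc.2 zero_le_one) zero_le_one
  simp [φ, -inner_gradient_left] at this
  linarith

/-- The lower bound gives nonnegativity and the descent inequality at the origin gives quadratic
growth, so square integrability of X is enough. -/
lemma IsSmooth.integrable {Ω : Type*} [MeasurableSpace Ω] {P : Measure Ω}
    [IsProbabilityMeasure P] (h : IsSmooth f L) {fstar : ℝ} (hf : ∀ x, fstar ≤ f x)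
    {X : Ω → Vec d} (hX : MemLp X 2 P) : Integrable (fun z => f (X z) - fstar) P := by
  have hi := integrable_norm_sq hX
  have hg : Integrable (fun z => f 0 - fstar + ‖gradient f 0‖ * ‖X z‖ + L / 2 * ‖X z‖ ^ 2) P :=
    ((integrable_const _).add ((hX.integrable one_le_two).norm.const_mul _)).add (hi.const_mul _)
  refine hg.mono' ((h.2.1.continuous.comp_aestronglyMeasurable hX.1).sub
    aestronglyMeasurable_const) (ae_of_all _ fun z => ?_)
  rw [Real.norm_of_nonneg (sub_nonneg.2 (hf _))]
  have h1 := h.descent 0 (X z)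
  have h2 := real_inner_le_norm (gradient f 0) (X z)
  rw [sub_zero] at h1
  linarith

/-- One gradient step with an inexact gradient. -/
lemma IsSmooth.descent_step (h : IsSmooth f L) {γ : ℝ} (hγ : 0 < γ) (x g : Vec d) :
    f (x - γ • g) + γ / 2 * ‖gradient f x‖ ^ 2
        + (1 / (2 * γ) - L / 2) * ‖(x - γ • g) - x‖ ^ 2
      ≤ f x + γ / 2 * ‖g - gradient f x‖ ^ 2 := by
  have h1 := h.descent x (x - γ • g)
  have e1 : (x - γ • g) - x = -(γ • g) := by abel
  rw [e1, norm_neg, norm_smul, inner_neg_right, inner_smul_right, Real.norm_of_nonneg hγ.le] at h1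
  rw [e1, norm_neg, norm_smul, Real.norm_of_nonneg hγ.le, norm_sub_sq_real, real_inner_comm]
  have e2 : (1 / (2 * γ) - L / 2) * (γ * ‖g‖) ^ 2
      = γ / 2 * ‖g‖ ^ 2 - L / 2 * (γ * ‖g‖) ^ 2 := by
    field_simp
  rw [e2]
  linarith

end Smooth

/-! ### Algebra of averages over the workers. -/

section Avg

variable {n : ℕ} {V : Type*} [AddCommGroup V] [Module ℝ V]

lemma avg_add (u v : Fin n → V) : (avg fun i => u i + v i) = avg u + avg v := by
  simp [avg, Finset.sum_add_distrib]

lemma avg_sub (u v : Fin n → V) : (avg fun i => u i - v i) = avg u - avg v := by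
  simp [avg, Finset.sum_sub_distrib, smul_sub]

lemma avg_smul (a : ℝ) (u : Fin n → V) : (avg fun i => a • u i) = a • avg u := by
  simp only [avg, ← Finset.smul_sum]
  rw [smul_comm]

lemma avg_const (hn : 1 ≤ n) (x : V) : (avg fun _ : Fin n => x) = x := by
  have : (n : ℝ) ≠ 0 := by positivity
  simp only [avg, Finset.sum_const, Finset.card_univ, Fintype.card_fin]
  rw [← Nat.cast_smul_eq_nsmul ℝ, smul_smul, one_div_mul_cancel this, one_smul]

lemma avg_mul (a : ℝ) (u : Fin n → ℝ) : (avg fun i => a * u i) = a * avg u :=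
  avg_smul a u

lemma avg_mono {u v : Fin n → ℝ} (h : ∀ i, u i ≤ v i) : avg u ≤ avg v := by
  simp only [avg, smul_eq_mul]
  gcongr with i _
  exact h i

lemma avg_nonneg {u : Fin n → ℝ} (h : ∀ i, 0 ≤ u i) : 0 ≤ avg u := by
  simp only [avg, smul_eq_mul]
  exact mul_nonneg (by positivity) (Finset.sum_nonneg fun i _ => h i)

lemma integral_avg {Ω : Type*} [MeasurableSpace Ω] {P : Measure Ω} {h : Fin n → Ω → ℝ}
    (hi : ∀ i, Integrable (h i) P) :
    ∫ z, avg (fun i => h i z) ∂P = avg fun i => ∫ z, h i z ∂P := by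
  simp only [avg, smul_eq_mul]
  rw [integral_const_mul, integral_finsetSum _ fun i _ => hi i]

lemma integrable_avg {Ω : Type*} [MeasurableSpace Ω] {P : Measure Ω} {h : Fin n → Ω → ℝ}
    (hi : ∀ i, Integrable (h i) P) : Integrable (fun z => avg fun i => h i z) P :=
  (integrable_finsetSum _ fun i _ => hi i).smul (1 / (n : ℝ))

end Avg

/-! ### Adaptedness and square integrability of the iterates. -/

section Adapted

variable {Ω Ξ Θ : Type*} {n d b : ℕ} [MeasurableSpace Ξ] [MeasurableSpace Θ]
  [mΩ : MeasurableSpace Ω]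

/-- `X` is square integrable and determined by the sources of rank at most `t`. -/
structure Noise.IsL2 (N : Noise Ω Ξ Θ n d b) (P : Measure Ω) (t : ℕ) (X : Ω → Vec d) : Prop where
  measurable : Measurable[N.upTo t] X
  memLp : MemLp X 2 P

variable {N : Noise Ω Ξ Θ n d b} {P : Measure Ω}

namespace Noise.IsL2

variable {s t : ℕ} {X Y : Ω → Vec d}

lemma mono (h : N.IsL2 P s X) (hst : s ≤ t) : N.IsL2 P t X :=
  ⟨h.1.mono (Noise.upTo_mono hst) le_rfl, h.2⟩

lemma add (hX : N.IsL2 P t X) (hY : N.IsL2 P t Y) : N.IsL2 P t fun z => X z + Y z :=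
  ⟨hX.1.add hY.1, hX.2.add hY.2⟩

lemma sub (hX : N.IsL2 P t X) (hY : N.IsL2 P t Y) : N.IsL2 P t fun z => X z - Y z :=
  ⟨hX.1.sub hY.1, hX.2.sub hY.2⟩

lemma smul (a : ℝ) (hX : N.IsL2 P t X) : N.IsL2 P t fun z => a • X z :=
  ⟨hX.1.const_smul a, hX.2.const_smul a⟩

lemma sum {J : Type*} (S : Finset J) {X : J → Ω → Vec d} (h : ∀ j, N.IsL2 P t (X j)) :
    N.IsL2 P t fun z => ∑ j ∈ S, X j z :=
  ⟨Finset.measurable_fun_sum S fun j _ => (h j).1, memLp_finsetSum S fun j _ => (h j).2⟩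

lemma avg {X : Fin n → Ω → Vec d} (h : ∀ j, N.IsL2 P t (X j)) :
    N.IsL2 P t fun z => M4.avg fun i => X i z :=
  (sum Finset.univ h).smul _

lemma const [IsFiniteMeasure P] (x : Vec d) : N.IsL2 P t fun _ => x :=
  ⟨measurable_const, memLp_const x⟩

lemma grad [IsProbabilityMeasure P] {f : Vec d → ℝ} {L : ℝ} (hf : IsSmooth f L)
    (hX : N.IsL2 P t X) : N.IsL2 P t fun z => gradient f (X z) :=
  ⟨hf.continuous_gradient.measurable.comp hX.1, hf.memLp_gradient hX.2⟩

lemma sq (hX : N.IsL2 P t X) : Integrable (fun z => ‖X z‖ ^ 2) P :=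
  integrable_norm_sq hX.2

end Noise.IsL2

variable {D : Fin n → Measure Ξ} {ps p ωs ω : ℝ}

/-- The strict inequality between s and the rank of the source expresses that the random map is
drawn after its argument is known. -/
lemma Noise.Valid.isL2_oracle [IsProbabilityMeasure P] (hN : N.Valid P D ps p ωs ω) {β : Type*}
    [mβ : MeasurableSpace β] {s t : ℕ} {src : Source n b} (hs : s < src.rank) (ht : src.rank ≤ t)
    {θ : Ω → β} (hθm : Measurable θ) (hθ : N.sigma src = MeasurableSpace.comap θ mβ)
    {K : Vec d → β → Vec d} {m : Vec d → Vec d} {V : Vec d → ℝ} (hK : IsOracle (P.map θ) K m V)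
    {X : Ω → Vec d} (hX : N.IsL2 P s X) (hV : Integrable (fun z => V (X z)) P)
    (hm : N.IsL2 P s fun z => m (X z)) : N.IsL2 P t fun z => K (X z) (θ z) := by
  constructor
  · exact hK.measurable.comp ((hX.mono (hs.le.trans ht)).1.prodMk
      (Noise.measurable_of_sigma_eq ht hθ))
  · have hns : src ∉ {y : Source n b | y.rank ≤ s} := fun h => absurd h (not_le.2 hs)
    have h := (hK.error_sq (hX.1.mono (hN.gen_le _) le_rfl) hθm
      (hN.indepFun hns hX.1 hθ) hV).1
    refine (h.add hm.2).ae_eq (ae_of_all _ fun z => ?_)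
    simp

lemma Noise.isL2_ite {t : ℕ} {c : Ω → Bool} (hcm : Measurable c) {src : Source n b}
    (ht : src.rank ≤ t) (hc : N.sigma src = MeasurableSpace.comap c inferInstance)
    {X Y : Ω → Vec d} (hX : N.IsL2 P t X) (hY : N.IsL2 P t Y) :
    N.IsL2 P t fun z => if c z then X z else Y z := by
  refine ⟨?_, memLp_ite hcm hX.2 hY.2⟩
  have h : Measurable[N.upTo t] c := Noise.measurable_of_sigma_eq ht hc
  exact Measurable.ite (h (measurableSet_singleton true)) hX.1 hY.1

lemma IsUnbiasedCompressor.isOracle {ρ : Measure Θ} {C : Vec d → Θ → Vec d} {q : ℝ}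
    (h : IsUnbiasedCompressor ρ C q) : IsOracle ρ C (fun x => x) (fun x => q * ‖x‖ ^ 2) where
  measurable := h.measurable
  memLp := h.memLp
  measurable_mean := measurable_id
  measurable_var := (measurable_norm.pow_const 2).const_mul q
  mean := h.unbiased
  variance_le := h.variance_le

lemma IsStochasticGradient.isOracle {f : Vec d → ℝ} {ρ : Measure Ξ} {G : Vec d → Ξ → Vec d}
    {σ L : ℝ} (h : IsStochasticGradient f ρ G σ) (hf : IsSmooth f L) :
    IsOracle ρ G (gradient f) (fun _ => σ ^ 2) where
  measurable := h.measurable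
  memLp := h.memLp
  measurable_mean := hf.continuous_gradient.measurable
  measurable_var := measurable_const
  mean := h.unbiased
  variance_le := h.variance_le

variable {F : Fin n → Vec d → ℝ} {L : ℝ} {Li : Fin n → ℝ} {LA LB fstar σ : ℝ}
  {G : Fin n → Vec d → Ξ → Vec d} {x0 : Vec d} {γ μ ν : ℝ}

lemma Assumptions.sample_isOracle (hA : Assumptions F L Li LA LB fstar σ D G)
    (hN : N.Valid P D ps p ωs ω) (i : Fin n) (k : ℕ) (r : Fin b) :
    IsOracle (P.map (N.ξ i k r)) (G i) (gradient (F i)) (fun _ => σ ^ 2) := by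
  rw [hN.sample_law]
  exact (hA.stochastic i).isOracle (hA.smooth_worker i)

local notation "S" => iterate N G x0 γ μ ν

/-- All variables of iteration `k` are square integrable and determined by the earlier sources. -/
structure IsAdapted (N : Noise Ω Ξ Θ n d b) (P : Measure Ω) (s : Ω → State n d) (t : ℕ) :
    Prop where
  x : N.IsL2 P t fun z => (s z).x
  w : ∀ i, N.IsL2 P t fun z => (s z).w i
  xw : ∀ i, N.IsL2 P t fun z => (s z).xw i
  v : ∀ i, N.IsL2 P t fun z => (s z).v i
  g : N.IsL2 P t fun z => (s z).g

lemma isL2_x_succ {k : ℕ} (h : IsAdapted N P (S k) (5 * k)) :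
    N.IsL2 P (5 * k) fun z => (S (k + 1) z).x :=
  h.x.sub (h.g.smul γ)

lemma isL2_w_succ [IsProbabilityMeasure P] (hN : N.Valid P D ps p ωs ω) {k : ℕ} (h : IsAdapted N P (S k) (5 * k)) (i : Fin n) :
    N.IsL2 P (5 * k + 2) fun z => (S (k + 1) z).w i := by
  have hx := isL2_x_succ h
  have hC := hN.isL2_oracle (src := .seedS i k) (s := 5 * k) (t := 5 * k + 2)
    (by simp [Source.rank]) (by simp [Source.rank]) (hN.seedS_measurable i k) rfl
    (hN.compressorS i k).isOracle (hx.sub h.x) ((hx.sub h.x).sq.const_mul _) (hx.sub h.x)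
  exact Noise.isL2_ite (t := 5 * k + 2) (hN.coinS_measurable k) (src := .coinS k) le_rfl rfl
    (hx.mono (by omega)) (((h.w i).mono (by omega)).add hC)

lemma isL2_xw_succ [IsProbabilityMeasure P] (hN : N.Valid P D ps p ωs ω) {k : ℕ} (h : IsAdapted N P (S k) (5 * k)) (i : Fin n) :
    N.IsL2 P (5 * k + 2) fun z => (S (k + 1) z).xw i :=
  (((h.xw i).mono (by omega)).smul (1 - μ)).add ((isL2_w_succ hN h i).smul μ)

lemma isL2_v_succ [IsProbabilityMeasure P] (hA : Assumptions F L Li LA LB fstar σ D G)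
    (hN : N.Valid P D ps p ωs ω) {k : ℕ} (h : IsAdapted N P (S k) (5 * k)) (i : Fin n) :
    N.IsL2 P (5 * k + 3) fun z => (S (k + 1) z).v i := by
  have hxw := isL2_xw_succ hN h i
  refine (((h.v i).mono (by omega)).smul (1 - ν)).add
    ((Noise.IsL2.sum Finset.univ fun r => ?_).smul (ν / (b : ℝ)))
  exact hN.isL2_oracle (src := .sample i k r) (by simp [Source.rank]) le_rfl
    (hN.sample_measurable i k r) rfl (hA.sample_isOracle hN i k r) hxw (integrable_const _)
    (hxw.grad (hA.smooth_worker i))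

lemma isL2_g_succ [IsProbabilityMeasure P] (hA : Assumptions F L Li LA LB fstar σ D G)
    (hN : N.Valid P D ps p ωs ω) {k : ℕ} (h : IsAdapted N P (S k) (5 * k)) :
    N.IsL2 P (5 * k + 5) fun z => (S (k + 1) z).g := by
  have hv := isL2_v_succ hA hN h
  have hC : ∀ i, N.IsL2 P (5 * k + 5)
      fun z => N.C i k ((S (k + 1) z).v i - (S k z).v i) (N.seed i k z) := by
    intro i
    have hd := (hv i).sub ((h.v i).mono (t := 5 * k + 3) (by omega))
    exact hN.isL2_oracle (src := .seed i k) (by simp [Source.rank]) (by simp [Source.rank])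
      (hN.seed_measurable i k) rfl (hN.compressor i k).isOracle hd (hd.sq.const_mul _) hd
  exact Noise.isL2_ite (t := 5 * k + 5) (hN.coin_measurable k) (src := .coin k) le_rfl rfl
    (Noise.IsL2.avg fun i => (hv i).mono (by omega))
    ((h.g.mono (by omega)).add (Noise.IsL2.avg hC))

lemma isAdapted [IsProbabilityMeasure P] (hA : Assumptions F L Li LA LB fstar σ D G)
    (hN : N.Valid P D ps p ωs ω) (k : ℕ) : IsAdapted N P (S k) (5 * k) := by
  induction k with
  | zero =>
    have hv : ∀ i, N.IsL2 P (5 * 0) (N.v0 i) := fun i =>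
      have h : Measurable[N.upTo (5 * 0)] fun z i => N.v0 i z :=
        Noise.measurable_of_sigma_eq (s := Source.init) (Nat.le_refl 0) rfl
      ⟨(measurable_pi_apply i).comp h, hN.v0_memLp i⟩
    exact ⟨.const x0, fun _ => .const x0, fun _ => .const x0, hv, .avg hv⟩
  | succ k ih =>
    exact ⟨(isL2_x_succ ih).mono (by omega), fun i => (isL2_w_succ hN ih i).mono (by omega),
      fun i => (isL2_xw_succ hN ih i).mono (by omega),
      fun i => (isL2_v_succ hA hN ih i).mono (by omega), isL2_g_succ hA hN ih⟩

end Adapted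

/-! ### Inequalities for squared norms. -/

section Inequalities

variable {V : Type*} [NormedAddCommGroup V] [InnerProductSpace ℝ V]

lemma norm_add_sq_le_young {V : Type*} [NormedAddCommGroup V] {t : ℝ} (ht : 0 < t) (x y : V) :
    ‖x + y‖ ^ 2 ≤ (1 + t) * ‖x‖ ^ 2 + (1 + 1 / t) * ‖y‖ ^ 2 := by
  have h1 := norm_add_le x y
  have h2 : ‖x + y‖ ^ 2 ≤ (‖x‖ + ‖y‖) ^ 2 := by gcongr
  have h3 : 0 ≤ 1 / t * (t * ‖x‖ - ‖y‖) ^ 2 := by positivity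
  have h4 : 1 / t * (t * ‖x‖ - ‖y‖) ^ 2 = t * ‖x‖ ^ 2 - 2 * ‖x‖ * ‖y‖ + 1 / t * ‖y‖ ^ 2 := by
    field_simp
    ring
  linarith

lemma norm_add_sq_le_two {V : Type*} [NormedAddCommGroup V] (x y : V) : ‖x + y‖ ^ 2 ≤ 2 * ‖x‖ ^ 2 + 2 * ‖y‖ ^ 2 := by
  have := norm_add_sq_le_young one_pos x y
  norm_num at this
  linarith

lemma norm_convex_sq_le {ν : ℝ} (h0 : 0 ≤ ν) (h1 : ν ≤ 1) (x y : V) :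
    ‖(1 - ν) • x + ν • y‖ ^ 2 ≤ (1 - ν) * ‖x‖ ^ 2 + ν * ‖y‖ ^ 2 := by
  have h := norm_add_le ((1 - ν) • x) (ν • y)
  rw [norm_smul, norm_smul, Real.norm_of_nonneg h0, Real.norm_of_nonneg (sub_nonneg.2 h1)] at h
  have h2 : ‖(1 - ν) • x + ν • y‖ ^ 2 ≤ ((1 - ν) * ‖x‖ + ν * ‖y‖) ^ 2 := by gcongr
  have h3 : 0 ≤ (1 - ν) * ν * (‖x‖ - ‖y‖) ^ 2 :=
    mul_nonneg (mul_nonneg (sub_nonneg.2 h1) h0) (sq_nonneg _)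
  linarith

/-- Writing (1 − ν)y as ν times a vector makes the sum a convex combination, so x keeps exactly the
factor 1 − ν and Young's inequality is not needed. -/
lemma norm_contract_sq_le {ν : ℝ} (h0 : 0 < ν) (h1 : ν ≤ 1) (x y : V) :
    ‖(1 - ν) • x + (1 - ν) • y‖ ^ 2 ≤ (1 - ν) * ‖x‖ ^ 2 + 1 / ν * ‖y‖ ^ 2 := by
  have h := norm_convex_sq_le h0.le h1 x (((1 - ν) / ν) • y)
  rw [smul_smul, mul_div_cancel₀ _ h0.ne', norm_smul,
    Real.norm_of_nonneg (div_nonneg (sub_nonneg.2 h1) h0.le)] at h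
  refine h.trans (add_le_add le_rfl ?_)
  have e : ν * ((1 - ν) / ν * ‖y‖) ^ 2 = 1 / ν * ‖y‖ ^ 2 * (1 - ν) ^ 2 := by
    field_simp
  rw [e]
  have h2 : (1 - ν) ^ 2 ≤ 1 := by nlinarith
  exact mul_le_of_le_one_right (by positivity) h2

lemma norm_contract_add_sq_le {ν : ℝ} (h0 : 0 < ν) (h1 : ν ≤ 1) (x y h : V) :
    ‖(1 - ν) • x + (1 - ν) • y + ν • h‖ ^ 2
      ≤ (1 - ν) * ‖x‖ ^ 2 + 2 / ν * ‖y‖ ^ 2 + 2 * ν * ‖h‖ ^ 2 := by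
  have e0 : (1 - ν) • x + (1 - ν) • y + ν • h = (1 - ν) • x + ν • (((1 - ν) / ν) • y + h) := by
    rw [smul_add, smul_smul, mul_div_cancel₀ _ h0.ne', add_assoc]
  have h2 := norm_convex_sq_le h0.le h1 x (((1 - ν) / ν) • y + h)
  have h3 := norm_add_sq_le_two (((1 - ν) / ν) • y) h
  rw [norm_smul, Real.norm_of_nonneg (div_nonneg (sub_nonneg.2 h1) h0.le)] at h3
  rw [e0]
  have h4 := mul_le_mul_of_nonneg_left h3 h0.le
  have e : ν * (2 * ((1 - ν) / ν * ‖y‖) ^ 2) = 2 / ν * ‖y‖ ^ 2 * (1 - ν) ^ 2 := by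
    field_simp
  have h5 : 2 / ν * ‖y‖ ^ 2 * (1 - ν) ^ 2 ≤ 2 / ν * ‖y‖ ^ 2 :=
    mul_le_of_le_one_right (by positivity) (by nlinarith)
  linarith

/-- The left side is the second moment of q + δ + cy for a coin c of parameter p, that is, ‖q + δ +
py‖² plus the variance p(1 − p)‖y‖². Young's inequality is applied only to the mean, where y carries
the factor p, so no term p‖y‖²/t arises. -/
lemma mix_norm_sq_le {p t : ℝ} (hp : 0 ≤ p) (ht : 0 < t) (q δ y : V) :
    p * ‖q + δ + y‖ ^ 2 + (1 - p) * ‖q + δ‖ ^ 2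
      ≤ (1 + t) * ‖q‖ ^ 2 + (1 + 1 / t) * (2 * ‖δ‖ ^ 2 + 2 * p ^ 2 * ‖y‖ ^ 2) + p * ‖y‖ ^ 2 := by
  have h1 := norm_add_sq_le_young ht q (δ + p • y)
  have h2 := norm_add_sq_le_two δ (p • y)
  have h3 : ‖q + (δ + p • y)‖ ^ 2 = ‖q + δ‖ ^ 2 + 2 * p * inner ℝ (q + δ) y + p ^ 2 * ‖y‖ ^ 2 := by
    rw [← add_assoc, norm_add_sq_real (q + δ), inner_smul_right, norm_smul,
      Real.norm_of_nonneg hp]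
    ring
  have h4 := norm_add_sq_real (q + δ) y
  rw [norm_smul, Real.norm_of_nonneg hp, mul_pow] at h2
  have h5 := mul_le_mul_of_nonneg_left h2 (by positivity : 0 ≤ 1 + 1 / t)
  rw [h4]
  nlinarith [mul_nonneg (sq_nonneg p) (sq_nonneg ‖y‖)]

end Inequalities

/-! ### One communication or sampling step, in second moments. -/

section Recursions

variable {Ω Ξ Θ : Type*} {n d b : ℕ} [MeasurableSpace Ξ] [MeasurableSpace Θ]
  [mΩ : MeasurableSpace Ω] {N : Noise Ω Ξ Θ n d b} {P : Measure Ω} [IsProbabilityMeasure P]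
  {D : Fin n → Measure Ξ} {ps p ωs ω : ℝ}

/-- The index type J covers two cases: a single worker with a = 1, and the mean over all workers
with a = 1/n, where the variance gains the factor 1/n. -/
lemma Noise.Valid.server_sq_le (hN : N.Valid P D ps p ωs ω) (hps : 0 ≤ ps) (hps1 : ps ≤ 1)
    {J : Type*} [Fintype J] {ι : J → Fin n} (hι : Function.Injective ι) {k : ℕ} (a : ℝ)
    {δ U W : Ω → Vec d} (hδ : N.IsL2 P (5 * k) δ) (hU : N.IsL2 P (5 * k) U)
    (hW : N.IsL2 P (5 * k) W) :
    ∫ z, ‖if N.coinS k z then W z else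
        U z + a • ∑ j, (N.Cs (ι j) k (δ z) (N.seedS (ι j) k z) - δ z)‖ ^ 2 ∂P
      ≤ ps * ∫ z, ‖W z‖ ^ 2 ∂P + (1 - ps) * (∫ z, ‖U z‖ ^ 2 ∂P
          + a ^ 2 * (Fintype.card J * (ωs * ∫ z, ‖δ z‖ ^ 2 ∂P))) := by
  have hC : ∀ j, N.IsL2 P (5 * k + 1) fun z => N.Cs (ι j) k (δ z) (N.seedS (ι j) k z) := fun j =>
    hN.isL2_oracle (src := .seedS (ι j) k) (s := 5 * k) (by simp [Source.rank])
      (by simp [Source.rank]) (hN.seedS_measurable (ι j) k) rfl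
      (hN.compressorS (ι j) k).isOracle hδ (hδ.sq.const_mul _) hδ
  have hUC : N.IsL2 P (5 * k + 1)
      fun z => U z + a • ∑ j, (N.Cs (ι j) k (δ z) (N.seedS (ι j) k z) - δ z) :=
    (hU.mono (by omega)).add
      ((Noise.IsL2.sum _ fun j => (hC j).sub (hδ.mono (by omega))).smul a)
  have hW' : N.IsL2 P (5 * k + 1) W := hW.mono (by omega)
  have hc : Source.coinS k ∉ {y : Source n b | y.rank ≤ 5 * k + 1} := by simp [Source.rank]
  rw [integral_norm_ite_sq (hN.coinS_measurable k) hps (hN.coinS_law k) hW.memLp hUC.memLp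
    (hN.indepFun hc hW'.measurable rfl) (hN.indepFun hc hUC.measurable rfl)]
  have h := hN.error_sum (src := fun j => Source.seedS (ι j) k)
    (T := {y : Source n b | y.rank ≤ 5 * k})
    (fun i j hij => hι (by simpa using hij)) (fun j => by simp [Source.rank])
    (fun j => hN.seedS_measurable (ι j) k) (fun j => rfl)
    (fun j => (hN.compressorS (ι j) k).isOracle) (fun _ => hδ.measurable)
    (fun _ => hδ.sq.const_mul ωs) hU.measurable hU.memLp a
  simp only [integral_const_mul, Finset.sum_const, Finset.card_univ, nsmul_eq_mul] at h
  have := sub_nonneg.2 hps1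
  gcongr

/-- The server-to-worker step applied to `q`, where `q + δ + y` is the synchronized value. -/
lemma Noise.Valid.server_diff_sq_le (hN : N.Valid P D ps p ωs ω) (hps : 0 ≤ ps) (hps1 : ps ≤ 1)
    (hωs : 0 ≤ ωs) {J : Type*} [Fintype J] {ι : J → Fin n} (hι : Function.Injective ι) {k : ℕ}
    (a : ℝ) {t : ℝ} (ht : 0 < t) {q δ y : Ω → Vec d} (hδ : N.IsL2 P (5 * k) δ)
    (hq : N.IsL2 P (5 * k) q) (hy : N.IsL2 P (5 * k) y) :
    ∫ z, ‖if N.coinS k z then q z + δ z + y z else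
        q z + δ z + a • ∑ j, (N.Cs (ι j) k (δ z) (N.seedS (ι j) k z) - δ z)‖ ^ 2 ∂P
      ≤ (1 + t) * ∫ z, ‖q z‖ ^ 2 ∂P
        + (1 + 1 / t) * (2 * ∫ z, ‖δ z‖ ^ 2 ∂P + 2 * ps ^ 2 * ∫ z, ‖y z‖ ^ 2 ∂P)
        + ps * ∫ z, ‖y z‖ ^ 2 ∂P + a ^ 2 * (Fintype.card J * (ωs * ∫ z, ‖δ z‖ ^ 2 ∂P)) := by
  have h1 := hN.server_sq_le hps hps1 hι a hδ (hq.add hδ) ((hq.add hδ).add hy)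
  have i1 := (((hq.add hδ).add hy).sq).const_mul ps
  have i2 := ((hq.add hδ).sq).const_mul (1 - ps)
  have i3 := hq.sq.const_mul (1 + t)
  have i4 := hδ.sq.const_mul 2
  have i5 := hy.sq.const_mul (2 * ps ^ 2)
  have i6 := hy.sq.const_mul ps
  have i45 := (i4.add i5).const_mul (1 + 1 / t)
  have h2 := integral_mono (i1.add i2) ((i3.add i45).add i6)
    fun z => mix_norm_sq_le hps ht (q z) (δ z) (y z)
  rw [integral_add' i1 i2, integral_add' (i3.add i45) i6, integral_add' i3 i45] at h2
  simp only [integral_const_mul, Pi.add_apply] at h2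
  rw [integral_add i4 i5] at h2
  simp only [integral_const_mul] at h2
  have h3 : 0 ≤ ps * (a ^ 2 * (Fintype.card J * (ωs * ∫ z, ‖δ z‖ ^ 2 ∂P))) := by
    have : 0 ≤ ∫ z, ‖δ z‖ ^ 2 ∂P := integral_nonneg fun z => by positivity
    positivity
  linarith

variable {F : Fin n → Vec d → ℝ} {L : ℝ} {Li : Fin n → ℝ} {LA LB fstar σ : ℝ}
  {G : Fin n → Vec d → Ξ → Vec d} {x0 : Vec d} {γ μ ν : ℝ}

lemma Noise.Valid.sample_sq_le (hN : N.Valid P D ps p ωs ω)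
    (hA : Assumptions F L Li LA LB fstar σ D G) {J : Type*} [Fintype J] {ι : J → Fin n × Fin b}
    (hι : Function.Injective ι) {k : ℕ} (a : ℝ) {X : Fin n → Ω → Vec d} {U : Ω → Vec d}
    (hX : ∀ i, N.IsL2 P (5 * k + 2) (X i)) (hU : N.IsL2 P (5 * k + 2) U) :
    ∫ z, ‖U z + a • ∑ j, (G (ι j).1 (X (ι j).1 z) (N.ξ (ι j).1 k (ι j).2 z)
        - gradient (F (ι j).1) (X (ι j).1 z))‖ ^ 2 ∂P
      ≤ ∫ z, ‖U z‖ ^ 2 ∂P + a ^ 2 * (Fintype.card J * σ ^ 2) := by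
  have h := hN.error_sum (src := fun j => Source.sample (ι j).1 k (ι j).2)
    (T := {y : Source n b | y.rank ≤ 5 * k + 2})
    (fun i j hij => hι (by
      simp only [Source.sample.injEq, true_and] at hij
      exact Prod.ext hij.1 hij.2)) (fun j => by simp [Source.rank])
    (fun j => hN.sample_measurable (ι j).1 k (ι j).2) (fun j => rfl)
    (fun j => hA.sample_isOracle hN (ι j).1 k (ι j).2) (fun j => (hX (ι j).1).measurable)
    (fun _ => integrable_const _) hU.measurable hU.memLp a
  simpa using h

lemma Noise.Valid.worker_sq_le (hN : N.Valid P D ps p ωs ω) (hp : 0 ≤ p) (hp1 : p ≤ 1)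
    {k : ℕ} {X : Fin n → Ω → Vec d} {U : Ω → Vec d} (hX : ∀ i, N.IsL2 P (5 * k + 3) (X i))
    (hU : N.IsL2 P (5 * k + 3) U) :
    ∫ z, ‖if N.coin k z then 0 else
        U z + (1 / (n : ℝ)) • ∑ i, (N.C i k (X i z) (N.seed i k z) - X i z)‖ ^ 2 ∂P
      ≤ (1 - p) * (∫ z, ‖U z‖ ^ 2 ∂P + ω / n * avg fun i => ∫ z, ‖X i z‖ ^ 2 ∂P) := by
  have hC : ∀ i, N.IsL2 P (5 * k + 4) fun z => N.C i k (X i z) (N.seed i k z) := fun i =>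
    hN.isL2_oracle (src := .seed i k) (s := 5 * k + 3) (by simp [Source.rank])
      (by simp [Source.rank]) (hN.seed_measurable i k) rfl
      (hN.compressor i k).isOracle (hX i) ((hX i).sq.const_mul _) (hX i)
  have hUC : N.IsL2 P (5 * k + 4)
      fun z => U z + (1 / (n : ℝ)) • ∑ i, (N.C i k (X i z) (N.seed i k z) - X i z) :=
    (hU.mono (by omega)).add
      ((Noise.IsL2.sum _ fun i => (hC i).sub ((hX i).mono (by omega))).smul _)
  have h0 : N.IsL2 P (5 * k + 4) fun _ => (0 : Vec d) := .const 0
  have hc : Source.coin k ∉ {y : Source n b | y.rank ≤ 5 * k + 4} := by simp [Source.rank]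
  rw [integral_norm_ite_sq (hN.coin_measurable k) hp (hN.coin_law k) h0.memLp hUC.memLp
    (hN.indepFun hc h0.measurable rfl) (hN.indepFun hc hUC.measurable rfl)]
  have h := hN.error_sum (src := fun i => Source.seed i k)
    (T := {y : Source n b | y.rank ≤ 5 * k + 3})
    (fun i j hij => by simpa using hij) (fun j => by simp [Source.rank])
    (fun i => hN.seed_measurable i k) (fun j => rfl)
    (fun i => (hN.compressor i k).isOracle) (fun i => (hX i).measurable)
    (fun i => (hX i).sq.const_mul ω) hU.measurable hU.memLp (1 / (n : ℝ))
  simp only [integral_const_mul, ← Finset.mul_sum] at h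
  have := sub_nonneg.2 hp1
  simp only [norm_zero, avg, smul_eq_mul]
  norm_num only [integral_zero, mul_zero, zero_add]
  refine mul_le_mul_of_nonneg_left (h.trans (le_of_eq ?_)) this
  ring

end Recursions

/-! ### The error quantities. -/

section Errors

variable {Ω : Type*} [MeasurableSpace Ω] {n d : ℕ} (F : Fin n → Vec d → ℝ) (P : Measure Ω)
  (s s' : Ω → State n d)

/-- The second moment of the compression error of `g`. -/
noncomputable def gErr : ℝ := ∫ z, ‖(s z).g - avg (s z).v‖ ^ 2 ∂P

/-- The second moment of the error of the averaged gradient estimators. -/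
noncomputable def vMeanErr : ℝ := ∫ z, ‖avg (s z).v - gradient (objective F) (s z).x‖ ^ 2 ∂P

/-- The average second moment of the errors of the gradient estimators. -/
noncomputable def vErr : ℝ := avg fun i => ∫ z, ‖(s z).v i - gradient (F i) ((s z).xw i)‖ ^ 2 ∂P

noncomputable def wxwErr : ℝ := avg fun i => ∫ z, ‖(s z).w i - (s z).xw i‖ ^ 2 ∂P

noncomputable def wxErr : ℝ := avg fun i => ∫ z, ‖(s z).w i - (s z).x‖ ^ 2 ∂P

noncomputable def wxwMeanErr : ℝ := ∫ z, ‖avg (s z).w - avg (s z).xw‖ ^ 2 ∂P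

noncomputable def wxMeanErr : ℝ := ∫ z, ‖avg (s z).w - (s z).x‖ ^ 2 ∂P

/-- The second moment of the displacement of `x`. -/
noncomputable def xStep : ℝ := ∫ z, ‖(s' z).x - (s z).x‖ ^ 2 ∂P

/-- The average second moment of the displacements of the worker variables `xᵢ`. -/
noncomputable def xwStep : ℝ := avg fun i => ∫ z, ‖(s' z).xw i - (s z).xw i‖ ^ 2 ∂P

/-- The average second moment of the displacements of the gradient estimators. -/
noncomputable def vStep : ℝ := avg fun i => ∫ z, ‖(s' z).v i - (s z).v i‖ ^ 2 ∂P

/-- The second moment of the heterogeneity error. -/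
noncomputable def heteroErr : ℝ :=
  ∫ z, ‖(avg fun i => gradient (F i) ((s z).xw i)) - gradient (objective F) (s z).x‖ ^ 2 ∂P

end Errors

/-! ### Recursions for the worker copies of the iterate. -/

section Recursions

variable {Ω Ξ Θ : Type*} {n d b : ℕ} [MeasurableSpace Ξ] [MeasurableSpace Θ]
  [mΩ : MeasurableSpace Ω] {N : Noise Ω Ξ Θ n d b} {P : Measure Ω} [IsProbabilityMeasure P]
  {D : Fin n → Measure Ξ} {ps p ωs ω : ℝ}
  {F : Fin n → Vec d → ℝ} {L : ℝ} {Li : Fin n → ℝ} {LA LB fstar σ : ℝ}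
  {G : Fin n → Vec d → Ξ → Vec d} {x0 : Vec d} {γ μ ν : ℝ}

local notation "S" => iterate N G x0 γ μ ν

lemma iterate_succ_w (k : ℕ) (z : Ω) (i : Fin n) :
    (S (k + 1) z).w i = if N.coinS k z then (S (k + 1) z).x else
      (S k z).w i + N.Cs i k ((S (k + 1) z).x - (S k z).x) (N.seedS i k z) := rfl

lemma iterate_succ_xw (k : ℕ) (z : Ω) (i : Fin n) :
    (S (k + 1) z).xw i = (1 - μ) • (S k z).xw i + μ • (S (k + 1) z).w i := rfl

lemma iterate_succ_v (k : ℕ) (z : Ω) (i : Fin n) :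
    (S (k + 1) z).v i = (1 - ν) • (S k z).v i
      + (ν / (b : ℝ)) • ∑ r, G i ((S (k + 1) z).xw i) (N.ξ i k r z) := rfl

lemma iterate_succ_g (k : ℕ) (z : Ω) :
    (S (k + 1) z).g = if N.coin k z then avg (S (k + 1) z).v else
      (S k z).g + avg fun i => N.C i k ((S (k + 1) z).v i - (S k z).v i) (N.seed i k z) := rfl

/-- The general server estimate with q = wᵢ − xᵢ, δ the displacement of x and y = x − wᵢ;
synchronization replaces q + δ by q + δ + y. -/
lemma integral_w_succ_sub_xw (hN : N.Valid P D ps p ωs ω)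
    (hps : 0 ≤ ps) (hps1 : ps ≤ 1) (hωs : 0 ≤ ωs) {k : ℕ} (h : IsAdapted N P (S k) (5 * k))
    {t : ℝ} (ht : 0 < t) (i : Fin n) :
    ∫ z, ‖(S (k + 1) z).w i - (S k z).xw i‖ ^ 2 ∂P
      ≤ (1 + t) * ∫ z, ‖(S k z).w i - (S k z).xw i‖ ^ 2 ∂P
        + (1 + 1 / t) * (2 * xStep P (S k) (S (k + 1))
          + 2 * ps ^ 2 * ∫ z, ‖(S k z).w i - (S k z).x‖ ^ 2 ∂P)
        + ps * ∫ z, ‖(S k z).w i - (S k z).x‖ ^ 2 ∂P + ωs * xStep P (S k) (S (k + 1)) := by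
  have h1 := hN.server_diff_sq_le hps hps1 hωs (J := Unit) (ι := fun _ => i)
    (fun _ _ _ => rfl) 1 ht ((isL2_x_succ h).sub h.x) ((h.w i).sub (h.xw i)) (h.x.sub (h.w i))
  simp only [norm_sub_rev (S k _).x ((S k _).w i)] at h1
  simp only [Fintype.card_unit, Nat.cast_one, one_pow, one_mul] at h1
  refine le_trans (le_of_eq ?_) h1
  refine integral_congr_ae (ae_of_all _ fun z => ?_)
  simp only [iterate_succ_w]
  congr 2
  split_ifs with hc
  · abel
  · simp
    abel

lemma integral_avg_w_succ_sub_xw (hn : 1 ≤ n) (hN : N.Valid P D ps p ωs ω)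
    (hps : 0 ≤ ps) (hps1 : ps ≤ 1) (hωs : 0 ≤ ωs) {k : ℕ} (h : IsAdapted N P (S k) (5 * k))
    {t : ℝ} (ht : 0 < t) :
    ∫ z, ‖avg (S (k + 1) z).w - avg (S k z).xw‖ ^ 2 ∂P
      ≤ (1 + t) * wxwMeanErr P (S k) + (1 + 1 / t) * (2 * xStep P (S k) (S (k + 1))
          + 2 * ps ^ 2 * wxMeanErr P (S k))
        + ps * wxMeanErr P (S k) + ωs / n * xStep P (S k) (S (k + 1)) := by
  have hw : N.IsL2 P (5 * k) fun z => avg (S k z).w := .avg h.w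
  have hxw : N.IsL2 P (5 * k) fun z => avg (S k z).xw := .avg h.xw
  have h1 := hN.server_diff_sq_le hps hps1 hωs (J := Fin n) (ι := fun i => i)
    (fun _ _ hij => hij) (1 / (n : ℝ)) ht ((isL2_x_succ h).sub h.x) (hw.sub hxw) (h.x.sub hw)
  simp only [norm_sub_rev (S k _).x (avg (S k _).w)] at h1
  have hn' : (n : ℝ) ≠ 0 := by positivity
  have e : (1 / (n : ℝ)) ^ 2 * ((n : ℝ) * (ωs * xStep P (S k) (S (k + 1))))
      = ωs / n * xStep P (S k) (S (k + 1)) := by field_simp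
  rw [← e]
  simp only [Fintype.card_fin] at h1
  refine le_trans (le_of_eq ?_) h1
  refine integral_congr_ae (ae_of_all _ fun z => ?_)
  simp only
  congr 2
  split_ifs with hc
  · have : (S (k + 1) z).w = fun _ => (S (k + 1) z).x := by
      funext i; rw [iterate_succ_w, if_pos hc]
    rw [this, avg_const hn]
    abel
  · have : (S (k + 1) z).w = fun i => (S k z).w i +
        N.Cs i k ((S (k + 1) z).x - (S k z).x) (N.seedS i k z) := by
      funext i; rw [iterate_succ_w, if_neg hc]
    rw [this, avg_add]
    have e2 := avg_sub (fun i => N.Cs i k ((S (k + 1) z).x - (S k z).x) (N.seedS i k z))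
      fun _ => (S (k + 1) z).x - (S k z).x
    rw [avg_const hn] at e2
    change _ = _ + avg _
    rw [e2]
    abel

lemma avg_le_of_le {u a b : Fin n → ℝ} (α β ρ : ℝ) (hn : 1 ≤ n) (r : ℝ)
    (h : ∀ i, u i ≤ α * a i + β * b i + ρ * r) :
    avg u ≤ α * avg a + β * avg b + ρ * r := by
  have h1 := avg_mono h
  rw [avg_add, avg_add, avg_mul, avg_mul, avg_const hn] at h1
  exact h1

/-- With the Young parameter t = μ, one factor 1 − μ of (1 − μ)² absorbs the loss 1 + μ and the
other remains as contraction. -/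
lemma contract_young {μ : ℝ} (h0 : 0 < μ) (h1 : μ ≤ 1) :
    (1 - μ) ^ 2 * (1 + μ) ≤ 1 - μ ∧ (1 - μ) ^ 2 * (1 + 1 / μ) ≤ 1 / μ ∧ (1 - μ) ^ 2 ≤ 1 := by
  refine ⟨by nlinarith [mul_nonneg (sub_nonneg.2 h1) (sq_nonneg μ)], ?_, by nlinarith⟩
  have e : (1 - μ) ^ 2 * (1 + 1 / μ) = (1 - μ) ^ 2 * (1 + μ) * (1 / μ) := by
    field_simp
    ring
  rw [e]
  exact mul_le_of_le_one_left (by positivity) (by nlinarith [mul_nonneg (sub_nonneg.2 h1) (sq_nonneg μ)])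

lemma contract_mul_le {μ Q R Z X : ℝ} (h0 : 0 < μ) (h1 : μ ≤ 1) (hQ : 0 ≤ Q)
    (hZ : 0 ≤ Z) (hR : 0 ≤ R)
    (h : X ≤ (1 + μ) * Q + (1 + 1 / μ) * Z + R) :
    (1 - μ) ^ 2 * X ≤ (1 - μ) * Q + 1 / μ * Z + R := by
  obtain ⟨c1, c2, c3⟩ := contract_young h0 h1
  have h2 := mul_le_mul_of_nonneg_left h (sq_nonneg (1 - μ))
  have h3 := mul_le_mul_of_nonneg_right c1 hQ
  have h4 := mul_le_mul_of_nonneg_right c2 hZ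
  have h5 := mul_le_mul_of_nonneg_right c3 hR
  linarith

lemma integral_sq_nonneg {Ω : Type*} [MeasurableSpace Ω] (P : Measure Ω) {d : ℕ}
    (X : Ω → Vec d) : 0 ≤ ∫ z, ‖X z‖ ^ 2 ∂P :=
  integral_nonneg fun _ => by positivity

lemma xStep_nonneg (s s' : Ω → State n d) : 0 ≤ xStep P s s' := integral_sq_nonneg P _

lemma integral_smul_sq (a : ℝ) (X : Ω → Vec d) :
    ∫ z, ‖a • X z‖ ^ 2 ∂P = a ^ 2 * ∫ z, ‖X z‖ ^ 2 ∂P := by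
  simp_rw [norm_smul, mul_pow, integral_const_mul, Real.norm_eq_abs, sq_abs]

/-- The momentum step multiplies the new w minus the old xᵢ by 1 − μ, which turns the server
estimate into a contraction. -/
lemma wxwErr_succ_le (hn : 1 ≤ n) (hN : N.Valid P D ps p ωs ω)
    (hps : 0 ≤ ps) (hps1 : ps ≤ 1) (hωs : 0 ≤ ωs) (hμ : 0 < μ) (hμ1 : μ ≤ 1) {k : ℕ}
    (h : IsAdapted N P (S k) (5 * k)) :
    wxwErr P (S (k + 1)) ≤ (1 - μ) * wxwErr P (S k) + (2 * ps ^ 2 / μ + ps) * wxErr P (S k)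
      + (2 / μ + ωs) * xStep P (S k) (S (k + 1)) := by
  refine avg_le_of_le _ _ _ hn _ fun i => ?_
  have h1 := integral_w_succ_sub_xw hN hps hps1 hωs h hμ i
  rw [add_assoc] at h1
  have hr := xStep_nonneg (P := P) (S k) (S (k + 1))
  have hE := integral_sq_nonneg P fun z => (S k z).w i - (S k z).x
  have h2 := contract_mul_le hμ hμ1 (integral_sq_nonneg P _) (by positivity) (by positivity) h1
  have e : ∀ z, (S (k + 1) z).w i - (S (k + 1) z).xw i
      = (1 - μ) • ((S (k + 1) z).w i - (S k z).xw i) := by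
    intro z
    rw [iterate_succ_xw]
    module
  simp_rw [e]
  rw [integral_smul_sq]
  refine h2.trans (le_of_eq ?_)
  field_simp
  ring

lemma wxwMeanErr_succ_le (hn : 1 ≤ n) (hN : N.Valid P D ps p ωs ω)
    (hps : 0 ≤ ps) (hps1 : ps ≤ 1) (hωs : 0 ≤ ωs) (hμ : 0 < μ) (hμ1 : μ ≤ 1) {k : ℕ}
    (h : IsAdapted N P (S k) (5 * k)) :
    wxwMeanErr P (S (k + 1)) ≤ (1 - μ) * wxwMeanErr P (S k)
      + (2 * ps ^ 2 / μ + ps) * wxMeanErr P (S k)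
      + (2 / μ + ωs / n) * xStep P (S k) (S (k + 1)) := by
  have h1 := integral_avg_w_succ_sub_xw hn hN hps hps1 hωs h hμ
  rw [add_assoc] at h1
  have hr := xStep_nonneg (P := P) (S k) (S (k + 1))
  have hE : 0 ≤ wxMeanErr P (S k) := integral_sq_nonneg P _
  have hF : 0 ≤ wxwMeanErr P (S k) := integral_sq_nonneg P _
  have h2 := contract_mul_le hμ hμ1 hF (by positivity) (by positivity) h1
  have e : ∀ z, avg (S (k + 1) z).w - avg (S (k + 1) z).xw
      = (1 - μ) • (avg (S (k + 1) z).w - avg (S k z).xw) := by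
    intro z
    have : (S (k + 1) z).xw = fun i => (1 - μ) • (S k z).xw i + μ • (S (k + 1) z).w i := rfl
    rw [this, avg_add, avg_smul, avg_smul]
    module
  rw [wxwMeanErr]
  simp_rw [e]
  rw [integral_smul_sq]
  refine h2.trans (le_of_eq ?_)
  field_simp
  ring

lemma xwStep_le (hn : 1 ≤ n) (hN : N.Valid P D ps p ωs ω)
    (hps : 0 ≤ ps) (hps1 : ps ≤ 1) (hωs : 0 ≤ ωs) {k : ℕ}
    (h : IsAdapted N P (S k) (5 * k)) :
    xwStep P (S k) (S (k + 1)) ≤ μ ^ 2 * (2 * wxwErr P (S k)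
      + (4 * ps ^ 2 + ps) * wxErr P (S k) + (4 + ωs) * xStep P (S k) (S (k + 1))) := by
  have e : ∀ i z, (S (k + 1) z).xw i - (S k z).xw i
      = μ • ((S (k + 1) z).w i - (S k z).xw i) := by
    intro i z
    rw [iterate_succ_xw]
    module
  simp_rw [xwStep, e, integral_smul_sq, avg_mul]
  refine mul_le_mul_of_nonneg_left (avg_le_of_le _ _ _ hn _ fun i => ?_) (sq_nonneg μ)
  -- The displacement of xᵢ already carries the factor μ², so no contraction is needed and Young's
  -- parameter 1 suffices.
  have h1 := integral_w_succ_sub_xw hN hps hps1 hωs h one_pos i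
  refine h1.trans (le_of_eq ?_)
  ring

/-- Synchronization sets wᵢ − x to zero. Otherwise the displacement of x cancels and only the
centered compression error is added. -/
lemma wxErr_succ_le (hn : 1 ≤ n) (hN : N.Valid P D ps p ωs ω)
    (hps : 0 ≤ ps) (hps1 : ps ≤ 1) (hωs : 0 ≤ ωs) {k : ℕ}
    (h : IsAdapted N P (S k) (5 * k)) :
    wxErr P (S (k + 1)) ≤ (1 - ps) * wxErr P (S k) + ωs * xStep P (S k) (S (k + 1)) := by
  have hr := xStep_nonneg (P := P) (S k) (S (k + 1))
  have key : ∀ i, ∫ z, ‖(S (k + 1) z).w i - (S (k + 1) z).x‖ ^ 2 ∂P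
      ≤ (1 - ps) * ∫ z, ‖(S k z).w i - (S k z).x‖ ^ 2 ∂P
        + 0 * ∫ z, ‖(S k z).w i - (S k z).x‖ ^ 2 ∂P + ωs * xStep P (S k) (S (k + 1)) := by
    intro i
    have h1 := hN.server_sq_le hps hps1 (J := Unit) (ι := fun _ => i)
      (fun _ _ _ => rfl) 1 ((isL2_x_succ h).sub h.x) ((h.w i).sub h.x) (.const 0)
    refine le_trans (le_of_eq (integral_congr_ae (ae_of_all _ fun z => ?_))) (h1.trans ?_)
    · simp only [iterate_succ_w]
      congr 2
      split_ifs with hc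
      · abel
      · simp
        abel
    simp only [Fintype.card_unit, Nat.cast_one, one_pow, one_mul, norm_zero]
    change _ + (1 - ps) * (_ + ωs * xStep P (S k) (S (k + 1))) ≤ _
    have : 0 ≤ ps * (ωs * xStep P (S k) (S (k + 1))) := by positivity
    norm_num only [integral_zero]
    linarith
  have := avg_le_of_le _ _ _ hn _ key
  rw [zero_mul, add_zero] at this
  exact this

lemma wxMeanErr_succ_le (hn : 1 ≤ n) (hN : N.Valid P D ps p ωs ω)
    (hps : 0 ≤ ps) (hps1 : ps ≤ 1) (hωs : 0 ≤ ωs) {k : ℕ}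
    (h : IsAdapted N P (S k) (5 * k)) :
    wxMeanErr P (S (k + 1)) ≤ (1 - ps) * wxMeanErr P (S k)
      + ωs / n * xStep P (S k) (S (k + 1)) := by
  have hr := xStep_nonneg (P := P) (S k) (S (k + 1))
  have hw : N.IsL2 P (5 * k) fun z => avg (S k z).w := .avg h.w
  have h1 := hN.server_sq_le hps hps1 (J := Fin n) (ι := fun i => i)
    (fun _ _ hij => hij) (1 / (n : ℝ)) ((isL2_x_succ h).sub h.x) (hw.sub h.x) (.const 0)
  refine le_trans (le_of_eq (integral_congr_ae (ae_of_all _ fun z => ?_))) (h1.trans ?_)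
  · simp only
    congr 2
    split_ifs with hc
    · have : (S (k + 1) z).w = fun _ => (S (k + 1) z).x := by
        funext i; rw [iterate_succ_w, if_pos hc]
      rw [this, avg_const hn]
      abel
    · have : (S (k + 1) z).w = fun i => (S k z).w i +
          N.Cs i k ((S (k + 1) z).x - (S k z).x) (N.seedS i k z) := by
        funext i; rw [iterate_succ_w, if_neg hc]
      rw [this, avg_add]
      have e2 := avg_sub (fun i => N.Cs i k ((S (k + 1) z).x - (S k z).x) (N.seedS i k z))
        fun _ => (S (k + 1) z).x - (S k z).x
      rw [avg_const hn] at e2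
      change _ = _ + avg _
      rw [e2]
      abel
  simp only [Fintype.card_fin, norm_zero]
  change _ + (1 - ps) * (_ + (1 / (n : ℝ)) ^ 2 * (n * (ωs * xStep P (S k) (S (k + 1))))) ≤ _
  have hn' : (n : ℝ) ≠ 0 := by positivity
  have e2 : (1 / (n : ℝ)) ^ 2 * ((n : ℝ) * (ωs * xStep P (S k) (S (k + 1))))
      = ωs / n * xStep P (S k) (S (k + 1)) := by field_simp
  rw [e2]
  have : 0 ≤ ps * (ωs / n * xStep P (S k) (S (k + 1))) := by positivity
  norm_num only [integral_zero]
  change _ ≤ (1 - ps) * (∫ z, ‖avg (S k z).w - (S k z).x‖ ^ 2 ∂P) + _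
  linarith

end Recursions

/-! ### Consequences of smoothness and similarity for the objective. -/

section Problem

variable {Ξ : Type*} [MeasurableSpace Ξ] {n d : ℕ} {D : Fin n → Measure Ξ}
  {F : Fin n → Vec d → ℝ} {L : ℝ} {Li : Fin n → ℝ} {LA LB fstar σ : ℝ}
  {G : Fin n → Vec d → Ξ → Vec d}

lemma gradient_objective (hF : ∀ i, Differentiable ℝ (F i)) (x : Vec d) :
    gradient (objective F) x = avg fun i => gradient (F i) x := by
  have h : HasFDerivAt (objective F) ((1 / (n : ℝ)) • ∑ i, fderiv ℝ (F i) x) x :=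
    (HasFDerivAt.fun_sum fun i _ => (hF i x).hasFDerivAt).const_smul (1 / (n : ℝ))
  simp only [gradient, avg]
  rw [h.fderiv, map_smulₛₗ, map_sum]
  simp

lemma Assumptions.gradient_objective (hA : Assumptions F L Li LA LB fstar σ D G) (x : Vec d) :
    gradient (objective F) x = avg fun i => gradient (F i) x :=
  M4.gradient_objective (fun i => (hA.smooth_worker i).2.1) x

lemma le_Lmax (i : Fin n) : Li i ≤ Lmax Li LA LB :=
  (le_ciSup (Set.finite_range Li).bddAbove i).trans (le_max_left _ _)

lemma Assumptions.smooth_Lmax (hA : Assumptions F L Li LA LB fstar σ D G) (i : Fin n) :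
    IsSmooth (F i) (Lmax Li LA LB) := by
  obtain ⟨h0, h1, h2⟩ := hA.smooth_worker i
  refine ⟨h0.trans (le_Lmax i), h1, fun x y => (h2 x y).trans ?_⟩
  gcongr
  exact le_Lmax i

/-- This allows L_max to replace L, which the equal-momentum step size does not contain. -/
lemma Assumptions.smooth_objective_Lmax (hn : 1 ≤ n) (hA : Assumptions F L Li LA LB fstar σ D G) :
    IsSmooth (objective F) (Lmax Li LA LB) := by
  refine ⟨(hA.smooth_Lmax ⟨0, hn⟩).1, hA.smooth.2.1, fun x y => ?_⟩
  rw [hA.gradient_objective, hA.gradient_objective, ← avg_sub]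
  have h1 : ‖avg fun i => gradient (F i) x - gradient (F i) y‖
      ≤ avg fun i => ‖gradient (F i) x - gradient (F i) y‖ := by
    simp only [avg, smul_eq_mul]
    rw [norm_smul, Real.norm_of_nonneg (by positivity)]
    gcongr
    exact norm_sum_le _ _
  refine h1.trans ((avg_mono fun i => (hA.smooth_Lmax i).2.2 x y).trans (le_of_eq ?_))
  rw [avg_const hn]

lemma IsSmooth.gradient_sub_sq_le {f : Vec d → ℝ} (h : IsSmooth f L) (x y : Vec d) :
    ‖gradient f x - gradient f y‖ ^ 2 ≤ L ^ 2 * ‖x - y‖ ^ 2 := by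
  rw [← mul_pow]
  exact pow_le_pow_left₀ (norm_nonneg _) (h.2.2 x y) 2

lemma Assumptions.hetero_sq_le (hn : 1 ≤ n) (hA : Assumptions F L Li LA LB fstar σ D G)
    (x : Vec d) (y : Fin n → Vec d) :
    ‖(avg fun i => gradient (F i) (y i)) - gradient (objective F) x‖ ^ 2
      ≤ LA ^ 2 * avg (fun i => ‖y i - x‖ ^ 2) + LB ^ 2 * ‖avg y - x‖ ^ 2 := by
  have h := hA.similar.2.2 x fun i => y i - x
  simp only [add_sub_cancel] at h
  rw [avg_sub, avg_sub, avg_const hn, ← hA.gradient_objective] at h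
  exact h

/-- Similarity with all uᵢ equal is a Lipschitz bound for ∇f. With it the drift of ∇f is expressed
through L_A and L_B, so L enters the step size only through the descent inequality. -/
lemma Assumptions.gradient_objective_sub_sq_le (hn : 1 ≤ n)
    (hA : Assumptions F L Li LA LB fstar σ D G) (x y : Vec d) :
    ‖gradient (objective F) x - gradient (objective F) y‖ ^ 2
      ≤ (LA ^ 2 + LB ^ 2) * ‖x - y‖ ^ 2 := by
  have h := hA.hetero_sq_le hn y fun _ => x
  rw [← hA.gradient_objective, avg_const hn, avg_const hn] at h
  rw [add_mul]
  exact h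

end Problem

/-! ### Recursions for the gradient estimators and the objective. -/

section Recursions

variable {Ω Ξ Θ : Type*} {n d b : ℕ} [MeasurableSpace Ξ] [MeasurableSpace Θ]
  [mΩ : MeasurableSpace Ω] {N : Noise Ω Ξ Θ n d b} {P : Measure Ω} [IsProbabilityMeasure P]
  {D : Fin n → Measure Ξ} {ps p ωs ω : ℝ}
  {F : Fin n → Vec d → ℝ} {L : ℝ} {Li : Fin n → ℝ} {LA LB fstar σ : ℝ}
  {G : Fin n → Vec d → Ξ → Vec d} {x0 : Vec d} {γ μ ν : ℝ}

local notation "S" => iterate N G x0 γ μ ν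

/-- Similarity bounds the error by the deviations xᵢ − x and their mean; both are split at w. -/
lemma heteroErr_le (hn : 1 ≤ n) (hA : Assumptions F L Li LA LB fstar σ D G)
    {s : Ω → State n d} {t : ℕ} (h : IsAdapted N P s t) :
    heteroErr F P s ≤ 2 * LA ^ 2 * (wxwErr P s + wxErr P s)
      + 2 * LB ^ 2 * (wxwMeanErr P s + wxMeanErr P s) := by
  have hw : N.IsL2 P t fun z => avg (s z).w := .avg h.w
  have hxw : N.IsL2 P t fun z => avg (s z).xw := .avg h.xw
  have key : ∀ a b c : Vec d, ‖b - c‖ ^ 2 ≤ 2 * ‖a - b‖ ^ 2 + 2 * ‖a - c‖ ^ 2 := by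
    intro a b c
    have := norm_add_sq_le_two (b - a) (a - c)
    rwa [sub_add_sub_cancel, norm_sub_rev b a] at this
  have i1 := integrable_avg fun i => ((h.w i).sub (h.xw i)).sq
  have i2 := integrable_avg fun i => ((h.w i).sub h.x).sq
  have i3 := (hw.sub hxw).sq
  have i4 := (hw.sub h.x).sq
  have hle : ∀ z, ‖(avg fun i => gradient (F i) ((s z).xw i))
        - gradient (objective F) (s z).x‖ ^ 2
      ≤ 2 * LA ^ 2 * (avg (fun i => ‖(s z).w i - (s z).xw i‖ ^ 2)
          + avg fun i => ‖(s z).w i - (s z).x‖ ^ 2)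
        + 2 * LB ^ 2 * (‖avg (s z).w - avg (s z).xw‖ ^ 2 + ‖avg (s z).w - (s z).x‖ ^ 2) := by
    intro z
    have h1 := hA.hetero_sq_le hn (s z).x (s z).xw
    have h2 := avg_mono fun i => key ((s z).w i) ((s z).xw i) (s z).x
    rw [avg_add, avg_mul, avg_mul] at h2
    have h3 := key (avg (s z).w) (avg (s z).xw) (s z).x
    have h4 := mul_le_mul_of_nonneg_left h2 (sq_nonneg LA)
    have h5 := mul_le_mul_of_nonneg_left h3 (sq_nonneg LB)
    linarith
  have hg : N.IsL2 P t fun z => (avg fun i => gradient (F i) ((s z).xw i))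
      - gradient (objective F) (s z).x :=
    (Noise.IsL2.avg fun i => (h.xw i).grad (hA.smooth_worker i)).sub (h.x.grad hA.smooth)
  have i12 := (i1.add i2).const_mul (2 * LA ^ 2)
  have i34 := (i3.add i4).const_mul (2 * LB ^ 2)
  refine (integral_mono hg.sq (i12.add i34) hle).trans (le_of_eq ?_)
  rw [integral_add' i12 i34]
  simp only [integral_const_mul]
  rw [integral_add' i1 i2, integral_add' i3 i4, integral_avg fun i => ((h.w i).sub (h.xw i)).sq,
    integral_avg fun i => ((h.w i).sub h.x).sq]
  rfl

/-- Synchronization sets g − v to zero. Otherwise the centered errors of compressing the increments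
of vᵢ are added to the old g − v, independently across workers. -/
lemma gErr_succ_le (hA : Assumptions F L Li LA LB fstar σ D G) (hN : N.Valid P D ps p ωs ω)
    (hp : 0 ≤ p) (hp1 : p ≤ 1) {k : ℕ} (h : IsAdapted N P (S k) (5 * k)) :
    gErr P (S (k + 1)) ≤ (1 - p) * (gErr P (S k) + ω / n * vStep P (S k) (S (k + 1))) := by
  have hv : ∀ i, N.IsL2 P (5 * k + 3) fun z => (S k z).v i := fun i => (h.v i).mono (by omega)
  have hg : N.IsL2 P (5 * k + 3) fun z => (S k z).g := h.g.mono (by omega)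
  have h1 := hN.worker_sq_le hp hp1 (fun i => (isL2_v_succ hA hN h i).sub (hv i))
    (hg.sub (.avg hv))
  refine le_trans (le_of_eq (integral_congr_ae (ae_of_all _ fun z => ?_))) h1
  simp only [iterate_succ_g]
  congr 2
  split_ifs with hc
  · abel
  · have e1 := avg_sub (fun i => N.C i k ((S (k + 1) z).v i - (S k z).v i) (N.seed i k z))
      fun i => (S (k + 1) z).v i - (S k z).v i
    have e2 := avg_sub (S (k + 1) z).v (S k z).v
    change _ = _ + avg _
    rw [e1, e2]
    abel

lemma vErr_succ_le (hb : 1 ≤ b) (hn : 1 ≤ n) (hA : Assumptions F L Li LA LB fstar σ D G)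
    (hN : N.Valid P D ps p ωs ω) (hν : 0 < ν) (hν1 : ν ≤ 1) {k : ℕ}
    (h : IsAdapted N P (S k) (5 * k)) :
    vErr F P (S (k + 1)) ≤ (1 - ν) * vErr F P (S k)
      + 1 / ν * Lmax Li LA LB ^ 2 * xwStep P (S k) (S (k + 1)) + ν ^ 2 * σ ^ 2 / b := by
  have hxw := isL2_xw_succ hN h
  rw [← mul_one (ν ^ 2 * σ ^ 2 / b)]
  refine avg_le_of_le _ _ _ hn _ fun i => ?_
  have hg := ((h.xw i).grad (hA.smooth_worker i))
  have i1 : N.IsL2 P (5 * k + 2) fun z => (S k z).v i - gradient (F i) ((S k z).xw i) :=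
    ((h.v i).sub hg).mono (by omega)
  have i2 : N.IsL2 P (5 * k + 2)
      fun z => gradient (F i) ((S k z).xw i) - gradient (F i) ((S (k + 1) z).xw i) :=
    (hg.mono (by omega)).sub ((hxw i).grad (hA.smooth_worker i))
  have i3 : N.IsL2 P (5 * k + 2) fun z => (S (k + 1) z).xw i - (S k z).xw i :=
    (hxw i).sub ((h.xw i).mono (by omega))
  -- The conditional mean of the new estimator error: the old error plus the gradient drift, both
  -- damped by 1 − ν. Only sampling noise is left.
  have hU := (i1.smul (1 - ν)).add (i2.smul (1 - ν))
  have h1 := hN.sample_sq_le hA (J := Fin b) (ι := fun r => (i, r))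
    (fun _ _ hij => (Prod.ext_iff.1 hij).2) (ν / (b : ℝ)) hxw hU
  have hb' : (b : ℝ) ≠ 0 := by positivity
  have e : (ν / (b : ℝ)) ^ 2 * ((Fintype.card (Fin b) : ℝ) * σ ^ 2) = ν ^ 2 * σ ^ 2 / b := by
    rw [Fintype.card_fin]
    field_simp
  rw [e] at h1
  have h2 := integral_mono hU.sq ((i1.sq.const_mul (1 - ν)).add
    ((i3.sq.const_mul (Lmax Li LA LB ^ 2)).const_mul (1 / ν))) fun z => by
      refine (norm_contract_sq_le hν hν1 _ _).trans ?_
      simp only [Pi.add_apply]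
      gcongr
      rw [norm_sub_rev]
      exact (hA.smooth_Lmax i).gradient_sub_sq_le _ _
  rw [integral_add' (i1.sq.const_mul (1 - ν))
    ((i3.sq.const_mul (Lmax Li LA LB ^ 2)).const_mul (1 / ν))] at h2
  simp only [integral_const_mul] at h2
  rw [mul_one]
  refine le_trans (le_of_eq (integral_congr_ae (ae_of_all _ fun z => ?_)))
    (h1.trans (by linarith))
  simp only [iterate_succ_v, Finset.sum_sub_distrib, Finset.sum_const, Finset.card_univ,
    Fintype.card_fin]
  congr 2
  rw [smul_sub (ν / (b : ℝ)), ← Nat.cast_smul_eq_nsmul ℝ, smul_smul, div_mul_cancel₀ _ hb']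
  module

lemma vStep_le (hb : 1 ≤ b) (hn : 1 ≤ n) (hA : Assumptions F L Li LA LB fstar σ D G)
    (hN : N.Valid P D ps p ωs ω) {k : ℕ} (h : IsAdapted N P (S k) (5 * k)) :
    vStep P (S k) (S (k + 1)) ≤ 5 / 4 * ν ^ 2 * vErr F P (S k)
      + 5 * ν ^ 2 * Lmax Li LA LB ^ 2 * xwStep P (S k) (S (k + 1)) + ν ^ 2 * σ ^ 2 / b := by
  have hxw := isL2_xw_succ hN h
  rw [← mul_one (ν ^ 2 * σ ^ 2 / b)]
  refine avg_le_of_le _ _ _ hn _ fun i => ?_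
  have hg := ((h.xw i).grad (hA.smooth_worker i))
  have i1 : N.IsL2 P (5 * k + 2) fun z => (S k z).v i - gradient (F i) ((S k z).xw i) :=
    ((h.v i).sub hg).mono (by omega)
  have i2 : N.IsL2 P (5 * k + 2)
      fun z => gradient (F i) ((S k z).xw i) - gradient (F i) ((S (k + 1) z).xw i) :=
    (hg.mono (by omega)).sub ((hxw i).grad (hA.smooth_worker i))
  have i3 : N.IsL2 P (5 * k + 2) fun z => (S (k + 1) z).xw i - (S k z).xw i :=
    (hxw i).sub ((h.xw i).mono (by omega))
  have hU := (i1.add i2).smul (-ν)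
  have h1 := hN.sample_sq_le hA (J := Fin b) (ι := fun r => (i, r))
    (fun _ _ hij => (Prod.ext_iff.1 hij).2) (ν / (b : ℝ)) hxw hU
  have hb' : (b : ℝ) ≠ 0 := by positivity
  have e : (ν / (b : ℝ)) ^ 2 * ((Fintype.card (Fin b) : ℝ) * σ ^ 2) = ν ^ 2 * σ ^ 2 / b := by
    rw [Fintype.card_fin]
    field_simp
  rw [e, integral_smul_sq] at h1
  have h2 := integral_mono (i1.add i2).sq ((i1.sq.const_mul (5 / 4)).add
    ((i3.sq.const_mul (Lmax Li LA LB ^ 2)).const_mul 5)) fun z => by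
      -- The parameter 1/4 produces the factors 5/4 and 5 of the statement.
      refine (norm_add_sq_le_young (t := 1 / 4) (by norm_num) _ _).trans ?_
      norm_num only [Pi.add_apply]
      gcongr
      rw [norm_sub_rev]
      exact (hA.smooth_Lmax i).gradient_sub_sq_le _ _
  rw [integral_add' (i1.sq.const_mul (5 / 4))
    ((i3.sq.const_mul (Lmax Li LA LB ^ 2)).const_mul 5)] at h2
  simp only [integral_const_mul] at h2
  have h3 := mul_le_mul_of_nonneg_left h2 (sq_nonneg (-ν))
  rw [mul_one]
  refine le_trans (le_of_eq (integral_congr_ae (ae_of_all _ fun z => ?_)))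
    (h1.trans (by linarith))
  simp only [iterate_succ_v, Finset.sum_sub_distrib, Finset.sum_const, Finset.card_univ,
    Fintype.card_fin]
  congr 2
  rw [smul_sub (ν / (b : ℝ)), ← Nat.cast_smul_eq_nsmul ℝ, smul_smul, div_mul_cancel₀ _ hb']
  module

lemma vMeanErr_succ_le (hb : 1 ≤ b) (hn : 1 ≤ n) (hA : Assumptions F L Li LA LB fstar σ D G)
    (hN : N.Valid P D ps p ωs ω) (hν : 0 < ν) (hν1 : ν ≤ 1) {k : ℕ}
    (h : IsAdapted N P (S k) (5 * k)) :
    vMeanErr F P (S (k + 1)) ≤ (1 - ν) * vMeanErr F P (S k)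
      + 2 / ν * (LA ^ 2 + LB ^ 2) * xStep P (S k) (S (k + 1))
      + 2 * ν * heteroErr F P (S (k + 1)) + ν ^ 2 * σ ^ 2 / (n * b) := by
  have hxw := isL2_xw_succ hN h
  have hx : N.IsL2 P (5 * k + 2) fun z => (S k z).x := h.x.mono (by omega)
  have hx' : N.IsL2 P (5 * k + 2) fun z => (S (k + 1) z).x := (isL2_x_succ h).mono (by omega)
  have i1 : N.IsL2 P (5 * k + 2) fun z => avg (S k z).v - gradient (objective F) (S k z).x :=
    (Noise.IsL2.avg fun i => (h.v i).mono (by omega)).sub (hx.grad hA.smooth)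
  have i2 : N.IsL2 P (5 * k + 2)
      fun z => gradient (objective F) (S k z).x - gradient (objective F) (S (k + 1) z).x :=
    (hx.grad hA.smooth).sub (hx'.grad hA.smooth)
  have i3 : N.IsL2 P (5 * k + 2) fun z => (avg fun i => gradient (F i) ((S (k + 1) z).xw i))
      - gradient (objective F) (S (k + 1) z).x :=
    (Noise.IsL2.avg fun i => (hxw i).grad (hA.smooth_worker i)).sub (hx'.grad hA.smooth)
  -- The samples are taken at xᵢ and not at x, which adds ν times the heterogeneity error at time k
  -- + 1. The noise is summed over all pairs of worker and sample, whence the factor 1/(nb).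
  have hU := ((i1.smul (1 - ν)).add (i2.smul (1 - ν))).add (i3.smul ν)
  have h1 := hN.sample_sq_le hA (J := Fin n × Fin b) (ι := fun j => j)
    (fun _ _ hij => hij) (ν / (n * b : ℝ)) hxw hU
  have hb' : (b : ℝ) ≠ 0 := by positivity
  have hn' : (n : ℝ) ≠ 0 := by positivity
  have e : (ν / (n * b : ℝ)) ^ 2 * ((Fintype.card (Fin n × Fin b) : ℝ) * σ ^ 2)
      = ν ^ 2 * σ ^ 2 / (n * b) := by
    rw [Fintype.card_prod, Fintype.card_fin, Fintype.card_fin, Nat.cast_mul]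
    field_simp
  rw [e] at h1
  have j1 := i1.sq.const_mul (1 - ν)
  have j2 := ((hx'.sub hx).sq.const_mul (LA ^ 2 + LB ^ 2)).const_mul (2 / ν)
  have j3 := i3.sq.const_mul (2 * ν)
  have h2 := integral_mono hU.sq ((j1.add j2).add j3) fun z => by
      refine (norm_contract_add_sq_le hν hν1 _ _ _).trans ?_
      simp only [Pi.add_apply]
      gcongr
      rw [norm_sub_rev]
      exact hA.gradient_objective_sub_sq_le hn _ _
  rw [integral_add' (j1.add j2) j3, integral_add' j1 j2] at h2
  simp only [integral_const_mul] at h2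
  change _ ≤ (1 - ν) * vMeanErr F P (S k) + 2 / ν * ((LA ^ 2 + LB ^ 2) * xStep P (S k) (S (k + 1)))
    + 2 * ν * heteroErr F P (S (k + 1)) at h2
  refine le_trans (le_of_eq (integral_congr_ae (ae_of_all _ fun z => ?_)))
    (h1.trans (by linarith))
  simp only [Fintype.sum_prod_type, Finset.sum_sub_distrib, Finset.sum_const, Finset.card_univ,
    Fintype.card_fin]
  congr 2
  have e1 : avg (S (k + 1) z).v = (1 - ν) • avg (S k z).v
      + (ν / (n * b : ℝ)) • ∑ i, ∑ r, G i ((S (k + 1) z).xw i) (N.ξ i k r z) := by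
    have : (S (k + 1) z).v = fun i => (1 - ν) • (S k z).v i
      + (ν / (b : ℝ)) • ∑ r, G i ((S (k + 1) z).xw i) (N.ξ i k r z) := rfl
    rw [this, avg_add, avg_smul, avg_smul]
    simp only [avg]
    rw [smul_smul, smul_smul, show ν / (b : ℝ) * (1 / n) = ν / (n * b) by field_simp]
  have e2 : (ν / (n * b : ℝ)) • ∑ i, b • gradient (F i) ((S (k + 1) z).xw i)
      = ν • avg fun i => gradient (F i) ((S (k + 1) z).xw i) := by
    simp only [avg]
    rw [← Finset.smul_sum, ← Nat.cast_smul_eq_nsmul ℝ, smul_smul, smul_smul]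
    congr 1
    field_simp
  rw [smul_sub (ν / (n * b : ℝ)), e2, e1]
  module

lemma objective_succ_le (hA : Assumptions F L Li LA LB fstar σ D G) {L' : ℝ}
    (hL : IsSmooth (objective F) L') (hγ : 0 < γ) {k : ℕ} (h : IsAdapted N P (S k) (5 * k)) :
    ∫ z, (objective F (S (k + 1) z).x - fstar) ∂P
        + γ / 2 * ∫ z, ‖gradient (objective F) (S k z).x‖ ^ 2 ∂P
        + (1 / (2 * γ) - L' / 2) * xStep P (S k) (S (k + 1))
      ≤ ∫ z, (objective F (S k z).x - fstar) ∂P + γ * (gErr P (S k) + vMeanErr F P (S k)) := by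
  have hx' := isL2_x_succ h
  have hg := h.x.grad hA.smooth
  have hv : N.IsL2 P (5 * k) fun z => avg (S k z).v := .avg h.v
  have i1 := hA.smooth.integrable hA.lower_bound hx'.memLp
  have i2 := hg.sq.const_mul (γ / 2)
  have i3 := (hx'.sub h.x).sq.const_mul (1 / (2 * γ) - L' / 2)
  have i4 := hA.smooth.integrable hA.lower_bound h.x.memLp
  have i5 := (h.g.sub hv).sq.const_mul γ
  have i6 := (hv.sub hg).sq.const_mul γ
  have h2 := integral_mono ((i1.add i2).add i3) ((i4.add i5).add i6) fun z => by
    have h1 := hL.descent_step hγ (S k z).x (S k z).g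
    have h3 := norm_add_sq_le_two ((S k z).g - avg (S k z).v)
      (avg (S k z).v - gradient (objective F) (S k z).x)
    rw [sub_add_sub_cancel] at h3
    have h4 := mul_le_mul_of_nonneg_left h3 (half_pos hγ).le
    have e : (S (k + 1) z).x = (S k z).x - γ • (S k z).g := rfl
    simp only [Pi.add_apply]
    rw [e]
    linarith
  rw [integral_add' (i1.add i2) i3, integral_add' i1 i2, integral_add' (i4.add i5) i6,
    integral_add' i4 i5] at h2
  simp only [integral_const_mul] at h2
  rw [mul_add, ← add_assoc]
  exact h2

end Recursions

/-! ### Deterministic analysis of the coupled recursions. -/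

section Sequences

/-- The coupled recursions satisfied by the expected errors of the method. Here `x = L_A²`,
`y = L_B²`, `m = L_max²`, `q = ω / n`, `ωm = ωs / n`, and `τ`, `τm` are the variances of the
estimators of one worker and of the average; `e` is an additional error of the gradient. -/
structure ErrorRecursion (γ L ps p ν μ ωs ωm q x y m τ τm e : ℝ)
    (f g r A B C D E F G M : ℕ → ℝ) : Prop where
  f_nonneg : ∀ k, 0 ≤ f k
  r_nonneg : ∀ k, 0 ≤ r k
  A_nonneg : ∀ k, 0 ≤ A k
  B_nonneg : ∀ k, 0 ≤ B k
  C_nonneg : ∀ k, 0 ≤ C k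
  D_nonneg : ∀ k, 0 ≤ D k
  E_nonneg : ∀ k, 0 ≤ E k
  F_nonneg : ∀ k, 0 ≤ F k
  G_nonneg : ∀ k, 0 ≤ G k
  M_nonneg : ∀ k, 0 ≤ M k
  f_succ : ∀ k, f (k + 1) + γ / 2 * g k + (1 / (2 * γ) - L / 2) * r k
    ≤ f k + γ * (A k + B k) + γ * e
  A_succ : ∀ k, A (k + 1) ≤ (1 - p) * A k
    + q * (5 / 4 * ν ^ 2 * C k + 5 * ν ^ 2 * m * M k + τ)
  B_succ : ∀ k, B (k + 1) ≤ (1 - ν) * B k + 2 / ν * (x + y) * r k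
    + 4 * ν * (x * (D (k + 1) + E (k + 1)) + y * (F (k + 1) + G (k + 1))) + τm
  C_succ : ∀ k, C (k + 1) ≤ (1 - ν) * C k + 1 / ν * m * M k + τ
  D_succ : ∀ k, D (k + 1) ≤ (1 - μ) * D k + (2 * ps ^ 2 / μ + ps) * E k + (2 / μ + ωs) * r k
  E_succ : ∀ k, E (k + 1) ≤ (1 - ps) * E k + ωs * r k
  F_succ : ∀ k, F (k + 1) ≤ (1 - μ) * F k + (2 * ps ^ 2 / μ + ps) * G k + (2 / μ + ωm) * r k
  G_succ : ∀ k, G (k + 1) ≤ (1 - ps) * G k + ωm * r k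
  M_le : ∀ k, M k ≤ μ ^ 2 * (2 * D k + (4 * ps ^ 2 + ps) * E k + (4 + ωs) * r k)

variable {γ L ps p ν μ ωs ωm q x y m τ τm e : ℝ} {f g r A B C D E F G M : ℕ → ℝ}

/-- The weighted sum of the errors decreases, provided that the weights satisfy a linear system. -/
lemma ErrorRecursion.step
    (h : ErrorRecursion γ L ps p ν μ ωs ωm q x y m τ τm e f g r A B C D E F G M)
    {lA lB lC lD lE lF lG a : ℝ} (hlA : 0 ≤ lA) (hlB : 0 ≤ lB) (hlC : 0 ≤ lC)
    (hlD : 0 ≤ lD) (hlE : 0 ≤ lE) (hlF : 0 ≤ lF) (hlG : 0 ≤ lG) (ha : 0 ≤ a)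
    (hx : 0 ≤ γ * x) (hy : 0 ≤ γ * y)
    (hA : lA * p = γ) (hB : lB * ν = γ) (hC : lA * q * (5 / 4 * ν ^ 2) = lC * ν)
    (hM : lA * q * (5 * ν ^ 2 * m) + lC * (1 / ν * m) ≤ a)
    (hD : (lD + 4 * γ * x) * (1 - μ) + a * (2 * μ ^ 2) ≤ lD)
    (hE : (lE + 4 * γ * x) * (1 - ps) + (lD + 4 * γ * x) * (2 * ps ^ 2 / μ + ps)
      + a * (μ ^ 2 * (4 * ps ^ 2 + ps)) ≤ lE)
    (hF : (lF + 4 * γ * y) * (1 - μ) ≤ lF)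
    (hG : (lG + 4 * γ * y) * (1 - ps) + (lF + 4 * γ * y) * (2 * ps ^ 2 / μ + ps) ≤ lG)
    (hr : (lD + 4 * γ * x) * (2 / μ + ωs) + (lE + 4 * γ * x) * ωs + a * (μ ^ 2 * (4 + ωs))
      + (lF + 4 * γ * y) * (2 / μ + ωm) + (lG + 4 * γ * y) * ωm + lB * (2 / ν * (x + y))
      ≤ 1 / (2 * γ) - L / 2) (k : ℕ) :
    f (k + 1) + lA * A (k + 1) + lB * B (k + 1) + lC * C (k + 1) + lD * D (k + 1)
        + lE * E (k + 1) + lF * F (k + 1) + lG * G (k + 1) + γ / 2 * g k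
      ≤ f k + lA * A k + lB * B k + lC * C k + lD * D k + lE * E k + lF * F k + lG * G k
        + (γ * e + lA * q * τ + lC * τ + lB * τm) := by
  have eA : lA * p * A k = γ * A k := by rw [hA]
  have eB : lB * ν * B k = γ * B k := by rw [hB]
  have eC : lA * q * (5 / 4 * ν ^ 2) * C k = lC * ν * C k := by rw [hC]
  -- The recursion of B contains D, E, F, G at time k + 1. As lB ν = γ, this raises their weights by
  -- 4γx or 4γy, so their recursions are multiplied by the enlarged weights.
  have eB2 : lB * ν * (x * (D (k + 1) + E (k + 1)) + y * (F (k + 1) + G (k + 1)))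
      = γ * (x * (D (k + 1) + E (k + 1)) + y * (F (k + 1) + G (k + 1))) := by rw [hB]
  have sA := mul_le_mul_of_nonneg_left (h.A_succ k) hlA
  have sB := mul_le_mul_of_nonneg_left (h.B_succ k) hlB
  have sC := mul_le_mul_of_nonneg_left (h.C_succ k) hlC
  have sD := mul_le_mul_of_nonneg_left (h.D_succ k) (by linarith : 0 ≤ lD + 4 * γ * x)
  have sE := mul_le_mul_of_nonneg_left (h.E_succ k) (by linarith : 0 ≤ lE + 4 * γ * x)
  have sF := mul_le_mul_of_nonneg_left (h.F_succ k) (by linarith : 0 ≤ lF + 4 * γ * y)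
  have sG := mul_le_mul_of_nonneg_left (h.G_succ k) (by linarith : 0 ≤ lG + 4 * γ * y)
  have sM := mul_le_mul_of_nonneg_left (h.M_le k) ha
  have tM := mul_le_mul_of_nonneg_right hM (h.M_nonneg k)
  have tD := mul_le_mul_of_nonneg_right hD (h.D_nonneg k)
  have tE := mul_le_mul_of_nonneg_right hE (h.E_nonneg k)
  have tF := mul_le_mul_of_nonneg_right hF (h.F_nonneg k)
  have tG := mul_le_mul_of_nonneg_right hG (h.G_nonneg k)
  have tr := mul_le_mul_of_nonneg_right hr (h.r_nonneg k)
  have sf := h.f_succ k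
  linarith

/-- The inequality for the weight of w − x, proved by displaying the surplus as a nonnegative
expression; the only negative term, −4ps/μ, is completed to a square. With κ = 0 it also serves for
the weight of the mean. -/
lemma weight_le {γ x κ : ℝ} (hγ : 0 ≤ γ) (hx : 0 ≤ x) (hκ : 0 ≤ κ) (hps : 0 < ps)
    (hμ : 0 < μ) (hμ1 : μ ≤ 1) :
    (γ * (x * (8 / ps + 20 * ps / μ ^ 2) + κ * (56 * ps + 21 * μ)) + 4 * γ * x) * (1 - ps)
      + (γ * (4 * x / μ + 14 * μ * κ) + 4 * γ * x) * (2 * ps ^ 2 / μ + ps)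
      + 7 * γ * κ * (μ ^ 2 * (4 * ps ^ 2 + ps))
      ≤ γ * (x * (8 / ps + 20 * ps / μ ^ 2) + κ * (56 * ps + 21 * μ)) := by
  have key : 0 ≤ γ * x * (3 + (1 - 2 * (ps / μ)) ^ 2 + 8 * (ps / μ) * (ps * (1 - μ) / μ))
      + γ * κ * (28 * ps ^ 2 * (1 - μ) * (1 + μ) + 7 * μ * ps * (1 - μ)) := by
    have := sub_nonneg.2 hμ1
    positivity
  have e : γ * (x * (8 / ps + 20 * ps / μ ^ 2) + κ * (56 * ps + 21 * μ))
      - ((γ * (x * (8 / ps + 20 * ps / μ ^ 2) + κ * (56 * ps + 21 * μ)) + 4 * γ * x) * (1 - ps)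
      + (γ * (4 * x / μ + 14 * μ * κ) + 4 * γ * x) * (2 * ps ^ 2 / μ + ps)
      + 7 * γ * κ * (μ ^ 2 * (4 * ps ^ 2 + ps)))
      = γ * x * (3 + (1 - 2 * (ps / μ)) ^ 2 + 8 * (ps / μ) * (ps * (1 - μ) / μ))
      + γ * κ * (28 * ps ^ 2 * (1 - μ) * (1 + μ) + 7 * μ * ps * (1 - μ)) := by
    field_simp
    ring
  linarith

lemma step_coeff_le {v : ℝ} (hv : 0 ≤ v) (hps : 0 < ps) (hps1 : ps ≤ 1) (hμ : 0 < μ) (hμ1 : μ ≤ 1)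
    (hν : 0 < ν) :
    (4 / μ + 4) * (2 / μ + v) + (8 / ps + 20 * ps / μ ^ 2 + 4) * v + 2 / ν ^ 2
      ≤ 708 * ((v * (ps + μ) + 1) / ν ^ 2 + (v * ps + 1) / μ ^ 2 + v / ps) := by
  have h1 : 1 ≤ 1 / μ := (one_le_div hμ).2 hμ1
  have h2 : 1 ≤ 1 / ps := (one_le_div hps).2 hps1
  -- This square yields 2/μ ≤ 1/ps + ps/μ², by which the mixed terms v/μ are absorbed.
  have h3 : 0 ≤ 1 / ps * (1 - ps * (1 / μ)) ^ 2 := by positivity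
  have h4 : 1 / ps * (1 - ps * (1 / μ)) ^ 2 = 1 / ps - 2 * (1 / μ) + ps * (1 / μ) ^ 2 := by
    field_simp
    ring
  have h5 : 0 ≤ v * (ps + μ) * (1 / ν) ^ 2 := by positivity
  have e : ∀ w : ℝ, w / μ ^ 2 = w * (1 / μ) ^ 2 := fun w => by rw [one_div, inv_pow]; rfl
  have e' : ∀ w : ℝ, w / ν ^ 2 = w * (1 / ν) ^ 2 := fun w => by rw [one_div, inv_pow]; rfl
  have e1 : ∀ w : ℝ, w / μ = w * (1 / μ) := fun w => by rw [mul_one_div]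
  have e2 : ∀ w : ℝ, w / ps = w * (1 / ps) := fun w => by rw [mul_one_div]
  rw [e, e, e', e', e1 4, e1 2, e2 8, e2 v]
  generalize 1 / μ = i at *
  generalize 1 / ps = j at *
  generalize 1 / ν = l at *
  have h6 : v * (2 * i) ≤ v * (j + ps * i ^ 2) := mul_le_mul_of_nonneg_left (by linarith) hv
  have h7 : 0 ≤ v * (ps * i ^ 2) := by positivity
  have h8 : v * 1 ≤ v * j := mul_le_mul_of_nonneg_left h2 hv
  have h9 : i ≤ i ^ 2 := by nlinarith
  nlinarith [sq_nonneg l]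

/-- The main estimate for sequences satisfying the error recursions. -/
theorem ErrorRecursion.sum_le
    (h : ErrorRecursion γ L ps p ν μ ωs ωm q x y m τ τm e f g r A B C D E F G M)
    (hγ : 0 < γ) (hps : 0 < ps) (hps1 : ps ≤ 1) (hp : 0 < p) (hν : 0 < ν) (hν1 : ν ≤ 1)
    (hμ : 0 < μ) (hμ1 : μ ≤ 1) (hωs : 0 ≤ ωs) (hωm : 0 ≤ ωm) (hq : 0 ≤ q) (hx : 0 ≤ x)
    (hy : 0 ≤ y) (hm : 0 ≤ m) (hτ : 0 ≤ τ)
    (hstep : 708 * γ * (((ωs * (ps + μ) + 1) / ν ^ 2 + (ωs * ps + 1) / μ ^ 2 + ωs / ps) * x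
      + ((ωm * (ps + μ) + 1) / ν ^ 2 + (ωm * ps + 1) / μ ^ 2 + ωm / ps) * y
      + (μ * ωs + 1 + ωs * ps) * (q * m / p)) ≤ 1 / (2 * γ) - L / 2)
    (hD0 : D 0 = 0) (hE0 : E 0 = 0) (hF0 : F 0 = 0) (hG0 : G 0 = 0) (hA0 : A 0 = 0) (K : ℕ) :
    γ / 2 * ∑ k ∈ Finset.range K, g k
      ≤ f 0 + γ / ν * B 0 + 5 * ν * q * γ / (4 * p) * C 0
        + K * (γ * e + 9 / 4 * (γ * q / p) * τ + γ / ν * τm) := by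
  set κ := q * m / p with hκ
  have hκ0 : 0 ≤ κ := by positivity
  have hν2 : ν ^ 2 ≤ 1 := pow_le_one₀ hν.le hν1
  have hμ2 : μ ^ 2 ≤ μ := by nlinarith
  -- The weights of A, B, C are forced by the three equalities. The coefficient of M is then γκ(5ν²
  -- + 5/4), rounded up to a = 7γκ; the term 14μκ in the weight of D cancels the resulting 2aμ²
  -- exactly.
  have key := h.step (lA := γ / p) (lB := γ / ν) (lC := 5 * ν * q * γ / (4 * p))
    (lD := γ * (4 * x / μ + 14 * μ * κ))
    (lE := γ * (x * (8 / ps + 20 * ps / μ ^ 2) + κ * (56 * ps + 21 * μ)))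
    (lF := γ * (4 * y / μ)) (lG := γ * (y * (8 / ps + 20 * ps / μ ^ 2))) (a := 7 * γ * κ)
    (by positivity) (by positivity) (by positivity) (by positivity) (by positivity)
    (by positivity) (by positivity) (by positivity) (by positivity) (by positivity)
    (by field_simp) (by field_simp) (by field_simp)
    (by
      have e1 : γ / p * q * (5 * ν ^ 2 * m) + 5 * ν * q * γ / (4 * p) * (1 / ν * m)
          = γ * κ * (5 * ν ^ 2 + 5 / 4) := by
        rw [hκ]
        field_simp
      rw [e1]
      have := mul_le_mul_of_nonneg_left (by linarith : 5 * ν ^ 2 + 5 / 4 ≤ 7)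
        (by positivity : 0 ≤ γ * κ)
      linarith)
    (by
      have e1 : γ * (4 * x / μ + 14 * μ * κ) - ((γ * (4 * x / μ + 14 * μ * κ) + 4 * γ * x) * (1 - μ)
          + 7 * γ * κ * (2 * μ ^ 2)) = 4 * γ * x * μ := by
        field_simp
        ring
      have : 0 ≤ 4 * γ * x * μ := by positivity
      linarith)
    (weight_le hγ.le hx hκ0 hps hμ hμ1)
    (by
      have e1 : γ * (4 * y / μ) - (γ * (4 * y / μ) + 4 * γ * y) * (1 - μ) = 4 * γ * y * μ := by
        field_simp
        ring
      have : 0 ≤ 4 * γ * y * μ := by positivity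
      linarith)
    (by simpa using weight_le hγ.le hy le_rfl hps hμ hμ1)
    (by
      refine le_trans ?_ hstep
      have c1 := mul_le_mul_of_nonneg_left (step_coeff_le hωs hps hps1 hμ hμ1 hν)
        (by positivity : 0 ≤ γ * x)
      have c2 := mul_le_mul_of_nonneg_left (step_coeff_le hωm hps hps1 hμ hμ1 hν)
        (by positivity : 0 ≤ γ * y)
      have c3 : 14 * μ * (2 / μ + ωs) + (56 * ps + 21 * μ) * ωs + 7 * (μ ^ 2 * (4 + ωs))
          ≤ 708 * (μ * ωs + 1 + ωs * ps) := by
        have e1 : 14 * μ * (2 / μ + ωs) = 28 + 14 * (μ * ωs) := by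
          field_simp
          ring
        have := mul_le_mul_of_nonneg_right hμ2 hωs
        have : 0 ≤ μ * ωs := by positivity
        have : 0 ≤ ωs * ps := by positivity
        nlinarith
      have c4 := mul_le_mul_of_nonneg_left c3 (by positivity : 0 ≤ γ * κ)
      have e1 : γ / ν * (2 / ν * (x + y)) = γ * x * (2 / ν ^ 2) + γ * y * (2 / ν ^ 2) := by
        field_simp
      rw [e1]
      have e2 : γ * (4 * x / μ + 14 * μ * κ) + 4 * γ * x
          = γ * x * (4 / μ + 4) + γ * κ * (14 * μ) := by ring
      have e3 : γ * (4 * y / μ) + 4 * γ * y = γ * y * (4 / μ + 4) := by ring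
      rw [e2, e3]
      linarith)
  have hnoise : γ * e + γ / p * q * τ + 5 * ν * q * γ / (4 * p) * τ + γ / ν * τm
      ≤ γ * e + 9 / 4 * (γ * q / p) * τ + γ / ν * τm := by
    have e1 : 5 * ν * q * γ / (4 * p) * τ = 5 / 4 * (γ * q / p * τ) * ν := by ring
    have e2 : 5 / 4 * (γ * q / p * τ) * ν ≤ 5 / 4 * (γ * q / p * τ) :=
      mul_le_of_le_one_right (by positivity) hν1
    have e3 : γ / p * q * τ = γ * q / p * τ := by ring
    rw [e1, e3]
    linarith
  have hsum : ∀ K : ℕ, (f K + γ / p * A K + γ / ν * B K + 5 * ν * q * γ / (4 * p) * C K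
        + γ * (4 * x / μ + 14 * μ * κ) * D K
        + γ * (x * (8 / ps + 20 * ps / μ ^ 2) + κ * (56 * ps + 21 * μ)) * E K
        + γ * (4 * y / μ) * F K + γ * (y * (8 / ps + 20 * ps / μ ^ 2)) * G K)
        + γ / 2 * ∑ k ∈ Finset.range K, g k
      ≤ f 0 + γ / ν * B 0 + 5 * ν * q * γ / (4 * p) * C 0
        + K * (γ * e + 9 / 4 * (γ * q / p) * τ + γ / ν * τm) := by
    intro K
    induction K with
    | zero => simp [hD0, hE0, hF0, hG0, hA0]
    | succ K ih =>
      rw [Finset.sum_range_succ]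
      push_cast
      linarith [key K]
  refine le_trans (le_add_of_nonneg_left ?_) (hsum K)
  have := h.f_nonneg K
  have := h.A_nonneg K
  have := h.B_nonneg K
  have := h.C_nonneg K
  have := h.D_nonneg K
  have := h.E_nonneg K
  have := h.F_nonneg K
  have := h.G_nonneg K
  positivity

/-- The initial error `C 0` can be removed at the price of a uniformly small additional error of
the gradient. -/
lemma ErrorRecursion.remove_initial
    (h : ErrorRecursion γ L ps p ν μ ωs ωm q x y m τ τm 0 f g r A B C D E F G M)
    (hγ : 0 < γ) (hp : 0 ≤ p) (hp1 : p ≤ 1) (hν : 0 < ν) (hν1 : ν ≤ 1)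
    (hq : 0 ≤ q) (hm : 0 ≤ m) (hτ : 0 ≤ τ) :
    ErrorRecursion γ L ps p ν μ ωs ωm q x y m τ τm (5 / 4 * q * ν * C 0) f g r
      (fun k => max (A k - 5 / 4 * q * ν * C 0 * (1 - (1 - ν) ^ k)) 0) B
      (fun k => max (C k - (1 - ν) ^ k * C 0) 0) D E F G M := by
  have hC0 := h.C_nonneg 0
  have h1ν := sub_nonneg.2 hν1
  have hpow : ∀ k, (1 - ν) ^ k ≤ 1 := fun k => pow_le_one₀ h1ν (by linarith)
  have hpow0 : ∀ k, 0 ≤ (1 - ν) ^ k := fun k => by positivity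
  have ha : 0 ≤ 5 / 4 * q * ν * C 0 := by positivity
  refine { h with
    A_nonneg := fun k => le_max_right _ _
    C_nonneg := fun k => le_max_right _ _
    f_succ := fun k => ?_
    A_succ := fun k => ?_
    C_succ := fun k => ?_ }
  · have h1 := h.f_succ k
    have h2 : A k ≤ max (A k - 5 / 4 * q * ν * C 0 * (1 - (1 - ν) ^ k)) 0
        + 5 / 4 * q * ν * C 0 := by
      have h3 := le_max_left (A k - 5 / 4 * q * ν * C 0 * (1 - (1 - ν) ^ k)) 0
      have h4 : 5 / 4 * q * ν * C 0 * (1 - (1 - ν) ^ k) ≤ 5 / 4 * q * ν * C 0 :=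
        -- The subtracted part never exceeds (5/4)qνC₀, which therefore becomes the persistent
        -- gradient error.
        mul_le_of_le_one_right ha (by linarith [hpow0 k])
      linarith
    have h3 := mul_le_mul_of_nonneg_left h2 hγ.le
    linarith
  · have hM := h.M_nonneg k
    have hC := le_max_left (C k - (1 - ν) ^ k * C 0) 0
    have hC' := le_max_right (C k - (1 - ν) ^ k * C 0) 0
    have hA := le_max_left (A k - 5 / 4 * q * ν * C 0 * (1 - (1 - ν) ^ k)) 0
    have hA' := le_max_right (A k - 5 / 4 * q * ν * C 0 * (1 - (1 - ν) ^ k)) 0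
    set c := max (C k - (1 - ν) ^ k * C 0) 0
    set w := max (A k - 5 / 4 * q * ν * C 0 * (1 - (1 - ν) ^ k)) 0
    have h1p := sub_nonneg.2 hp1
    refine max_le ?_ (by positivity)
    have h1 := h.A_succ k
    have h2 := mul_le_mul_of_nonneg_left hA h1p
    -- The part of C coming from C₀ adds (5/4)qν²(1 − ν)^k C₀ to A, exactly the increment of the
    -- subtracted sequence. The contraction by p is not used on this part, so no factor 1/p appears.
    have h3 : 0 ≤ p * (5 / 4 * q * ν * C 0 * (1 - (1 - ν) ^ k)) :=
      mul_nonneg hp (mul_nonneg ha (by linarith [hpow k]))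
    have h4 := mul_le_mul_of_nonneg_left hC (by positivity : 0 ≤ q * (5 / 4 * ν ^ 2))
    rw [pow_succ]
    linarith
  · have hM := h.M_nonneg k
    have hC := le_max_left (C k - (1 - ν) ^ k * C 0) 0
    have hC' := le_max_right (C k - (1 - ν) ^ k * C 0) 0
    set c := max (C k - (1 - ν) ^ k * C 0) 0
    refine max_le ?_ (by positivity)
    have h1 := h.C_succ k
    have h2 := mul_le_mul_of_nonneg_left hC h1ν
    rw [pow_succ]
    linarith

end Sequences

/-! ### The recursions of the method and the bound by the initial Lyapunov value. -/

section Method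

variable {Ω Ξ Θ : Type*} {n d b : ℕ} [MeasurableSpace Ξ] [MeasurableSpace Θ]
  [mΩ : MeasurableSpace Ω] {N : Noise Ω Ξ Θ n d b} {P : Measure Ω} [IsProbabilityMeasure P]
  {D : Fin n → Measure Ξ} {ps p ωs ω : ℝ}
  {F : Fin n → Vec d → ℝ} {L : ℝ} {Li : Fin n → ℝ} {LA LB fstar σ : ℝ}
  {G : Fin n → Vec d → Ξ → Vec d} {x0 : Vec d} {γ μ ν ε : ℝ}

local notation "S" => iterate N G x0 γ μ ν

lemma errorRecursion (hn : 1 ≤ n) (hb : 1 ≤ b) (hA : Assumptions F L Li LA LB fstar σ D G)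
    (hN : N.Valid P D ps p ωs ω) (hγ : 0 < γ) (hps : 0 ≤ ps) (hps1 : ps ≤ 1) (hp : 0 ≤ p)
    (hp1 : p ≤ 1) (hν : 0 < ν) (hν1 : ν ≤ 1) (hμ : 0 < μ) (hμ1 : μ ≤ 1) (hωs : 0 ≤ ωs)
    (hω : 0 ≤ ω) {L' : ℝ} (hL : IsSmooth (objective F) L') :
    ErrorRecursion γ L' ps p ν μ ωs (ωs / n) (ω / n) (LA ^ 2) (LB ^ 2) (Lmax Li LA LB ^ 2)
      (ν ^ 2 * σ ^ 2 / b) (ν ^ 2 * σ ^ 2 / (n * b)) 0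
      (fun k => ∫ z, (objective F (S k z).x - fstar) ∂P)
      (fun k => ∫ z, ‖gradient (objective F) (S k z).x‖ ^ 2 ∂P)
      (fun k => xStep P (S k) (S (k + 1))) (fun k => gErr P (S k)) (fun k => vMeanErr F P (S k))
      (fun k => vErr F P (S k)) (fun k => wxwErr P (S k)) (fun k => wxErr P (S k))
      (fun k => wxwMeanErr P (S k)) (fun k => wxMeanErr P (S k))
      (fun k => xwStep P (S k) (S (k + 1))) := by
  have h : ∀ k, IsAdapted N P (S k) (5 * k) := isAdapted hA hN
  have hC : ∀ k, 0 ≤ vErr F P (S k) := fun k => avg_nonneg fun i => integral_sq_nonneg P _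
  have hM : ∀ k, 0 ≤ xwStep P (S k) (S (k + 1)) := fun k =>
    avg_nonneg fun i => integral_sq_nonneg P _
  exact
  { f_nonneg := fun k => integral_nonneg fun z => sub_nonneg.2 (hA.lower_bound _)
    r_nonneg := fun k => xStep_nonneg _ _
    A_nonneg := fun k => integral_sq_nonneg P _
    B_nonneg := fun k => integral_sq_nonneg P _
    C_nonneg := hC
    D_nonneg := fun k => avg_nonneg fun i => integral_sq_nonneg P _
    E_nonneg := fun k => avg_nonneg fun i => integral_sq_nonneg P _
    F_nonneg := fun k => integral_sq_nonneg P _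
    G_nonneg := fun k => integral_sq_nonneg P _
    M_nonneg := hM
    f_succ := fun k => by
      rw [mul_zero, add_zero]
      exact objective_succ_le hA hL hγ (h k)
    A_succ := fun k => by
      have h1 := gErr_succ_le hA hN hp hp1 (h k)
      have h2 := vStep_le hb hn hA hN (h k)
      have h3 : 0 ≤ ω / n * vStep P (S k) (S (k + 1)) :=
        mul_nonneg (by positivity) (avg_nonneg fun i => integral_sq_nonneg P _)
      have h4 := mul_le_mul_of_nonneg_left h2 (by positivity : 0 ≤ ω / n)
      have h5 := mul_nonneg hp h3
      linarith
    B_succ := fun k => by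
      have h1 := vMeanErr_succ_le hb hn hA hN hν hν1 (h k)
      have h2 := heteroErr_le hn hA (h (k + 1))
      have h3 := mul_le_mul_of_nonneg_left h2 (by positivity : 0 ≤ 2 * ν)
      linarith
    C_succ := fun k => vErr_succ_le hb hn hA hN hν hν1 (h k)
    D_succ := fun k => wxwErr_succ_le hn hN hps hps1 hωs hμ hμ1 (h k)
    E_succ := fun k => wxErr_succ_le hn hN hps hps1 hωs (h k)
    F_succ := fun k => wxwMeanErr_succ_le hn hN hps hps1 hωs hμ hμ1 (h k)
    G_succ := fun k => wxMeanErr_succ_le hn hN hps hps1 hωs (h k)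
    M_le := fun k => xwStep_le hn hN hps hps1 hωs (h k) }

lemma gErr_zero : gErr P (S 0) = 0 := by
  simp [gErr, iterate, State.initial]

lemma wxwErr_zero : wxwErr P (S 0) = 0 := by
  simp [wxwErr, iterate, State.initial, avg]

lemma wxErr_zero : wxErr P (S 0) = 0 := by
  simp [wxErr, iterate, State.initial, avg]

lemma wxwMeanErr_zero : wxwMeanErr P (S 0) = 0 := by
  simp [wxwMeanErr, iterate, State.initial]

lemma wxMeanErr_zero (hn : 1 ≤ n) : wxMeanErr P (S 0) = 0 := by
  simp [wxMeanErr, iterate, State.initial, avg_const hn]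

lemma generalRate_eq (hn : 1 ≤ n) (hp : 0 < p) (M : ℝ) :
    generalRate n LA LB M ps p ν μ ωs ω
      = ((ωs * (ps + μ) + 1) / ν ^ 2 + (ωs * ps + 1) / μ ^ 2 + ωs / ps) * LA ^ 2
      + ((ωs / n * (ps + μ) + 1) / ν ^ 2 + (ωs / n * ps + 1) / μ ^ 2 + ωs / n / ps) * LB ^ 2
      + (μ * ωs + 1 + ωs * ps) * (ω / n * M ^ 2 / p) := by
  have hn' : (n : ℝ) ≠ 0 := by positivity
  unfold generalRate
  rw [div_div]
  congr 1
  field_simp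
  ring

lemma generalRate_nonneg (hps : 0 < ps) (hp : 0 < p) (hμ : 0 < μ) (hωs : 0 ≤ ωs) (hω : 0 ≤ ω)
    (M : ℝ) : 0 ≤ generalRate n LA LB M ps p ν μ ωs ω := by
  unfold generalRate
  positivity

/-- The step size condition in the form in which it is used. -/
lemma step_size_condition {Q : ℝ} (hL : 0 ≤ L) (hγ : 0 < γ) (hQ : 0 ≤ Q)
    (h : γ * (L + √(1416 * Q)) ≤ 1) : 708 * γ * Q ≤ 1 / (2 * γ) - L / 2 := by
  have h1 : √(1416 * Q) ^ 2 = 1416 * Q := Real.sq_sqrt (by positivity)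
  have h2 : 0 ≤ γ * √(1416 * Q) := by positivity
  have h3 : 0 ≤ γ * L := by positivity
  -- The square root term is at most 1, hence dominates its square.
  have h4 : γ * L + (γ * √(1416 * Q)) ^ 2 ≤ 1 := by nlinarith
  rw [mul_pow, h1] at h4
  have h5 : 1 / (2 * γ) - L / 2 - 708 * γ * Q = (1 - γ * L - γ ^ 2 * (1416 * Q)) / (2 * γ) := by
    field_simp
    ring
  have h6 : 0 ≤ (1 - γ * L - γ ^ 2 * (1416 * Q)) / (2 * γ) :=
    div_nonneg (by linarith) (by positivity)
  linarith

/-- The sum of the squared gradient norms, in terms of the initial errors of the estimators. -/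
lemma sum_gradient_le (hn : 1 ≤ n) (hb : 1 ≤ b) (hA : Assumptions F L Li LA LB fstar σ D G)
    (hN : N.Valid P D ps p ωs ω) (hγ : 0 < γ) (hps : 0 < ps) (hps1 : ps ≤ 1) (hp : 0 < p)
    (hp1 : p ≤ 1) (hν : 0 < ν) (hν1 : ν ≤ 1) (hμ : 0 < μ) (hμ1 : μ ≤ 1) (hωs : 0 ≤ ωs)
    (hω : 0 ≤ ω) {L' : ℝ} (hL : IsSmooth (objective F) L')
    (hstep : γ * (L' + √(1416 * generalRate n LA LB (Lmax Li LA LB) ps p ν μ ωs ω)) ≤ 1)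
    (K : ℕ) :
    (γ / 2 * ∑ k ∈ Finset.range K, ∫ z, ‖gradient (objective F) (S k z).x‖ ^ 2 ∂P
      ≤ objective F x0 - fstar + γ / ν * vMeanErr F P (S 0)
        + 5 * ν * (ω / n) * γ / (4 * p) * vErr F P (S 0)
        + K * (9 / 4 * (γ * (ω / n) / p) * (ν ^ 2 * σ ^ 2 / b)
          + γ / ν * (ν ^ 2 * σ ^ 2 / (n * b)))) ∧
    γ / 2 * ∑ k ∈ Finset.range K, ∫ z, ‖gradient (objective F) (S k z).x‖ ^ 2 ∂P
      ≤ objective F x0 - fstar + γ / ν * vMeanErr F P (S 0)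
        + K * (γ * (5 / 4 * (ω / n) * ν * vErr F P (S 0))
          + 9 / 4 * (γ * (ω / n) / p) * (ν ^ 2 * σ ^ 2 / b)
          + γ / ν * (ν ^ 2 * σ ^ 2 / (n * b))) := by
  have hrec := errorRecursion (x0 := x0) hn hb hA hN hγ hps.le hps1 hp.le hp1 hν hν1 hμ hμ1 hωs hω
    hL
  have hstep' := step_size_condition hL.1 hγ (generalRate_nonneg hps hp hμ hωs hω _) hstep
  rw [generalRate_eq hn hp] at hstep'
  have hf0 : ∫ z, (objective F (S 0 z).x - fstar) ∂P = objective F x0 - fstar := by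
    simp [iterate, State.initial]
  have hq : 0 ≤ ω / n := by positivity
  constructor
  · have h1 := hrec.sum_le hγ hps hps1 hp hν hν1 hμ hμ1 hωs (by positivity) hq
      (sq_nonneg _) (sq_nonneg _) (sq_nonneg _) (by positivity) hstep' wxwErr_zero
      wxErr_zero wxwMeanErr_zero (wxMeanErr_zero hn) gErr_zero K
    rw [hf0, mul_zero, zero_add] at h1
    exact h1
  · have h1 := (hrec.remove_initial hγ hp.le hp1 hν hν1 hq (sq_nonneg _) (by positivity)).sum_le
      hγ hps hps1 hp hν hν1 hμ hμ1 hωs (by positivity) hq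
      (sq_nonneg _) (sq_nonneg _) (sq_nonneg _) (by positivity) hstep' wxwErr_zero
      wxErr_zero wxwMeanErr_zero (wxMeanErr_zero hn) (by simp [gErr_zero]) K
    simp only [hf0, pow_zero, one_mul, sub_self, max_self, mul_zero, add_zero] at h1
    exact h1

/-- Initially all copies coincide with x⁰ and g⁰ is the mean of the vᵢ⁰, so the other terms vanish
and the mean of ∇fᵢ(xᵢ⁰) is ∇f(x⁰). -/
lemma lyapunov_initial (hn : 1 ≤ n) (hA : Assumptions F L Li LA LB fstar σ D G) (LM : ℝ) (z : Ω) :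
    lyapunov F fstar LA LB LM γ ps p ν μ ω (S 0 z)
      = objective F x0 - fstar
        + lamB γ ν * ‖avg (S 0 z).v - gradient (objective F) (S 0 z).x‖ ^ 2
        + lamC n γ p ν ω * avg fun i => ‖(S 0 z).v i - gradient (F i) ((S 0 z).xw i)‖ ^ 2 := by
  simp only [lyapunov, iterate, State.initial, sub_self, norm_zero, avg_const hn,
    hA.gradient_objective]
  ring

lemma integral_lyapunov_initial (hn : 1 ≤ n) (hA : Assumptions F L Li LA LB fstar σ D G)
    (hN : N.Valid P D ps p ωs ω) (LM : ℝ) :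
    Integrable (fun z => lyapunov F fstar LA LB LM γ ps p ν μ ω (S 0 z)) P ∧
    ∫ z, lyapunov F fstar LA LB LM γ ps p ν μ ω (S 0 z) ∂P
      = objective F x0 - fstar + lamB γ ν * vMeanErr F P (S 0)
        + lamC n γ p ν ω * vErr F P (S 0) := by
  have h := isAdapted (x0 := x0) (γ := γ) (μ := μ) (ν := ν) hA hN 0
  have hv : N.IsL2 P (5 * 0) fun z => avg (S 0 z).v := .avg h.v
  have i0 : Integrable (fun _ : Ω => objective F x0 - fstar) P := integrable_const _
  have i1 := (hv.sub (h.x.grad hA.smooth)).sq.const_mul (lamB γ ν)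
  have hi : ∀ i, Integrable
      (fun z => ‖(S 0 z).v i - gradient (F i) ((S 0 z).xw i)‖ ^ 2) P := fun i =>
    ((h.v i).sub ((h.xw i).grad (hA.smooth_worker i))).sq
  have i2 := (integrable_avg hi).const_mul (lamC n γ p ν ω)
  simp_rw [lyapunov_initial hn hA]
  have i01 : Integrable (fun z => objective F x0 - fstar
      + lamB γ ν * ‖avg (S 0 z).v - gradient (objective F) (S 0 z).x‖ ^ 2) P := i0.add i1
  refine ⟨i01.add i2, ?_⟩
  rw [integral_add i01 i2, integral_add i0 i1, integral_const_mul, integral_const_mul,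
    integral_avg hi]
  simp [vMeanErr, vErr]

lemma average_le_of_sum_le {γ s R T ε : ℝ} {K : ℕ} (hγ : 0 < γ) (hK : 1 ≤ K)
    (h : γ / 2 * s ≤ R + K * (γ * T)) (hT : 2 * T ≤ ε) :
    1 / (K : ℝ) * s ≤ 2 * R / (γ * K) + ε := by
  have hK' : (0 : ℝ) < K := by positivity
  have h1 : 1 / (K : ℝ) * s = 2 / (γ * K) * (γ / 2 * s) := by field_simp
  have h2 := mul_le_mul_of_nonneg_left h (by positivity : 0 ≤ 2 / (γ * K))
  have h3 : 2 / (γ * K) * (R + K * (γ * T)) = 2 * R / (γ * K) + 2 * T := by field_simp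
  linarith

/-- The average of the squared gradient norms is controlled by the initial Lyapunov value. -/
lemma averageBound (hn : 1 ≤ n) (hb : 1 ≤ b) (hA : Assumptions F L Li LA LB fstar σ D G)
    (hN : N.Valid P D ps p ωs ω) (hγ : 0 < γ) (hps : 0 < ps) (hps1 : ps ≤ 1) (hp : 0 < p)
    (hp1 : p ≤ 1) (hν : 0 < ν) (hν1 : ν ≤ 1) (hμ : 0 < μ) (hμ1 : μ ≤ 1) (hωs : 0 ≤ ωs)
    (hω : 0 ≤ ω) {L' : ℝ} (hL : IsSmooth (objective F) L')
    (hstep : γ * (L' + √(1416 * generalRate n LA LB (Lmax Li LA LB) ps p ν μ ωs ω)) ≤ 1)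
    (hnoise : 9 / 2 * (ν ^ 2 * ω * σ ^ 2 / (n * p * b)) + 2 * (ν * σ ^ 2 / (n * b)) ≤ ε / 2) :
    AverageBound P (objective F) S
      (lyapunov F fstar LA LB (Lmax Li LA LB) γ ps p ν μ ω) γ ε := by
  have hΨ := integral_lyapunov_initial (x0 := x0) (γ := γ) (ν := ν) (μ := μ) hn hA hN
    (Lmax Li LA LB)
  have hn' : (0 : ℝ) < n := by positivity
  have hb' : (0 : ℝ) < b := by positivity
  refine ⟨hΨ.1, fun k => ((isAdapted hA hN k).x.grad hA.smooth).sq, fun K hK => ?_⟩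
  have h1 := (sum_gradient_le (x0 := x0) hn hb hA hN hγ hps hps1 hp hp1 hν hν1 hμ hμ1 hωs hω hL
    hstep K).1
  refine average_le_of_sum_le (T := 9 / 4 * ((ω / n) / p) * (ν ^ 2 * σ ^ 2 / b)
          + 1 / ν * (ν ^ 2 * σ ^ 2 / (n * b))) hγ hK ?_ ?_
  · rw [hΨ.2]
    refine h1.trans ?_
    have hB : 0 ≤ vMeanErr F P (S 0) := integral_sq_nonneg P _
    have hC : 0 ≤ vErr F P (S 0) := avg_nonneg fun i => integral_sq_nonneg P _
    -- The weights used in the proof are smaller than λ_B and λ_C, by the factors 2/3 and 5/12.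
    have e1 : γ / ν * vMeanErr F P (S 0) ≤ lamB γ ν * vMeanErr F P (S 0) := by
      refine mul_le_mul_of_nonneg_right ?_ hB
      have : lamB γ ν = 3 / 2 * (γ / ν) := by unfold lamB; field_simp
      rw [this]
      have : 0 ≤ γ / ν := by positivity
      linarith
    have e2 : 5 * ν * (ω / n) * γ / (4 * p) * vErr F P (S 0)
        ≤ lamC n γ p ν ω * vErr F P (S 0) := by
      refine mul_le_mul_of_nonneg_right ?_ hC
      have e3 : 5 * ν * (ω / n) * γ / (4 * p) = 5 / 4 * (ν * ω * γ / (n * p)) := by field_simp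
      have e4 : lamC n γ p ν ω = 3 * (ν * ω * γ / (n * p)) := by unfold lamC; ring
      rw [e3, e4]
      have : 0 ≤ ν * ω * γ / (n * p) := by positivity
      linarith
    have e5 : (K : ℝ) * (9 / 4 * (γ * (ω / n) / p) * (ν ^ 2 * σ ^ 2 / b)
          + γ / ν * (ν ^ 2 * σ ^ 2 / (n * b)))
        = K * (γ * (9 / 4 * ((ω / n) / p) * (ν ^ 2 * σ ^ 2 / b)
          + 1 / ν * (ν ^ 2 * σ ^ 2 / (n * b)))) := by ring
    linarith
  · refine le_trans (le_of_eq ?_) hnoise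
    field_simp
    ring

end Method

/-! ### The choice of η and the comparison of step sizes. -/

section Parameters

variable {n b : ℕ} {ε σ ωs ω : ℝ}

lemma eta_pos : 0 < eta n b ε σ ωs ω :=
  one_div_pos.2 (lt_of_lt_of_le one_pos (le_max_of_le_right (le_max_right _ _)))

/-- Since η is the reciprocal of a maximum, every entry of the maximum gives one inequality, without
case distinction for vanishing denominators. -/
lemma eta_mul_le {x : ℝ}
    (hx : x ≤ max (max (6 * √(ω * (ω + 1) * σ ^ 2 / (b * n * ε))) (6 * σ ^ 2 / (b * n * ε)))
      (max ((ω * (ω + 1) * ωs / n) ^ ((1 : ℝ) / 3)) 1)) :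
    eta n b ε σ ωs ω * x ≤ 1 := by
  have h := mul_le_mul_of_nonneg_left hx (eta_pos (n := n) (b := b) (ε := ε) (σ := σ) (ωs := ωs)
    (ω := ω)).le
  refine h.trans (le_of_eq ?_)
  exact one_div_mul_cancel
    (lt_of_lt_of_le one_pos (le_max_of_le_right (le_max_right _ _))).ne'

lemma eta_le_one : eta n b ε σ ωs ω ≤ 1 := by
  simpa using eta_mul_le (n := n) (b := b) (ε := ε) (σ := σ) (ωs := ωs) (ω := ω)
    (le_max_of_le_right (le_max_right _ _))

lemma eta_sq_mul_le (hn : 1 ≤ n) (hb : 1 ≤ b) (hε : 0 < ε) (hω : 0 ≤ ω) :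
    eta n b ε σ ωs ω ^ 2 * (ω * (ω + 1)) * σ ^ 2 / (n * b) ≤ ε / 36 := by
  have h := eta_mul_le (n := n) (b := b) (ε := ε) (σ := σ) (ωs := ωs) (ω := ω)
    (le_max_of_le_left (le_max_left _ _))
  have h0 := eta_pos (n := n) (b := b) (ε := ε) (σ := σ) (ωs := ωs) (ω := ω)
  generalize eta n b ε σ ωs ω = η at *
  have hn' : (0 : ℝ) < n := by positivity
  have hb' : (0 : ℝ) < b := by positivity
  have h1 : (η * (6 * √(ω * (ω + 1) * σ ^ 2 / (b * n * ε)))) ^ 2 ≤ 1 :=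
    pow_le_one₀ (by positivity) h
  rw [mul_pow, mul_pow, Real.sq_sqrt (by positivity)] at h1
  have h2 : η ^ 2 * (ω * (ω + 1)) * σ ^ 2 / (n * b)
      = η ^ 2 * (6 ^ 2 * (ω * (ω + 1) * σ ^ 2 / (b * n * ε))) * (ε / 36) := by
    field_simp
    norm_num
  rw [h2]
  exact mul_le_of_le_one_left (by positivity) h1

lemma eta_mul_sq_le (hn : 1 ≤ n) (hb : 1 ≤ b) (hε : 0 < ε) :
    eta n b ε σ ωs ω * σ ^ 2 / (n * b) ≤ ε / 6 := by
  have h := eta_mul_le (n := n) (b := b) (ε := ε) (σ := σ) (ωs := ωs) (ω := ω)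
    (le_max_of_le_left (le_max_right _ _))
  generalize eta n b ε σ ωs ω = η at *
  have hn' : (0 : ℝ) < n := by positivity
  have hb' : (0 : ℝ) < b := by positivity
  have h2 : η * σ ^ 2 / (n * b) = η * (6 * σ ^ 2 / (b * n * ε)) * (ε / 6) := by
    field_simp
  rw [h2]
  exact mul_le_of_le_one_left (by positivity) h

lemma eta_cube_mul_le (hωs : 0 ≤ ωs) (hω : 0 ≤ ω) :
    eta n b ε σ ωs ω ^ 3 * (ω * (ω + 1) * ωs / n) ≤ 1 := by
  have h := eta_mul_le (n := n) (b := b) (ε := ε) (σ := σ) (ωs := ωs) (ω := ω)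
    (le_max_of_le_right (le_max_left _ _))
  have h0 := eta_pos (n := n) (b := b) (ε := ε) (σ := σ) (ωs := ωs) (ω := ω)
  generalize eta n b ε σ ωs ω = η at *
  have hx : 0 ≤ ω * (ω + 1) * ωs / n := by positivity
  have h1 : ((ω * (ω + 1) * ωs / n) ^ ((1 : ℝ) / 3)) ^ 3 = ω * (ω + 1) * ωs / n := by
    rw [← Real.rpow_natCast, ← Real.rpow_mul hx]
    norm_num
  rw [← h1, ← mul_pow]
  exact pow_le_one₀ (by positivity) h

lemma one_div_eta_le (hωs : 0 ≤ ωs) (hω : 0 ≤ ω) :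
    1 / eta n b ε σ ωs ω ≤ 6 * rateMax n b ε σ ωs ω := by
  rw [eta, one_div_one_div, rateMax]
  have hx : 0 ≤ (ω * (ω + 1) * ωs / n) ^ ((1 : ℝ) / 3) := by positivity
  set X := √(ω * (ω + 1) * σ ^ 2 / (b * n * ε))
  set Y := σ ^ 2 / (b * n * ε) with hY
  set Z := (ω * (ω + 1) * ωs / n) ^ ((1 : ℝ) / 3)
  have h1 : X ≤ max (max X Y) (max Z 1) := le_max_of_le_left (le_max_left _ _)
  have h2 : Y ≤ max (max X Y) (max Z 1) := le_max_of_le_left (le_max_right _ _)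
  have h3 : Z ≤ max (max X Y) (max Z 1) := le_max_of_le_right (le_max_left _ _)
  have h4 : 1 ≤ max (max X Y) (max Z 1) := le_max_of_le_right (le_max_right _ _)
  rw [mul_div_assoc, ← hY]
  refine max_le (max_le ?_ ?_) (max_le ?_ ?_) <;> linarith

/-- The terms v·ps are at most 1, and the cross term v/η is at most (v² + 1/η²)/2 with v² ≤ v(ωs +
1). Taking v = ωs and v = ωs/n serves both similarity constants. -/
lemma equal_coeff_le {η v : ℝ} (hη : 0 < η) (hv : 0 ≤ v) (hvω : v ≤ ωs) :
    (v * (1 / (ωs + 1) + η) + 1) / η ^ 2 + (v * (1 / (ωs + 1)) + 1) / η ^ 2 + v / (1 / (ωs + 1))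
      ≤ 9 / 2 * (1 / η ^ 2) + 3 / 2 * (v * (ωs + 1)) := by
  have hωs : 0 ≤ ωs := hv.trans hvω
  have h1 : v * (1 / (ωs + 1)) ≤ 1 := by
    rw [mul_one_div, div_le_one (by positivity)]
    linarith
  have h2 : 0 ≤ 1 / 2 * (v - 1 / η) ^ 2 := by positivity
  have h3 : v ^ 2 ≤ v * (ωs + 1) := by nlinarith
  have h4 := mul_le_mul_of_nonneg_right h1 (by positivity : 0 ≤ 1 / η ^ 2)
  have e : (v * (1 / (ωs + 1) + η) + 1) / η ^ 2 + (v * (1 / (ωs + 1)) + 1) / η ^ 2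
      + v / (1 / (ωs + 1)) = 2 * (v * (1 / (ωs + 1)) * (1 / η ^ 2)) + 2 * (1 / η ^ 2)
        + v * (1 / η) + v * (ωs + 1) := by
    field_simp
    ring
  have e2 : (1 / η) ^ 2 = 1 / η ^ 2 := by rw [one_div_pow]
  rw [e]
  nlinarith

/-- The cube-root entry of η bounds ηω(ω + 1)ωs/n by 1/η². The terms with 1/η² then add up to 9/2 +
9/2 + 1 = 10. -/
lemma generalRate_le_equalRate (hn : 1 ≤ n) {LA LB LM η : ℝ} (hη : 0 < η) (hωs : 0 ≤ ωs)
    (hω : 0 ≤ ω) (hA : 0 ≤ LA) (hB : 0 ≤ LB) (hAM : LA ≤ LM) (hBM : LB ≤ LM)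
    (hη3 : η ^ 3 * (ω * (ω + 1) * ωs / n) ≤ 1) :
    generalRate n LA LB LM (1 / (ωs + 1)) (1 / (ω + 1)) η η ωs ω
      ≤ 10 * equalRate n LA LB LM ωs ω η := by
  have hn' : (1 : ℝ) ≤ n := by exact_mod_cast hn
  rw [generalRate_eq hn (by positivity), equalRate]
  have h1 := mul_le_mul_of_nonneg_right (equal_coeff_le hη hωs le_rfl) (sq_nonneg LA)
  have h2 := mul_le_mul_of_nonneg_right (equal_coeff_le hη (by positivity : 0 ≤ ωs / n)
    (div_le_self hωs hn')) (sq_nonneg LB)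
  have h3 : (η * ωs + 1 + ωs * (1 / (ωs + 1))) * (ω / n * LM ^ 2 / (1 / (ω + 1)))
      ≤ (1 / η ^ 2 + 2 * (ω * (ω + 1) / n)) * LM ^ 2 := by
    have e : (η * ωs + 1 + ωs * (1 / (ωs + 1))) * (ω / n * LM ^ 2 / (1 / (ω + 1)))
        = (η ^ 3 * (ω * (ω + 1) * ωs / n) * (1 / η ^ 2)
          + (1 + ωs * (1 / (ωs + 1))) * (ω * (ω + 1) / n)) * LM ^ 2 := by
      field_simp
      ring
    rw [e]
    have h4 : ωs * (1 / (ωs + 1)) ≤ 1 := by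
      rw [mul_one_div, div_le_one (by positivity)]
      linarith
    refine mul_le_mul_of_nonneg_right (add_le_add ?_ ?_) (sq_nonneg _)
    · exact mul_le_of_le_one_left (by positivity) hη3
    · exact mul_le_mul_of_nonneg_right (by linarith) (by positivity)
  have hA2 : 1 / η ^ 2 * LA ^ 2 ≤ 1 / η ^ 2 * LM ^ 2 := by gcongr
  have hB2 : 1 / η ^ 2 * LB ^ 2 ≤ 1 / η ^ 2 * LM ^ 2 := by gcongr
  have p1 : 0 ≤ ωs * (ωs + 1) * LA ^ 2 := by positivity
  have p2 : 0 ≤ ωs / n * (ωs + 1) * LB ^ 2 := by positivity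
  have p3 : 0 ≤ ω * (ω + 1) / n * LM ^ 2 := by positivity
  linarith

lemma equal_step_size (hn : 1 ≤ n) {LA LB LM η γ : ℝ} (hγ : 0 < γ) (hη : 0 < η) (hη1 : η ≤ 1)
    (hωs : 0 ≤ ωs) (hω : 0 ≤ ω) (hA : 0 ≤ LA) (hB : 0 ≤ LB) (hAM : LA ≤ LM) (hBM : LB ≤ LM)
    (hη3 : η ^ 3 * (ω * (ω + 1) * ωs / n) ≤ 1)
    (h : γ * (6 * √(1416 * equalRate n LA LB LM ωs ω η)) ≤ 1) :
    γ * (LM + √(1416 * generalRate n LA LB LM (1 / (ωs + 1)) (1 / (ω + 1)) η η ωs ω)) ≤ 1 := by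
  have hQ : LM ^ 2 ≤ equalRate n LA LB LM ωs ω η := by
    unfold equalRate
    have h1 : 1 ≤ 1 / η ^ 2 := by
      rw [le_div_iff₀ (by positivity), one_mul]
      exact pow_le_one₀ hη.le hη1
    have h2 := mul_le_mul_of_nonneg_right h1 (sq_nonneg LM)
    have p1 : 0 ≤ ωs * (ωs + 1) * LA ^ 2 := by positivity
    have p2 : 0 ≤ ωs / n * (ωs + 1) * LB ^ 2 := by positivity
    have p3 : 0 ≤ ω * (ω + 1) / n * LM ^ 2 := by positivity
    linarith
  have hQg := generalRate_le_equalRate hn hη hωs hω hA hB hAM hBM hη3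
  set Q := equalRate n LA LB LM ωs ω η
  -- As η ≤ 1, the rate dominates L_max². With √10 ≤ 4 below, the total is at most five square
  -- roots, within the six allowed.
  have h1 : LM ≤ √(1416 * Q) := Real.le_sqrt_of_sq_le (by nlinarith [sq_nonneg LM])
  have h2 : √(1416 * generalRate n LA LB LM (1 / (ωs + 1)) (1 / (ω + 1)) η η ωs ω)
      ≤ 4 * √(1416 * Q) := by
    refine Real.sqrt_le_iff.2 ⟨by positivity, ?_⟩
    rw [mul_pow, Real.sq_sqrt (by nlinarith [sq_nonneg LM])]
    nlinarith [sq_nonneg LM]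
  refine le_trans (mul_le_mul_of_nonneg_left ?_ hγ.le) h
  have := Real.sqrt_nonneg (1416 * Q)
  linarith

end Parameters

/-! ### From averages to a uniformly drawn iterate. -/

section Stationary

variable {Ω : Type*} [MeasurableSpace Ω] {P : Measure Ω} [IsProbabilityMeasure P] {n d : ℕ}

lemma findsStationary_of_average_le {f : Vec d → ℝ} (hf : Continuous (gradient f))
    {S : ℕ → Ω → State n d} {T : ℕ} {ε : ℝ} (hm : ∀ k, Measurable fun z => (S k z).x)
    (hi : ∀ k, Integrable (fun z => ‖gradient f (S k z).x‖ ^ 2) P)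
    (h : 1 / ((T + 1 : ℕ) : ℝ) * ∑ k ∈ Finset.range (T + 1), ∫ z, ‖gradient f (S k z).x‖ ^ 2 ∂P
      ≤ ε) :
    FindsStationary P f S T ε := by
  have hmeas : Measurable fun z : Fin (T + 1) × Ω => ‖gradient f (S z.1 z.2).x‖ ^ 2 :=
    measurable_from_prod_countable_right fun k =>
      ((hf.measurable.comp (hm k)).norm.pow_const 2)
  have hint : Integrable (fun z : Fin (T + 1) × Ω => ‖gradient f (S z.1 z.2).x‖ ^ 2)
      ((PMF.uniformOfFintype (Fin (T + 1))).toMeasure.prod P) :=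
    (integrable_prod_iff hmeas.aestronglyMeasurable).2
      ⟨ae_of_all _ fun k => hi k, Integrable.of_finite⟩
  refine ⟨hint, ?_⟩
  rw [integral_prod _ hint, PMF.integral_eq_sum]
  refine le_trans (le_of_eq ?_) h
  rw [Finset.sum_range, Finset.mul_sum]
  refine Finset.sum_congr rfl fun k _ => ?_
  rw [PMF.uniformOfFintype_apply, Fintype.card_fin, ENNReal.toReal_inv, ENNReal.toReal_natCast,
    smul_eq_mul, one_div]

end Stationary

/-! ### Initial errors of minibatch estimators. -/

section Minibatch

variable {Ω Ξ Θ : Type*} {n d b : ℕ} [MeasurableSpace Ξ] [MeasurableSpace Θ]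
  [mΩ : MeasurableSpace Ω] {N : Noise Ω Ξ Θ n d b} {P : Measure Ω} [IsProbabilityMeasure P]
  {D : Fin n → Measure Ξ} {ps p ωs ω : ℝ}
  {F : Fin n → Vec d → ℝ} {L : ℝ} {Li : Fin n → ℝ} {LA LB fstar σ : ℝ}
  {G : Fin n → Vec d → Ξ → Vec d} {x0 : Vec d} {γ μ ν ε : ℝ} {B : ℕ}
  {ξ0 : Fin n → Fin B → Ω → Ξ}

/-- The oracle estimates at the constant point x⁰. The index type covers one worker or all workers;
in the second case independence across workers gives the extra 1/n. -/
lemma IsMinibatchInit.sum_error_sq_le (h : IsMinibatchInit N.v0 P D G x0 B ξ0)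
    (hA : Assumptions F L Li LA LB fstar σ D G) {J : Type*} [Fintype J] {ι : J → Fin n × Fin B}
    (hι : Function.Injective ι) (a : ℝ) :
    ∫ z, ‖a • ∑ j, (G (ι j).1 x0 (ξ0 (ι j).1 (ι j).2 z) - gradient (F (ι j).1) x0)‖ ^ 2 ∂P
      ≤ a ^ 2 * (Fintype.card J * σ ^ 2) := by
  have hO : ∀ j, IsOracle (P.map (ξ0 (ι j).1 (ι j).2)) (G (ι j).1) (gradient (F (ι j).1))
      (fun _ => σ ^ 2) := fun j => by
    rw [h.law]
    exact (hA.stochastic _).isOracle (hA.smooth_worker _)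
  have hm : ∀ j, Measurable (ξ0 (ι j).1 (ι j).2) := fun j => h.measurable _ _
  have he := fun j => (hO j).error_sq (X := fun _ => x0) measurable_const (hm j)
    (indepFun_const_left _ _) (integrable_const _)
  have h1 := integral_norm_add_smul_sum_sq_le (U := fun _ => (0 : Vec d)) (v := fun _ : J => σ ^ 2)
    a (MemLp.zero' (p := 2) (μ := P)) (fun j => (he j).1) (fun j => by simp) (fun i j hij => ?_)
    (fun j => by simpa using (he j).2)
  · simpa using h1
  · have hK : Measurable fun y : Ξ => (G (ι i).1 x0 y - gradient (F (ι i).1) x0, x0) :=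
      ((((hA.stochastic _).measurable.comp (measurable_const.prodMk measurable_id)).sub
        measurable_const).prodMk measurable_const)
    have hind := (h.independent.indepFun (fun e => hij (hι e))).comp hK measurable_id
    exact (hO j).integral_inner_error measurable_const ((measurable_fst.comp hK).comp (hm i))
      (hm j) hind (integrable_const _) (he i).1

local notation "S" => iterate N G x0 γ μ ν

lemma IsMinibatchInit.vErr_le (h : IsMinibatchInit N.v0 P D G x0 B ξ0) (hn : 1 ≤ n) (hB : 1 ≤ B)
    (hA : Assumptions F L Li LA LB fstar σ D G) : vErr F P (S 0) ≤ σ ^ 2 / B := by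
  have hB' : (B : ℝ) ≠ 0 := by positivity
  refine (avg_mono (v := fun _ => σ ^ 2 / B) fun i => ?_).trans (le_of_eq (avg_const hn _))
  have h1 := h.sum_error_sq_le hA (J := Fin B) (ι := fun r => (i, r))
    (fun _ _ hij => (Prod.ext_iff.1 hij).2) (1 / (B : ℝ))
  have e : (1 / (B : ℝ)) ^ 2 * ((Fintype.card (Fin B) : ℝ) * σ ^ 2) = σ ^ 2 / B := by
    rw [Fintype.card_fin]
    field_simp
  rw [e] at h1
  refine le_trans (le_of_eq (integral_congr_ae (ae_of_all _ fun z => ?_))) h1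
  simp only [iterate, State.initial, h.v0_eq, Finset.sum_sub_distrib, Finset.sum_const,
    Finset.card_univ, Fintype.card_fin]
  congr 2
  rw [smul_sub, ← Nat.cast_smul_eq_nsmul ℝ, smul_smul, one_div_mul_cancel hB', one_smul]

lemma IsMinibatchInit.vMeanErr_le (h : IsMinibatchInit N.v0 P D G x0 B ξ0) (hn : 1 ≤ n)
    (hB : 1 ≤ B) (hA : Assumptions F L Li LA LB fstar σ D G) :
    vMeanErr F P (S 0) ≤ σ ^ 2 / (n * B) := by
  have hB' : (B : ℝ) ≠ 0 := by positivity
  have hn' : (n : ℝ) ≠ 0 := by positivity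
  have h1 := h.sum_error_sq_le hA (J := Fin n × Fin B) (ι := fun j => j)
    (fun _ _ hij => hij) (1 / (n * B : ℝ))
  have e : (1 / (n * B : ℝ)) ^ 2 * ((Fintype.card (Fin n × Fin B) : ℝ) * σ ^ 2)
      = σ ^ 2 / (n * B) := by
    rw [Fintype.card_prod, Fintype.card_fin, Fintype.card_fin, Nat.cast_mul]
    field_simp
  rw [e] at h1
  refine le_trans (le_of_eq (integral_congr_ae (ae_of_all _ fun z => ?_))) h1
  simp only [iterate, State.initial, h.v0_eq, hA.gradient_objective, Fintype.sum_prod_type,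
    Finset.sum_sub_distrib, Finset.sum_const, Finset.card_univ, Fintype.card_fin]
  congr 2
  rw [avg_smul]
  simp only [avg]
  rw [smul_sub, ← Finset.smul_sum, ← Nat.cast_smul_eq_nsmul ℝ, smul_smul, smul_smul]
  congr 2
  · field_simp
  · field_simp

end Minibatch

/-! ### Initial errors under the prescribed batch size. -/

section Complexity

variable {n b : ℕ} {ε σ ωs ω η β : ℝ}

/-- The persistent part of the initial error is a fixed fraction of `ε`. -/
lemma persistent_error_le (hn : 1 ≤ n) (hb : 1 ≤ b) (hε : 0 < ε) (hσ : 0 < σ) (hω : 0 ≤ ω)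
    (hη : 0 < η) (hη1 : η ≤ 1) (hβ : 0 < β)
    (hη2 : η ^ 2 * (ω * (ω + 1)) * σ ^ 2 / (n * b) ≤ ε / 36)
    (hB : b / η * (1 + σ ^ 2 / (n * ε)) ≤ β ^ 2) :
    ω / n * η * (σ ^ 2 / β) ≤ ε / 6 := by
  have hn' : (0 : ℝ) < n := by positivity
  have hb' : (0 : ℝ) < b := by positivity
  have h1 : b * (σ ^ 2 / (n * ε)) ≤ β ^ 2 := by
    refine le_trans ?_ hB
    have e1 : (b : ℝ) ≤ b / η := by
      rw [le_div_iff₀ hη]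
      exact mul_le_of_le_one_right hb'.le hη1
    have e2 : σ ^ 2 / (n * ε) ≤ 1 + σ ^ 2 / (n * ε) := by linarith
    exact mul_le_mul e1 e2 (by positivity) (by positivity)
  -- Squaring brings in β², whose lower bound bσ²/(nε) turns the expression into ε times the
  -- quantity controlled by the first entry of η.
  have h2 : (ω / n * η * (σ ^ 2 / β)) ^ 2 ≤ (ε / 6) ^ 2 := by
    calc (ω / n * η * (σ ^ 2 / β)) ^ 2 = ω ^ 2 * η ^ 2 * σ ^ 4 / n ^ 2 / β ^ 2 := by
          field_simp
      _ ≤ ω ^ 2 * η ^ 2 * σ ^ 4 / n ^ 2 / (b * (σ ^ 2 / (n * ε))) := by gcongr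
      _ = ω ^ 2 * (η ^ 2 * σ ^ 2 / (n * b)) * ε := by field_simp
      _ ≤ ω * (ω + 1) * (η ^ 2 * σ ^ 2 / (n * b)) * ε := by
          gcongr
          nlinarith
      _ = η ^ 2 * (ω * (ω + 1)) * σ ^ 2 / (n * b) * ε := by ring
      _ ≤ ε / 36 * ε := by gcongr
      _ = (ε / 6) ^ 2 := by ring
  exact (sq_le_sq₀ (by positivity) (by positivity)).1 h2

/-- The decaying part of the initial error. -/
lemma decaying_error_le (hn : 1 ≤ n) (hb : 1 ≤ b) (hε : 0 < ε) (hη : 0 < η) (hβ : 0 < β)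
    {M : ℝ} (hM : 1 / η ≤ 6 * M)
    (hB : b / η * (1 + σ ^ 2 / (n * ε)) ≤ β ^ 2) :
    1 / η * (σ ^ 2 / (n * β)) ≤ 3 * ε * √(M * (1 / b) * (1 + σ ^ 2 / (n * ε))) := by
  have hn' : (0 : ℝ) < n := by positivity
  have hb' : (0 : ℝ) < b := by positivity
  set q := 1 + σ ^ 2 / (n * ε) with hq
  have hq0 : 0 < q := by positivity
  have hM0 : 0 ≤ M := by
    have : 0 < 1 / η := by positivity
    linarith
  have hσ : σ ^ 2 / n ≤ ε * q := by
    have : ε * q = ε + σ ^ 2 / n := by rw [hq]; field_simp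
    linarith
  refine (sq_le_sq₀ (by positivity) (by positivity)).1 ?_
  rw [mul_pow (3 * ε), Real.sq_sqrt (by positivity)]
  -- One factor 1/η cancels against b/η in the bound for β², the other is at most 6M, and 6 ≤ 9 =
  -- 3².
  calc (1 / η * (σ ^ 2 / (n * β))) ^ 2 = (1 / η) ^ 2 * (σ ^ 2 / n) ^ 2 / β ^ 2 := by field_simp
    _ ≤ (1 / η) ^ 2 * (ε * q) ^ 2 / (b / η * q) := by gcongr
    _ = (1 / η) * (ε ^ 2 * q / b) := by field_simp
    _ ≤ 6 * M * (ε ^ 2 * q / b) := by gcongr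
    _ ≤ (3 * ε) ^ 2 * (M * (1 / b) * q) := by
        have e : (3 * ε) ^ 2 * (M * (1 / b) * q) = 9 * M * (ε ^ 2 * q / b) := by ring
        rw [e]
        gcongr
        norm_num

end Complexity

/-! ### Equal momentum parameters and the iteration complexity. -/

section EqualMomentum

variable {Ω Ξ Θ : Type*} {n d b : ℕ} [MeasurableSpace Ξ] [MeasurableSpace Θ]
  [mΩ : MeasurableSpace Ω] {N : Noise Ω Ξ Θ n d b} {P : Measure Ω} [IsProbabilityMeasure P]
  {D : Fin n → Measure Ξ} {ωs ω : ℝ}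
  {F : Fin n → Vec d → ℝ} {L : ℝ} {Li : Fin n → ℝ} {LA LB fstar σ : ℝ}
  {G : Fin n → Vec d → Ξ → Vec d} {x0 : Vec d} {γ ε η : ℝ} {B : ℕ}
  {ξ0 : Fin n → Fin B → Ω → Ξ}

/-- The entries of η with the factor 6 bound the two terms by (9/2)·ε/36 and 2·ε/6. The sum stays
below ε/2, which leaves room for the initial bias. -/
lemma equal_noise_le (hn : 1 ≤ n) (hb : 1 ≤ b) (hε : 0 < ε) (hω : 0 ≤ ω)
    (hη : η = eta n b ε σ ωs ω) :
    9 / 2 * (η ^ 2 * ω * σ ^ 2 / (n * (1 / (ω + 1)) * b)) + 2 * (η * σ ^ 2 / (n * b))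
      ≤ ε / 8 + ε / 3 := by
  have h1 := eta_sq_mul_le (σ := σ) (ωs := ωs) hn hb hε hω
  have h2 := eta_mul_sq_le (σ := σ) (ωs := ωs) (ω := ω) hn hb hε
  rw [← hη] at h1 h2
  have e : η ^ 2 * ω * σ ^ 2 / (n * (1 / (ω + 1)) * b)
      = η ^ 2 * (ω * (ω + 1)) * σ ^ 2 / (n * b) := by
    field_simp
  rw [e]
  linarith

lemma averageBound_equal (hn : 1 ≤ n) (hb : 1 ≤ b) (hA : Assumptions F L Li LA LB fstar σ D G)
    (hε : 0 < ε) (hγ : 0 < γ) (hωs : 0 ≤ ωs) (hω : 0 ≤ ω) (hη : η = eta n b ε σ ωs ω)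
    (hN : N.Valid P D (1 / (ωs + 1)) (1 / (ω + 1)) ωs ω)
    (hstep : γ * (6 * √(1416 * equalRate n LA LB (Lmax Li LA LB) ωs ω η)) ≤ 1) :
    γ * (Lmax Li LA LB + √(1416 * generalRate n LA LB (Lmax Li LA LB) (1 / (ωs + 1))
      (1 / (ω + 1)) η η ωs ω)) ≤ 1 ∧
    AverageBound P (objective F) (iterate N G x0 γ η η)
      (lyapunov F fstar LA LB (Lmax Li LA LB) γ (1 / (ωs + 1)) (1 / (ω + 1)) η η ω) γ ε := by
  have hη0 : 0 < η := hη ▸ eta_pos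
  have hη1 : η ≤ 1 := hη ▸ eta_le_one
  have hs := equal_step_size hn hγ hη0 hη1 hωs hω hA.similar.1 hA.similar.2.1
    (le_max_of_le_right (le_max_left _ _)) (le_max_of_le_right (le_max_right _ _))
    (hη ▸ eta_cube_mul_le hωs hω) hstep
  refine ⟨hs, averageBound hn hb hA hN hγ (by positivity) ?_ (by positivity) ?_ hη0 hη1 hη0 hη1
    hωs hω (hA.smooth_objective_Lmax hn) hs ?_⟩
  · rw [div_le_one (by positivity)]
    linarith
  · rw [div_le_one (by positivity)]
    linarith
  · have := equal_noise_le hn hb hε hω hη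
    linarith

lemma findsStationary_equal (hn : 1 ≤ n) (hb : 1 ≤ b) (hA : Assumptions F L Li LA LB fstar σ D G)
    (hε : 0 < ε) (hγ : 0 < γ) (hωs : 0 ≤ ωs) (hω : 0 ≤ ω) (hη : η = eta n b ε σ ωs ω)
    (hN : N.Valid P D (1 / (ωs + 1)) (1 / (ω + 1)) ωs ω)
    (hstep : γ * (6 * √(1416 * equalRate n LA LB (Lmax Li LA LB) ωs ω η)) ≤ 1)
    (hB : √(b / η * (1 + σ ^ 2 / (n * ε))) ≤ B)
    (hinit : IsMinibatchInit N.v0 P D G x0 B ξ0) {T : ℕ}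
    (hT : 200 * ((objective F x0 - fstar) / (γ * ε)
      + √(rateMax n b ε σ ωs ω * (1 / b) * (1 + σ ^ 2 / (n * ε)))) ≤ (T : ℝ) + 1) :
    FindsStationary P (objective F) (iterate N G x0 γ η η) T ε := by
  have hη0 : 0 < η := hη ▸ eta_pos
  have hη1 : η ≤ 1 := hη ▸ eta_le_one
  have hn' : (0 : ℝ) < n := by positivity
  have hb' : (0 : ℝ) < b := by positivity
  have hs := (averageBound_equal (x0 := x0) hn hb hA hε hγ hωs hω hη hN hstep).1
  have had := isAdapted (x0 := x0) (γ := γ) (μ := η) (ν := η) hA hN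
  have hβ : (0 : ℝ) < B := lt_of_lt_of_le (Real.sqrt_pos.2 (by positivity)) hB
  have hB1 : 1 ≤ B := by exact_mod_cast hβ
  have hB2 : b / η * (1 + σ ^ 2 / (n * ε)) ≤ (B : ℝ) ^ 2 :=
    (Real.sqrt_le_left hβ.le).1 hB
  have hp1 : 1 / (ω + 1) ≤ 1 := by
    rw [div_le_one (by positivity)]
    linarith
  have hps1 : 1 / (ωs + 1) ≤ 1 := by
    rw [div_le_one (by positivity)]
    linarith
  have hsum := (sum_gradient_le (x0 := x0) hn hb hA hN hγ (by positivity) hps1 (by positivity) hp1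
    hη0 hη1 hη0 hη1 hωs hω (hA.smooth_objective_Lmax hn) hs (T + 1)).2
  have hV := hinit.vErr_le (γ := γ) (μ := η) (ν := η) hn hB1 hA
  have hVm := hinit.vMeanErr_le (γ := γ) (μ := η) (ν := η) hn hB1 hA
  have hpers := persistent_error_le hn hb hε hA.sigma_pos hω hη0 hη1 hβ
    (hη ▸ eta_sq_mul_le hn hb hε hω) hB2
  have hdec := decaying_error_le (M := rateMax n b ε σ ωs ω) hn hb hε hη0 hβ
    (hη ▸ one_div_eta_le hωs hω) hB2
  have hnoise := equal_noise_le hn hb hε hω hη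
  refine findsStationary_of_average_le hA.smooth.continuous_gradient
    (fun k => (had k).x.measurable.mono (hN.gen_le _) le_rfl)
    (fun k => ((had k).x.grad hA.smooth).sq) ?_
  set V := vErr F P (iterate N G x0 γ η η 0)
  set Vm := vMeanErr F P (iterate N G x0 γ η η 0)
  have hV' : ω / n * η * V ≤ ε / 6 :=
    (mul_le_mul_of_nonneg_left hV (by positivity)).trans hpers
  have hVm' : 1 / η * Vm ≤ 3 * ε * √(rateMax n b ε σ ωs ω * (1 / b) * (1 + σ ^ 2 / (n * ε))) :=
    (mul_le_mul_of_nonneg_left hVm (by positivity)).trans hdec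
  set W := √(rateMax n b ε σ ωs ω * (1 / b) * (1 + σ ^ 2 / (n * ε)))
  have hW : 0 ≤ W := Real.sqrt_nonneg _
  have hΔ : 0 ≤ objective F x0 - fstar := sub_nonneg.2 (hA.lower_bound x0)
  have hK : (0 : ℝ) < ((T + 1 : ℕ) : ℝ) := by positivity
  have hK' : 200 * ((objective F x0 - fstar) / (γ * ε) + W) ≤ ((T + 1 : ℕ) : ℝ) := by
    rw [Nat.cast_succ]
    exact hT
  -- The budget: the persistent initial error costs 2·(5/4)·ε/6 = 5ε/12 and the noise ε/8 + ε/3,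
  -- together 7ε/8. The decaying part must fit into the remaining ε/8.
  have h1 := average_le_of_sum_le (R := objective F x0 - fstar + γ * (1 / η * Vm))
    (T := 5 / 4 * (ω / n) * η * V + 9 / 4 * ((ω / n) / (1 / (ω + 1))) * (η ^ 2 * σ ^ 2 / b)
      + 1 / η * (η ^ 2 * σ ^ 2 / (n * b))) (ε := 5 / 12 * ε + (ε / 8 + ε / 3)) hγ
    (Nat.succ_le_succ (Nat.zero_le T)) (hsum.trans (le_of_eq (by ring))) (by
      have e : 2 * (9 / 4 * ((ω / n) / (1 / (ω + 1))) * (η ^ 2 * σ ^ 2 / b)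
          + 1 / η * (η ^ 2 * σ ^ 2 / (n * b)))
          = 9 / 2 * (η ^ 2 * ω * σ ^ 2 / (n * (1 / (ω + 1)) * b)) + 2 * (η * σ ^ 2 / (n * b)) := by
        field_simp
        ring
      linarith)
  refine h1.trans ?_
  -- In units of γε the numerator is at most 2Δ/(γε) + 6W, hence at most 6R, while T + 1 ≥ 200R.
  have h2 : 2 * (objective F x0 - fstar + γ * (1 / η * Vm)) / (γ * ((T + 1 : ℕ) : ℝ))
      ≤ 6 / 200 * ε := by
    rw [div_le_iff₀ (by positivity)]
    have e1 : objective F x0 - fstar = (objective F x0 - fstar) / (γ * ε) * (γ * ε) := by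
      field_simp
    have h3 := mul_le_mul_of_nonneg_left hVm' hγ.le
    have h4 := mul_le_mul_of_nonneg_right hK' (by positivity : 0 ≤ 6 / 200 * (γ * ε))
    have h5 : 0 ≤ (objective F x0 - fstar) / (γ * ε) * (γ * ε) := by positivity
    rw [e1]
    rw [e1] at h4
    have e2 : (objective F x0 - fstar) / (γ * ε) * (γ * ε) / (γ * ε) * (γ * ε)
      = (objective F x0 - fstar) / (γ * ε) * (γ * ε) := by field_simp
    linarith
  linarith

end EqualMomentum

end M4

theorem mainTheorem4 :
    ∃ c : ℝ, 0 < c ∧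
    ∀ (Ω : Type u) (Ξ : Type v) (Θ : Type w)
      [MeasurableSpace Ω] [MeasurableSpace Ξ] [MeasurableSpace Θ]
      (P : Measure Ω) [IsProbabilityMeasure P]
      (n d b : ℕ) (_ : 1 ≤ n) (_ : 1 ≤ b)
      (F : Fin n → M4.Vec d → ℝ) (L : ℝ) (Li : Fin n → ℝ) (LA LB fstar σ : ℝ)
      (D : Fin n → Measure Ξ) (G : Fin n → M4.Vec d → Ξ → M4.Vec d)
      (_ : M4.Assumptions F L Li LA LB fstar σ D G)
      (ωs ω : ℝ) (_ : 0 ≤ ωs) (_ : 0 ≤ ω)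
      (ε : ℝ) (_ : 0 < ε)
      (N : M4.Noise Ω Ξ Θ n d b) (x0 : M4.Vec d) (γ : ℝ) (_ : 0 < γ),
      -- general parameters
      (∀ ps p ν μ : ℝ, 0 < ps → ps ≤ 1 → 0 < p → p ≤ 1 → 0 < ν → ν ≤ 1 → 0 < μ → μ ≤ 1 →
        N.Valid P D ps p ωs ω →
        γ * (L + √(1416 * M4.generalRate n LA LB (M4.Lmax Li LA LB) ps p ν μ ωs ω)) ≤ 1 →
        9 * ν ^ 2 * ω * σ ^ 2 / (n * p * b) + 3 * ν * σ ^ 2 / (n * b) ≤ ε / 2 →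
        M4.AverageBound P (M4.objective F) (M4.iterate N G x0 γ μ ν)
          (M4.lyapunov F fstar LA LB (M4.Lmax Li LA LB) γ ps p ν μ ω) γ ε) ∧
      -- equal momentum coefficients
      (∀ η ps p : ℝ, η = M4.eta n b ε σ ωs ω → ps = 1 / (ωs + 1) → p = 1 / (ω + 1) →
        N.Valid P D ps p ωs ω →
        γ * (6 * √(1416 * M4.equalRate n LA LB (M4.Lmax Li LA LB) ωs ω η)) ≤ 1 →
        M4.AverageBound P (M4.objective F) (M4.iterate N G x0 γ η η)
          (M4.lyapunov F fstar LA LB (M4.Lmax Li LA LB) γ ps p η η ω) γ ε ∧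
        -- iteration complexity with a minibatch initialization
        ∀ (binit : ℕ) (ξ0 : Fin n → Fin binit → Ω → Ξ) (R : ℝ),
          √(b / η * (1 + σ ^ 2 / (n * ε))) ≤ binit →
          M4.IsMinibatchInit N.v0 P D G x0 binit ξ0 →
          R = (M4.objective F x0 - fstar) / (γ * ε)
            + √(M4.rateMax n b ε σ ωs ω * (1 / b) * (1 + σ ^ 2 / (n * ε))) →
          (∃ T : ℕ, (T : ℝ) ≤ c * R ∧
            M4.FindsStationary P (M4.objective F) (M4.iterate N G x0 γ η η) T ε) ∧
          ∀ T : ℕ, c * R ≤ (T : ℝ) + 1 →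
            M4.FindsStationary P (M4.objective F) (M4.iterate N G x0 γ η η) T ε) := by
  refine ⟨200, by norm_num, ?_⟩
  intro Ω Ξ Θ _ _ _ P _ n d b hn hb F L Li LA LB fstar σ D G hA ωs ω hωs hω ε hε N x0 γ hγ
  refine ⟨?_, ?_⟩
  · intro ps p ν μ hps hps1 hp hp1 hν hν1 hμ hμ1 hN hstep hnoise
    refine M4.averageBound hn hb hA hN hγ hps hps1 hp hp1 hν hν1 hμ hμ1 hωs hω hA.smooth hstep ?_
    have h1 : 0 ≤ ν ^ 2 * ω * σ ^ 2 / (n * p * b) := by positivity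
    have h2 : 0 ≤ ν * σ ^ 2 / (n * b) := by positivity
    have e1 : 9 * ν ^ 2 * ω * σ ^ 2 / (n * p * b) = 9 * (ν ^ 2 * ω * σ ^ 2 / (n * p * b)) := by ring
    have e2 : 3 * ν * σ ^ 2 / (n * b) = 3 * (ν * σ ^ 2 / (n * b)) := by ring
    linarith
  · rintro η ps p hη rfl rfl hN hstep
    refine ⟨(M4.averageBound_equal hn hb hA hε hγ hωs hω hη hN hstep).2, ?_⟩
    rintro binit ξ0 R hB hinit rfl
    have key : ∀ T : ℕ, _ → M4.FindsStationary P (M4.objective F) (M4.iterate N G x0 γ η η) T ε :=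
      fun T hT => M4.findsStationary_equal hn hb hA hε hγ hωs hω hη hN hstep hB hinit hT
    -- The floor T of cR satisfies both T ≤ cR and cR ≤ T + 1, the latter being the number of
    -- iterates x⁰, …, x^T.
    refine ⟨⟨⌊200 * ((M4.objective F x0 - fstar) / (γ * ε)
      + √(M4.rateMax n b ε σ ωs ω * (1 / b) * (1 + σ ^ 2 / (n * ε))))⌋₊, Nat.floor_le ?_,
      key _ (Nat.lt_floor_add_one _).le⟩, key⟩
    have hΔ : 0 ≤ M4.objective F x0 - fstar := sub_nonneg.2 (hA.lower_bound x0)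
    positivity
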